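/- **Setting.** Let $S,A,B$ be Borel spaces (Borel subsets of Polish spaces). Consider the two-person zero-sum continuous-time Markov game with state space $S$, nonempty Borel admissible action sets $A(x)\subseteq A$, $B(x)\subseteq B$ ($x\in S$) such that $K=\{(x,a,b): a\in A(x),\,b\in B(x)\}$ is Borel, Borel payoff rate $r$ on $K$, Borel terminal reward $g$ on $S$, and transition rates $q(dy|x,a,b)$, which form a Borel signed kernel on $S$ given $K$ with $q(D|x,a,b)\ge 0$ if $x\notin D$, $q(S|x,a,b)=0$ and $q^*(x)=\sup_{a\in A(x),b\in B(x)}\bigl(-q(\{x\}|x,a,b)\bigr)<\infty$. Fix $T>0$ and $\theta>0$. Let $\Pi_i$ be the set of randomized history-dependent policies of player $i$ (the action distribution depends measurably on the past states and sojourn times and on the time elapsed since the last jump), and $\Pi_i^m\subseteq\Pi_i$ the set of Markov policies $\pi_i(\cdot|x,t)$; policies are concentrated on the admissible actions. Let $x_t$ be the controlled jump process. For $(\pi_1,\pi_2)\in\Pi_1\times\Pi_2$ put $$J(\pi_1,\pi_2,0,x)=\mathbb E_x^{\pi_1,\pi_2}\Bigl[e^{\theta\int_0^T\int\!\int r(x_s,a,b)\,\pi_1(da|\omega,s)\,\pi_2(db|\omega,s)\,ds+\theta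 g(x_T)}\Bigr],$$ and for Markov policies let $J(\pi_1,\pi_2,t,x)$ be the same expectation with $\int_t^T$ for the process that is in state $x$ at time $t$. For probability measures $\phi\in P(A(x))$, $\psi\in P(B(x))$ and bounded Borel $v$ on $[0,T]\times S$ put $$c_v(t,x,\phi,\psi)=\int\!\!\int\Bigl[\theta r(x,a,b)v(t,x)+\int_S v(t,y)\,q(dy|x,a,b)\Bigr]\phi(da)\,\psi(db),$$ $$\Gamma v(t,x)=e^{\theta g(x)}+\int_t^T\sup_{\phi\in P(A(x))}\inf_{\psi\in P(B(x))}c_v(s,x,\phi,\psi)\,ds .$$ **Assumptions.** For each $x\in S$, $A(x)$ and $B(x)$ are compact, and $r(x,\cdot,\cdot)$ and $q(D|x,\cdot,\cdot)$ (for every Borel $D\subseteq S$) are continuous on $A(x)\times B(x)$. The numbers $\|q\|=\sup_x q^*(x)$, $\|r\|=\sup_K|r|$, $\|g\|=\sup_x|g(x)|$ are finite. Write $L=\theta\|r\|+2\|q\|$ and $\|u\|=\sup_{[0,T]\times S}|u|$. Let $v_0$ be any bounded Borel function on $[0,T]\times S$, and $v_{n+1}=\Gamma v_n$ for $n\ge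 0$. For $\varepsilon>0$ put $$\delta_\varepsilon=\frac{\varepsilon}{2e^{LT}\bigl(1+\frac{2\|q\|}{\theta\|r\|}\bigr)},$$ where the inner fraction is read as $0$ if $\|r\|=0$. **Theorem 5.1.** The game has a value function: there is a function $\varphi:[0,T]\times S\to[0,\infty)$ with $$\varphi(t,x)=\sup_{\pi_1\in\Pi_1^m}\inf_{\pi_2\in\Pi_2^m}J(\pi_1,\pi_2,t,x)=\inf_{\pi_2\in\Pi_2^m}\sup_{\pi_1\in\Pi_1^m}J(\pi_1,\pi_2,t,x)$$ for all $(t,x)\in[0,T]\times S$, and $$\varphi(0,x)=\sup_{\pi_1\in\Pi_1}\inf_{\pi_2\in\Pi_2}J(\pi_1,\pi_2,0,x)=\inf_{\pi_2\in\Pi_2}\sup_{\pi_1\in\Pi_1}J(\pi_1,\pi_2,0,x)$$ for all $x\in S$. Moreover: (a) $\|v_1-v_0\|<\infty$, and for all $n\ge0$ and $(t,x)\in[0,T]\times S$, $$|v_{n+1}(t,x)-v_n(t,x)|\le\frac{L^n(T-t)^n}{n!}\|v_1-v_0\|,\qquad \|\varphi-v_{n+1}\|\le\frac{L^nT^n}{n!}e^{LT}\|v_1-v_0\|.$$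 Hence $v_n\to\varphi$ uniformly on $[0,T]\times S$. For every $\varepsilon>0$ there is $N_1>0$ such that $\|v_{n+1}-v_n\|<\delta_\varepsilon$ and $\|\varphi-v_{n+1}\|<\varepsilon/2$ for all $n\ge N_1$. Moreover, for every $\varepsilon>0$ and every $n\ge0$ with $\|v_{n+1}-v_n\|<\delta_\varepsilon$ one has $\|\varphi-v_{n+1}\|<\varepsilon/2$. (b) For every $n\ge0$ there are Markov policies $\phi_n\in\Pi_1^m$, $\psi_n\in\Pi_2^m$ that realise the sup-inf at stage $n$: for all $(t,x)\in[0,T]\times S$ the pair $(\phi_n(\cdot|x,t),\psi_n(\cdot|x,t))$ is a saddle point of $c_{v_n}(t,x,\cdot,\cdot)$ on $P(A(x))\times P(B(x))$, with value $\sup_\phi\inf_\psi c_{v_n}(t,x,\phi,\psi)$. If $\varepsilon>0$ and $\|v_{n+1}-v_n\|<\delta_\varepsilon$ (in particular if $n\ge N_1$), then for any such pair $J(\phi_n,\psi_n,\cdot,\cdot)$ is finite on $[0,T]\times S$, $$\sup_{(t,x)\in[0,T]\times S}|J(\phi_n,\psi_n,t,x)-\varphi(t,x)|<\varepsilon,$$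 and $(\phi_n,\psi_n)$ is an $\varepsilon$-Nash equilibrium: for all $x\in S$, $\pi_1\in\Pi_1$, $\pi_2\in\Pi_2$, $$J(\pi_1,\psi_n,0,x)-\varepsilon\le J(\phi_n,\psi_n,0,x)\le J(\phi_n,\pi_2,0,x)+\varepsilon .$$ -/

import Mathlib

open MeasureTheory ProbabilityTheory Set Filter Topology
open scoped ENNReal NNReal

namespace RiskGame

/-! ## The game model -/

/-- A two-person zero-sum continuous-time Markov game: admissible action sets `A(x)`, `B(x)`,
payoff rate `r`, transition rates `q(dy|x,a,b)` (signed, conservative, stable) and terminal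
reward `g`.  The data `r x a b`, `q x a b` only matter for `a ∈ A(x)`, `b ∈ B(x)`. -/
structure Model (S A B : Type*) [MeasurableSpace S] [MeasurableSpace A] [MeasurableSpace B] where
  actA : S → Set A
  actB : S → Set B
  r : S → A → B → ℝ
  q : S → A → B → SignedMeasure S
  g : S → ℝ
  nonempty_actA : ∀ x, (actA x).Nonempty
  nonempty_actB : ∀ x, (actB x).Nonempty
  measurableSet_actA : ∀ x, MeasurableSet (actA x)
  measurableSet_actB : ∀ x, MeasurableSet (actB x)
  measurableSet_graph : MeasurableSet {p : S × A × B | p.2.1 ∈ actA p.1 ∧ p.2.2 ∈ actB p.1}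
  measurable_r : Measurable
    fun p : {p : S × A × B | p.2.1 ∈ actA p.1 ∧ p.2.2 ∈ actB p.1} => r p.1.1 p.1.2.1 p.1.2.2
  measurable_q : ∀ D, MeasurableSet D → Measurable
    fun p : {p : S × A × B | p.2.1 ∈ actA p.1 ∧ p.2.2 ∈ actB p.1} => q p.1.1 p.1.2.1 p.1.2.2 D
  q_nonneg : ∀ x, ∀ a ∈ actA x, ∀ b ∈ actB x, ∀ D, MeasurableSet D → x ∉ D → 0 ≤ q x a b D
  q_conservative : ∀ x, ∀ a ∈ actA x, ∀ b ∈ actB x, q x a b univ = 0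
  q_stable : ∀ x, BddAbove {z | ∃ a ∈ actA x, ∃ b ∈ actB x, z = -q x a b {x}}
  measurable_g : Measurable g

section Basic

variable {S A B : Type*} [MeasurableSpace S] [MeasurableSpace A] [MeasurableSpace B]

/-- The set `K` of admissible state-action triples. -/
def Model.graph (G : Model S A B) : Set (S × A × B) :=
  {p | p.2.1 ∈ G.actA p.1 ∧ p.2.2 ∈ G.actB p.1}

/-- `q*(x) = sup_{a ∈ A(x), b ∈ B(x)} -q({x}|x,a,b)`. -/
noncomputable def Model.qStar (G : Model S A B) (x : S) : ℝ :=
  sSup {z | ∃ a ∈ G.actA x, ∃ b ∈ G.actB x, z = -G.q x a b {x}}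

/-- `‖q‖ = sup_x q*(x)`. -/
noncomputable def Model.qNorm (G : Model S A B) : ℝ := ⨆ x, G.qStar x

/-- `‖r‖ = sup_{(x,a,b) ∈ K} |r(x,a,b)|`. -/
noncomputable def Model.rNorm (G : Model S A B) : ℝ :=
  ⨆ p : G.graph, |G.r p.1.1 p.1.2.1 p.1.2.2|

/-- `‖q‖`, `‖r‖` and `‖g‖` are finite. -/
def Model.IsBounded (G : Model S A B) : Prop :=
  BddAbove (range G.qStar) ∧
  BddAbove (range fun p : G.graph => |G.r p.1.1 p.1.2.1 p.1.2.2|) ∧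
  BddAbove (range fun x => |G.g x|)

/-- Compactness of the action sets and continuity of `q(D|x,a,b)` and `r(x,a,b)` in the
actions. -/
def Model.CompactContinuous [TopologicalSpace A] [TopologicalSpace B] (G : Model S A B) : Prop :=
  (∀ x, IsCompact (G.actA x) ∧ IsCompact (G.actB x)) ∧
  (∀ x, ∀ D, MeasurableSet D →
    ContinuousOn (fun p : A × B => G.q x p.1 p.2 D) (G.actA x ×ˢ G.actB x)) ∧
  (∀ x, ContinuousOn (fun p : A × B => G.r x p.1 p.2) (G.actA x ×ˢ G.actB x))

/-- For an admissible triple, `q(·|x,a,b)` is nonnegative off the state `x`. -/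
theorem Model.q_restrict_nonneg [MeasurableSingletonClass S] (G : Model S A B) (p : S × A × B)
    (hp : p ∈ G.graph) :
    VectorMeasure.restrict 0 ({p.1}ᶜ : Set S) ≤
      VectorMeasure.restrict (G.q p.1 p.2.1 p.2.2) ({p.1}ᶜ : Set S) := by
  refine (VectorMeasure.restrict_le_restrict_iff _ _ (measurableSet_singleton _).compl).2 ?_
  intro D hD hsub
  simpa using G.q_nonneg p.1 p.2.1 hp.1 p.2.2 hp.2 D hD (fun h => hsub h rfl)

/-- Measurability of sections: `(x,a,b) ↦ q(E_x|x,a,b)` is measurable on `K`. -/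
theorem Model.measurable_q_section (G : Model S A B) {E : Set (S × S)} (hE : MeasurableSet E) :
    Measurable fun p : G.graph => G.q p.1.1 p.1.2.1 p.1.2.2 (Prod.mk p.1.1 ⁻¹' E) := by
  induction E, hE using MeasurableSpace.induction_on_inter generateFrom_prod.symm isPiSystem_prod with
  | empty => simp
  | basic E hE =>
    obtain ⟨E₁, h₁, E₂, h₂, rfl⟩ := hE
    have hm : Measurable fun p : G.graph =>
        E₁.indicator (fun _ => (1 : ℝ)) p.1.1 * G.q p.1.1 p.1.2.1 p.1.2.2 E₂ :=
      (((measurable_const.indicator h₁).comp measurable_fst).comp measurable_subtype_coe).mul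
        (G.measurable_q E₂ h₂)
    convert hm using 2 with p
    by_cases hx : p.1.1 ∈ E₁
    · simp [Set.mk_preimage_prod_right hx, hx]
    · simp [Set.mk_preimage_prod_right_eq_empty hx, hx]
  | compl E hE ih =>
    have hm : Measurable fun p : G.graph => G.q p.1.1 p.1.2.1 p.1.2.2 univ -
        G.q p.1.1 p.1.2.1 p.1.2.2 (Prod.mk p.1.1 ⁻¹' E) :=
      (G.measurable_q univ MeasurableSet.univ).sub ih
    convert hm using 2 with p
    have := VectorMeasure.of_add_of_sdiff (v := G.q p.1.1 p.1.2.1 p.1.2.2)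
      (measurable_prodMk_left (x := p.1.1) hE) MeasurableSet.univ (subset_univ _)
    rw [Set.preimage_compl, Set.compl_eq_univ_sdiff]
    linarith
  | iUnion f hd hf ih =>
    have hs : ∀ p : G.graph, HasSum
        (fun i => G.q p.1.1 p.1.2.1 p.1.2.2 (Prod.mk p.1.1 ⁻¹' f i))
        (G.q p.1.1 p.1.2.1 p.1.2.2 (Prod.mk p.1.1 ⁻¹' ⋃ i, f i)) := by
      intro p
      rw [Set.preimage_iUnion]
      exact (G.q p.1.1 p.1.2.1 p.1.2.2).m_iUnion (fun i => measurable_prodMk_left (hf i))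
        (fun i j hij => (hd hij).preimage _)
    exact measurable_of_tendsto_metrizable (fun n => Finset.measurable_sum _ fun i _ => ih i)
      (tendsto_pi_nhds.2 fun p => (hs p).tendsto_sum_nat)

open Classical in
/-- The jump-rate kernel `D ↦ q(D \ {x}|x,a,b)` on `K`, a nonnegative measure; it is extended by
`0` outside `K`. -/
noncomputable def Model.jumpKernel [StandardBorelSpace S] (G : Model S A B) :
    Kernel (S × A × B) S where
  toFun p := if hp : p ∈ G.graph then
      (G.q p.1 p.2.1 p.2.2).toMeasureOfZeroLE {p.1}ᶜ (measurableSet_singleton _).compl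
        (G.q_restrict_nonneg p hp)
    else 0
  measurable' := by
    refine Measurable.dite (s := G.graph) (f := fun p : G.graph =>
      (G.q p.1.1 p.1.2.1 p.1.2.2).toMeasureOfZeroLE {p.1.1}ᶜ (measurableSet_singleton _).compl
        (G.q_restrict_nonneg p.1 p.2)) (g := fun _ => 0) ?_ measurable_const G.measurableSet_graph
    refine Measure.measurable_of_measurable_coe _ fun D hD => ?_
    have h := G.measurable_q_section (E := (diagonal S)ᶜ ∩ Prod.snd ⁻¹' D)
      (measurableSet_diagonal.compl.inter (measurable_snd hD))
    have h2 := h.ennreal_ofReal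
    convert h2 using 2 with p
    rw [SignedMeasure.toMeasureOfZeroLE_apply _ _ _ hD]
    have : (Prod.mk p.1.1 ⁻¹' ((diagonal S)ᶜ ∩ Prod.snd ⁻¹' D)) = {p.1.1}ᶜ ∩ D := by
      ext y; simp [eq_comm]
    rw [this, ENNReal.ofReal, Real.toNNReal_of_nonneg]

open Classical in
theorem Model.jumpKernel_apply [StandardBorelSpace S] (G : Model S A B) {x : S} {a : A} {b : B}
    (ha : a ∈ G.actA x) (hb : b ∈ G.actB x) {D : Set S} (hD : MeasurableSet D) :
    G.jumpKernel (x, a, b) D = ENNReal.ofReal (G.q x a b ({x}ᶜ ∩ D)) := by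
  have hp : (x, a, b) ∈ G.graph := ⟨ha, hb⟩
  change (if hp : (x, a, b) ∈ G.graph then
      (G.q x a b).toMeasureOfZeroLE {x}ᶜ (measurableSet_singleton _).compl
        (G.q_restrict_nonneg (x, a, b) hp) else 0) D = _
  rw [dif_pos hp, SignedMeasure.toMeasureOfZeroLE_apply _ _ _ hD, ENNReal.ofReal,
    Real.toNNReal_of_nonneg]

open Classical in
theorem Model.jumpKernel_univ_le [StandardBorelSpace S] (G : Model S A B) (p : S × A × B) :
    G.jumpKernel p univ ≤ ENNReal.ofReal (G.qStar p.1) := by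
  obtain ⟨x, a, b⟩ := p
  by_cases hp : (x, a, b) ∈ G.graph
  · rw [G.jumpKernel_apply hp.1 hp.2 MeasurableSet.univ]
    refine ENNReal.ofReal_le_ofReal ?_
    have := VectorMeasure.of_add_of_sdiff (v := G.q x a b)
      (measurableSet_singleton x) MeasurableSet.univ (subset_univ _)
    rw [G.q_conservative x a hp.1 b hp.2, ← Set.compl_eq_univ_sdiff] at this
    rw [inter_univ]
    refine le_trans ?_ (le_csSup (G.q_stable x) ⟨a, hp.1, b, hp.2, rfl⟩)
    linarith
  · change (if hp : (x, a, b) ∈ G.graph then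
      (G.q x a b).toMeasureOfZeroLE {x}ᶜ (measurableSet_singleton _).compl
        (G.q_restrict_nonneg (x, a, b) hp) else 0) univ ≤ _
    simp [hp]

/-- A kernel all of whose values are finite measures is s-finite. -/
theorem isSFiniteKernel_of_lt_top {X Y : Type*} [MeasurableSpace X] [MeasurableSpace Y]
    (κ : Kernel X Y) (h : ∀ x, κ x univ < ∞) : IsSFiniteKernel κ := by
  have hmeas : Measurable fun x => κ x univ := κ.measurable_coe MeasurableSet.univ
  have hset : ∀ n : ℕ, MeasurableSet {x | ⌊(κ x univ).toReal⌋₊ = n} := fun n =>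
    (Nat.measurable_floor.comp hmeas.ennreal_toReal) (measurableSet_singleton n)
  classical
  refine ⟨⟨fun n => Kernel.piecewise (hset n) κ 0, fun n => ?_, ?_⟩⟩
  · refine ⟨⟨(n : ℝ≥0∞) + 1, by simp, fun x => ?_⟩⟩
    rw [Kernel.piecewise_apply]
    split_ifs with hx
    · rw [← ENNReal.ofReal_toReal (h x).ne]
      have h1 : (κ x univ).toReal ≤ (n : ℝ) + 1 := by
        have := Nat.lt_floor_add_one (κ x univ).toReal
        rw [show ⌊(κ x univ).toReal⌋₊ = n from hx] at this
        exact this.le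
      calc ENNReal.ofReal (κ x univ).toReal ≤ ENNReal.ofReal ((n : ℝ) + 1) :=
            ENNReal.ofReal_le_ofReal h1
        _ = (n : ℝ≥0∞) + 1 := by
            rw [ENNReal.ofReal_add (by positivity) (by norm_num)]; simp
    · simp
  · ext x s hs
    rw [Kernel.sum_apply' _ _ hs, tsum_eq_single ⌊(κ x univ).toReal⌋₊]
    · simp [Kernel.piecewise_apply]
    · intro n hn
      rw [Kernel.piecewise_apply, if_neg (show x ∉ {x | ⌊(κ x univ).toReal⌋₊ = n} from fun hx => hn (Eq.symm hx))]
      simp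

instance Model.instIsSFiniteKernelJump [StandardBorelSpace S] (G : Model S A B) :
    IsSFiniteKernel G.jumpKernel :=
  isSFiniteKernel_of_lt_top _ fun p => (G.jumpKernel_univ_le p).trans_lt ENNReal.ofReal_lt_top

/-! ## Histories, policies and the controlled jump process -/

/-- The sample space of the jump process: `ω n = (δ_n, x_n)`, where `x_n` is the state after the
`n`-th jump and `δ_n` the sojourn time in `x_{n-1}` (`δ_0 = 0` by convention).  If there is no
further jump, the sojourn time is `∞`; all later coordinates are then irrelevant. -/
abbrev Path (S : Type*) := ℕ → ℝ≥0∞ × S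

/-- The history `(x_0, δ_1, x_1, …, δ_k, x_k)` up to the `k`-th jump. -/
abbrev Hist (S : Type*) (k : ℕ) := (i : Finset.Iic k) → ℝ≥0∞ × S

/-- The current state `x_k` of a history. -/
def lastState {k : ℕ} (h : Hist S k) : S := (h ⟨k, Finset.mem_Iic.2 le_rfl⟩).2

/-- The time `δ_1 + … + δ_k` of the `k`-th jump. -/
noncomputable def histTime {k : ℕ} (h : Hist S k) : ℝ := (∑ i, (h i).1).toReal

theorem measurable_lastState {k : ℕ} : Measurable (lastState (S := S) (k := k)) :=
  measurable_snd.comp (measurable_pi_apply _)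

theorem measurable_histTime {k : ℕ} : Measurable (histTime (S := S) (k := k)) :=
  (Finset.measurable_sum _ fun i _ => measurable_fst.comp (measurable_pi_apply i)).ennreal_toReal

/-- A randomized history-dependent policy for a player with admissible sets `act x`: kernels
`π^k(·|x_0, δ_1, x_1, …, δ_k, x_k, s)`, where `s` is the time elapsed since the `k`-th jump, which
are concentrated on the actions admissible in `x_k`. -/
structure Policy {C : Type*} [MeasurableSpace C] (act : S → Set C) where
  ker : (k : ℕ) → Kernel (Hist S k × ℝ) C
  isMarkov : ∀ k, IsMarkovKernel (ker k)
  ker_act : ∀ k h s, ker k (h, s) (act (lastState h)) = 1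

/-- A randomized Markov policy: a kernel `π(·|x, t)` concentrated on the actions admissible in
`x`. -/
structure MarkovPolicy {C : Type*} [MeasurableSpace C] (act : S → Set C) where
  ker : Kernel (S × ℝ) C
  isMarkov : IsMarkovKernel ker
  ker_act : ∀ x t, ker (x, t) (act x) = 1

/-- The Markov policy `π` used from the clock time `t` on, as a policy of the process started (with
internal time `0`) at clock time `t`: after the `k`-th jump it uses `π(·|x_k, t + T_k + s)`. -/
noncomputable def MarkovPolicy.startAt {C : Type*} [MeasurableSpace C] {act : S → Set C}
    (π : MarkovPolicy act) (t : ℝ) : Policy act where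
  ker k := π.ker.comap (fun p : Hist S k × ℝ => (lastState p.1, t + histTime p.1 + p.2))
    ((measurable_lastState.comp measurable_fst).prodMk
      ((measurable_const.add (measurable_histTime.comp measurable_fst)).add measurable_snd))
  isMarkov k := by
    have := π.isMarkov
    infer_instance
  ker_act k h s := by
    rw [Kernel.comap_apply]
    exact π.ker_act _ _

variable [StandardBorelSpace S]

/-- The jump rate under a pair of policies: given the history `h` and the time `s` elapsed since
the last jump, `D ↦ ∫∫ q(D \ {x_k}|x_k,a,b) π₁^k(da|h,s) π₂^k(db|h,s)`. -/
noncomputable def Model.jumpRate (G : Model S A B) (π₁ : Policy G.actA) (π₂ : Policy G.actB)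
    (k : ℕ) : Kernel (Hist S k × ℝ) S :=
  G.jumpKernel ∘ₖ ((Kernel.deterministic (fun p : Hist S k × ℝ => lastState p.1)
    (measurable_lastState.comp measurable_fst)) ×ₖ (π₁.ker k ×ₖ π₂.ker k))

/-- The probability `exp(-∫_0^s q(x_k, π₁, π₂) du)` of no jump within time `s` after the last
one. -/
noncomputable def Model.survival (G : Model S A B) (π₁ : Policy G.actA) (π₂ : Policy G.actB)
    (k : ℕ) (h : Hist S k) (s : ℝ) : ℝ≥0∞ :=
  ENNReal.ofReal (Real.exp (-(∫⁻ u in Ioc 0 s, G.jumpRate π₁ π₂ k (h, u) univ).toReal))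

/-- The (sub-probability) law of the next sojourn time and the next state, on the event that there
is another jump: `survival(s) * jumpRate(dy) ds`. -/
noncomputable def Model.nextJump (G : Model S A B) (π₁ : Policy G.actA) (π₂ : Policy G.actB)
    (k : ℕ) : Kernel (Hist S k) (ℝ × S) :=
  (Kernel.withDensity (Kernel.const (Hist S k) (volume.restrict (Ioi (0 : ℝ))))
    (G.survival π₁ π₂ k)) ⊗ₖ G.jumpRate π₁ π₂ k

/-- The law of `(δ_{k+1}, x_{k+1})` given the history up to the `k`-th jump; with the remaining
probability there is no further jump, `δ_{k+1} = ∞`. -/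
noncomputable def Model.step (G : Model S A B) (π₁ : Policy G.actA) (π₂ : Policy G.actB)
    (k : ℕ) : Kernel (Hist S k) (ℝ≥0∞ × S) where
  toFun h := (G.nextJump π₁ π₂ k h).map (Prod.map ENNReal.ofReal id) +
    (1 - G.nextJump π₁ π₂ k h univ) • Measure.dirac (∞, lastState h)
  measurable' := by
    refine Measure.measurable_of_measurable_coe _ fun D hD => ?_
    have hf : Measurable (Prod.map ENNReal.ofReal (id : S → S)) :=
      ENNReal.measurable_ofReal.prodMap measurable_id
    simp only [Measure.add_apply, Measure.smul_apply, Measure.map_apply hf hD, smul_eq_mul,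
      Measure.dirac_apply' _ hD]
    refine ((G.nextJump π₁ π₂ k).measurable_coe (hf hD)).add
      ((measurable_const.sub ((G.nextJump π₁ π₂ k).measurable_coe MeasurableSet.univ)).mul ?_)
    exact (measurable_one.indicator hD).comp (measurable_const.prodMk measurable_lastState)

theorem Model.jumpRate_univ_le (G : Model S A B) (π₁ : Policy G.actA) (π₂ : Policy G.actB)
    (k : ℕ) (h : Hist S k) (s : ℝ) :
    G.jumpRate π₁ π₂ k (h, s) univ ≤ ENNReal.ofReal (G.qStar (lastState h)) := by
  have := π₁.isMarkov k
  have := π₂.isMarkov k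
  rw [Model.jumpRate, Kernel.comp_apply' _ _ _ MeasurableSet.univ, Kernel.prod_apply,
    Kernel.deterministic_apply, Measure.dirac_prod, lintegral_map
      (G.jumpKernel.measurable_coe MeasurableSet.univ) measurable_prodMk_left]
  refine (lintegral_mono fun p => G.jumpKernel_univ_le (lastState h, p)).trans ?_
  simp

instance Model.instIsSFiniteKernelJumpRate (G : Model S A B) (π₁ : Policy G.actA)
    (π₂ : Policy G.actB) (k : ℕ) : IsSFiniteKernel (G.jumpRate π₁ π₂ k) :=
  isSFiniteKernel_of_lt_top _ fun p =>
    (G.jumpRate_univ_le π₁ π₂ k p.1 p.2).trans_lt ENNReal.ofReal_lt_top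

theorem Model.measurable_survival (G : Model S A B) (π₁ : Policy G.actA) (π₂ : Policy G.actB)
    (k : ℕ) : Measurable (Function.uncurry (G.survival π₁ π₂ k)) := by
  have h1 : Measurable fun p : (Hist S k × ℝ) × ℝ =>
      {z : (Hist S k × ℝ) × ℝ | 0 < z.2 ∧ z.2 ≤ z.1.2}.indicator
        (fun z => G.jumpRate π₁ π₂ k (z.1.1, z.2) univ) p := by
    refine Measurable.indicator ?_ ?_
    · exact ((G.jumpRate π₁ π₂ k).measurable_coe MeasurableSet.univ).comp
        ((measurable_fst.comp measurable_fst).prodMk measurable_snd)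
    · exact (measurableSet_lt measurable_const measurable_snd).inter
        (measurableSet_le measurable_snd (measurable_snd.comp measurable_fst))
  have h2 := h1.lintegral_prod_right' (ν := volume)
  have h3 : Measurable fun p : Hist S k × ℝ =>
      ENNReal.ofReal (Real.exp (-(∫⁻ u in Ioc 0 p.2, G.jumpRate π₁ π₂ k (p.1, u) univ).toReal)) := by
    refine (Real.measurable_exp.comp (Measurable.ennreal_toReal ?_).neg).ennreal_ofReal
    convert h2 using 2 with p
    rw [← lintegral_indicator measurableSet_Ioc]
    rfl
  exact h3

theorem Model.nextJump_apply (G : Model S A B) (π₁ : Policy G.actA) (π₂ : Policy G.actB)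
    (k : ℕ) (h : Hist S k) {D : Set (ℝ × S)} (hD : MeasurableSet D) :
    G.nextJump π₁ π₂ k h D = ∫⁻ s in Ioi (0 : ℝ),
      G.survival π₁ π₂ k h s * G.jumpRate π₁ π₂ k (h, s) (Prod.mk s ⁻¹' D) := by
  have hs := G.measurable_survival π₁ π₂ k
  have : IsSFiniteKernel (Kernel.withDensity
      (Kernel.const (Hist S k) (volume.restrict (Ioi (0 : ℝ)))) (G.survival π₁ π₂ k)) :=
    Kernel.IsSFiniteKernel.withDensity _ fun _ _ => ENNReal.ofReal_ne_top
  rw [Model.nextJump, Kernel.compProd_apply hD, Kernel.lintegral_withDensity _ hs]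
  · simp [Kernel.const_apply]
  · exact Kernel.measurable_kernel_prodMk_left' hD h

/-- `∫_0^∞ Λ(s) exp(-∫_0^s Λ(u) du) ds ≤ 1` for a bounded measurable rate `Λ ≥ 0`. -/
theorem lintegral_hazard_le_one {f : ℝ → ℝ≥0∞} (hf : Measurable f) {c : ℝ}
    (hc : ∀ s, f s ≤ ENNReal.ofReal c) :
    ∫⁻ s in Ioi (0 : ℝ),
      ENNReal.ofReal (Real.exp (-(∫⁻ u in Ioc 0 s, f u).toReal)) * f s ≤ 1 := by
  have hfin : ∀ s, f s ≠ ∞ := fun s => ((hc s).trans_lt ENNReal.ofReal_lt_top).ne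
  set g : ℝ → ℝ := fun s => (f s).toReal with hg
  have hgm : Measurable g := hf.ennreal_toReal
  have hg0 : ∀ s, 0 ≤ g s := fun s => ENNReal.toReal_nonneg
  have hgc : ∀ s, ‖g s‖ ≤ max c 0 := fun s => by
    rw [Real.norm_of_nonneg (hg0 s)]
    have := ENNReal.toReal_mono ENNReal.ofReal_ne_top (hc s)
    rwa [ENNReal.toReal_ofReal'] at this
  have hgi : ∀ a b, IntervalIntegrable g volume a b := fun a b =>
    (intervalIntegrable_const (c := max c 0)).mono_fun hgm.aestronglyMeasurable
      (Eventually.of_forall fun s => by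
        rw [Real.norm_of_nonneg (le_max_right c 0)]
        exact hgc s)
  have hint : ∀ s, 0 ≤ s → (∫⁻ u in Ioc 0 s, f u).toReal = ∫ u in (0 : ℝ)..s, g u := by
    intro s hs
    rw [intervalIntegral.integral_of_le hs, integral_toReal hf.aemeasurable
      (Eventually.of_forall fun u => (hfin u).lt_top)]
  set F : ℝ → ℝ := fun s => -Real.exp (-(∫ u in (0 : ℝ)..s, g u)) with hF
  have hmono : Monotone F := by
    intro s t hst
    have h1 := intervalIntegral.integral_add_adjacent_intervals (hgi 0 s) (hgi s t)
    have h2 : 0 ≤ ∫ u in s..t, g u := intervalIntegral.integral_nonneg hst fun u _ => hg0 u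
    simp only [hF, neg_le_neg_iff, Real.exp_le_exp]
    linarith
  have hbound : ∀ n : ℕ, ∫⁻ s in Ioc (0 : ℝ) n,
      ENNReal.ofReal (Real.exp (-(∫⁻ u in Ioc 0 s, f u).toReal)) * f s ≤ 1 := by
    intro n
    have hn : (0 : ℝ) ≤ n := n.cast_nonneg
    have hmem := (hmono.monotoneOn (uIcc (0 : ℝ) n)).intervalIntegral_deriv_mem_uIcc
    have hd : ∀ᵐ x, x ∈ uIcc (0 : ℝ) n → HasDerivAt F
        (Real.exp (-(∫ u in (0 : ℝ)..x, g u)) * g x) x := by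
      filter_upwards [(hgi 0 n).ae_hasDerivAt_integral] with x hx hxm
      have h1 : HasDerivAt F (-(Real.exp (-(∫ u in (0 : ℝ)..x, g u)) * -g x)) x :=
        ((hx hxm 0 left_mem_uIcc).neg.exp).neg
      exact h1.congr_deriv (by ring)
    have hint2 : ∫ x in (0 : ℝ)..n, deriv F x ≤ 1 := by
      have h0 : 0 ≤ F n - F 0 := sub_nonneg.2 (hmono hn)
      rw [uIcc_of_le h0] at hmem
      refine hmem.2.trans ?_
      simp only [hF, intervalIntegral.integral_same, neg_zero, Real.exp_zero]
      linarith [Real.exp_pos (-(∫ u in (0 : ℝ)..n, g u))]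
    have hdi : IntegrableOn (deriv F) (Ioc (0 : ℝ) n) :=
      ((hmono.monotoneOn (uIcc (0 : ℝ) n)).intervalIntegrable_deriv).1
    rw [intervalIntegral.integral_of_le hn] at hint2
    have hae : ∀ᵐ x ∂(volume.restrict (Ioc (0 : ℝ) n)),
        ENNReal.ofReal (Real.exp (-(∫⁻ u in Ioc 0 x, f u).toReal)) * f x =
          ENNReal.ofReal (deriv F x) := by
      rw [ae_restrict_iff' measurableSet_Ioc]
      filter_upwards [hd] with x hx hxm
      have hxu : x ∈ uIcc (0 : ℝ) n := by
        rw [uIcc_of_le hn]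
        exact Ioc_subset_Icc_self hxm
      rw [(hx hxu).deriv, ENNReal.ofReal_mul (Real.exp_pos _).le, hint x hxm.1.le,
        ENNReal.ofReal_toReal (hfin x)]
    rw [lintegral_congr_ae hae, ← ofReal_integral_eq_lintegral_ofReal hdi
      (Eventually.of_forall fun x => hmono.deriv_nonneg)]
    exact ENNReal.ofReal_le_one.2 hint2
  have hU : Ioi (0 : ℝ) = ⋃ n : ℕ, Ioc (0 : ℝ) n := by
    ext x
    simp only [mem_Ioi, mem_iUnion, mem_Ioc]
    exact ⟨fun h => (exists_nat_ge x).imp fun n hn => ⟨h, hn⟩, fun ⟨n, h, _⟩ => h⟩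
  have hdir : Directed (· ⊆ ·) fun n : ℕ => Ioc (0 : ℝ) n :=
    Monotone.directed_le fun m n hmn => Ioc_subset_Ioc_right (Nat.cast_le.2 hmn)
  rw [hU, setLIntegral_iUnion_of_directed _ hdir]
  exact iSup_le hbound

theorem Model.nextJump_univ_le (G : Model S A B) (π₁ : Policy G.actA) (π₂ : Policy G.actB)
    (k : ℕ) (h : Hist S k) : G.nextJump π₁ π₂ k h univ ≤ 1 := by
  rw [G.nextJump_apply π₁ π₂ k h MeasurableSet.univ]
  exact lintegral_hazard_le_one
    (((G.jumpRate π₁ π₂ k).measurable_coe MeasurableSet.univ).comp measurable_prodMk_left)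
    (fun s => G.jumpRate_univ_le π₁ π₂ k h s)

instance Model.instIsMarkovKernelStep (G : Model S A B) (π₁ : Policy G.actA)
    (π₂ : Policy G.actB) (k : ℕ) : IsMarkovKernel (G.step π₁ π₂ k) := by
  refine ⟨fun h => ⟨?_⟩⟩
  have hf : Measurable (Prod.map ENNReal.ofReal (id : S → S)) :=
    ENNReal.measurable_ofReal.prodMap measurable_id
  change ((G.nextJump π₁ π₂ k h).map (Prod.map ENNReal.ofReal id) +
    (1 - G.nextJump π₁ π₂ k h univ) • Measure.dirac (∞, lastState h)) univ = 1
  simp [Measure.map_apply hf MeasurableSet.univ,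
    add_tsub_cancel_of_le (G.nextJump_univ_le π₁ π₂ k h)]

/-- The law of the controlled process started in `x` at time `0`. -/
noncomputable def Model.law (G : Model S A B) (π₁ : Policy G.actA) (π₂ : Policy G.actB)
    (x : S) : Measure (Path S) :=
  Kernel.traj (X := fun _ => ℝ≥0∞ × S) (G.step π₁ π₂) 0 (fun _ => (0, x))

/-- The `k`-th jump time `T_k = δ_1 + … + δ_k`. -/
noncomputable def jumpTime (ω : Path S) (k : ℕ) : ℝ≥0∞ := ∑ i ∈ Finset.range k, (ω (i + 1)).1

open Classical in
/-- `∑_k 1{T_k ≤ t < T_{k+1}} f_k(t - T_k)`: the quantity `f_k` evaluated for the current number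
`k` of jumps and the time `t - T_k` elapsed since the last jump (`0` after an explosion). -/
noncomputable def current (ω : Path S) (f : ℕ → ℝ → ℝ) (t : ℝ) : ℝ :=
  ∑' k, if jumpTime ω k ≤ ENNReal.ofReal t ∧ ENNReal.ofReal t < jumpTime ω (k + 1)
    then f k (t - (jumpTime ω k).toReal) else 0

/-- The payoff rate at time `t`,
`∫∫ r(x_t,a,b) π₁(da|ω,t) π₂(db|ω,t)`. -/
noncomputable def Model.payoffRate (G : Model S A B) (π₁ : Policy G.actA) (π₂ : Policy G.actB)
    (ω : Path S) (t : ℝ) : ℝ :=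
  current ω (fun k s => ∫ a, ∫ b, G.r (ω k).2 a b
    ∂(π₂.ker k (fun i => ω i, s)) ∂(π₁.ker k (fun i => ω i, s))) t

/-- The risk-sensitive value over the horizon `[0, H]`,
`E_x[exp(θ ∫_0^H r(x_t, π₁, π₂) dt + θ g(x_H))]`, for history-dependent policies. -/
noncomputable def Model.value (G : Model S A B) (θ H : ℝ) (π₁ : Policy G.actA)
    (π₂ : Policy G.actB) (x : S) : ℝ≥0∞ :=
  ∫⁻ ω, ENNReal.ofReal (Real.exp (θ * (∫ t in (0 : ℝ)..H, G.payoffRate π₁ π₂ ω t) +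
    θ * current ω (fun k _ => G.g (ω k).2) H)) ∂(G.law π₁ π₂ x)

/-- `J(π₁, π₂, t, x)`: the risk-sensitive value over `[t, T]` of a pair of Markov policies for the
process that is in state `x` at time `t`. -/
noncomputable def Model.J (G : Model S A B) (θ T : ℝ) (π₁ : MarkovPolicy G.actA)
    (π₂ : MarkovPolicy G.actB) (t : ℝ) (x : S) : ℝ≥0∞ :=
  G.value θ (T - t) (π₁.startAt t) (π₂.startAt t) x

/-- `φ` is the value function of the game: `φ(t,x)` is the common lower and upper value over Markov
policies from time `t` on, and `φ(0,x)` is the common lower and upper value over all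
history-dependent policies. -/
structure Model.IsValueFunction (G : Model S A B) (θ T : ℝ) (φ : ℝ → S → ℝ) : Prop where
  nonneg : ∀ t ∈ Icc 0 T, ∀ x, 0 ≤ φ t x
  lower_markov : ∀ t ∈ Icc 0 T, ∀ x,
    ⨆ π₁ : MarkovPolicy G.actA, ⨅ π₂ : MarkovPolicy G.actB, G.J θ T π₁ π₂ t x =
      ENNReal.ofReal (φ t x)
  upper_markov : ∀ t ∈ Icc 0 T, ∀ x,
    ⨅ π₂ : MarkovPolicy G.actB, ⨆ π₁ : MarkovPolicy G.actA, G.J θ T π₁ π₂ t x =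
      ENNReal.ofReal (φ t x)
  lower : ∀ x, ⨆ π₁ : Policy G.actA, ⨅ π₂ : Policy G.actB, G.value θ T π₁ π₂ x =
    ENNReal.ofReal (φ 0 x)
  upper : ∀ x, ⨅ π₂ : Policy G.actB, ⨆ π₁ : Policy G.actA, G.value θ T π₁ π₂ x =
    ENNReal.ofReal (φ 0 x)

/-- An `ε`-Nash equilibrium on the horizon `[0,T]`: no player gains more than `ε` by switching to
another history-dependent policy, whatever the initial state. -/
def Model.IsEpsNash (G : Model S A B) (θ T ε : ℝ) (π₁ : Policy G.actA) (π₂ : Policy G.actB) :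
    Prop :=
  ∀ x, (∀ π₁' : Policy G.actA,
      G.value θ T π₁' π₂ x ≤ G.value θ T π₁ π₂ x + ENNReal.ofReal ε) ∧
    (∀ π₂' : Policy G.actB,
      G.value θ T π₁ π₂ x ≤ G.value θ T π₁ π₂' x + ENNReal.ofReal ε)

end Basic

section Iteration

/-! ## Value iteration -/

variable {S A B : Type*} [MeasurableSpace S] [MeasurableSpace A] [MeasurableSpace B]

/-- The set `P(C)` of probability measures concentrated on `C`. -/
def probOn {X : Type*} [MeasurableSpace X] (C : Set X) : Set (Measure X) :=
  {μ | IsProbabilityMeasure μ ∧ μ C = 1}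

/-- `θ r(x,φ,ψ) v(t,x) + ∫_S v(t,y) q(dy|x,φ,ψ)`. -/
noncomputable def Model.payoff (G : Model S A B) (θ : ℝ) (v : ℝ → S → ℝ) (t : ℝ) (x : S)
    (φ : Measure A) (ψ : Measure B) : ℝ :=
  θ * (∫ a, ∫ b, G.r x a b ∂ψ ∂φ) * v t x +
    ∫ a, ∫ b, (G.q x a b).integral (v t) (ContinuousLinearMap.lsmul ℝ ℝ) ∂ψ ∂φ

/-- The operator
`Γv(t,x) = e^{θg(x)} + ∫_t^T sup_φ inf_ψ [θ r(x,φ,ψ) v(s,x) + ∫ v(s,y) q(dy|x,φ,ψ)] ds`. -/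
noncomputable def Model.Gam (G : Model S A B) (θ T : ℝ) (v : ℝ → S → ℝ) (t : ℝ) (x : S) : ℝ :=
  Real.exp (θ * G.g x) +
    ∫ s in t..T, ⨆ φ : probOn (G.actA x), ⨅ ψ : probOn (G.actB x), G.payoff θ v s x φ ψ

/-- The value iteration `v_{n+1} = Γ v_n`. -/
noncomputable def Model.iter (G : Model S A B) (θ T : ℝ) (v₀ : ℝ → S → ℝ) (n : ℕ) : ℝ → S → ℝ :=
  (G.Gam θ T)^[n] v₀

/-- `φ ∈ P(A(x))`, `ψ ∈ P(B(x))` realise the sup-inf of the one-stage game at `(t,x)`: the value of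
`(φ,ψ)` is the sup-inf, and `φ` and `ψ` are optimal against each other. -/
def Model.RealisesSupInf (G : Model S A B) (θ : ℝ) (v : ℝ → S → ℝ) (t : ℝ) (x : S)
    (φ : Measure A) (ψ : Measure B) : Prop :=
  φ ∈ probOn (G.actA x) ∧ ψ ∈ probOn (G.actB x) ∧
  G.payoff θ v t x φ ψ =
    ⨆ φ' : probOn (G.actA x), ⨅ ψ' : probOn (G.actB x), G.payoff θ v t x φ' ψ' ∧
  (∀ φ' ∈ probOn (G.actA x), G.payoff θ v t x φ' ψ ≤ G.payoff θ v t x φ ψ) ∧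
  (∀ ψ' ∈ probOn (G.actB x), G.payoff θ v t x φ ψ ≤ G.payoff θ v t x φ ψ')

/-- The norm `sup_{(t,x) ∈ [0,T] × S} |u(t,x)|`, with values in `[0,∞]`. -/
noncomputable def supNorm (T : ℝ) (u : ℝ → S → ℝ) : ℝ≥0∞ :=
  ⨆ t ∈ Icc 0 T, ⨆ x, ENNReal.ofReal |u t x|

/-- The threshold `ε / (2 e^{(θ‖r‖+2‖q‖)T} (1 + 2‖q‖/(θ‖r‖)))`. -/
noncomputable def Model.threshold (G : Model S A B) (θ T ε : ℝ) : ℝ :=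
  ε / (2 * Real.exp ((θ * G.rNorm + 2 * G.qNorm) * T) *
    (1 + 2 * G.qNorm / (θ * G.rNorm)))

end Iteration

end RiskGame

namespace RiskGame

section Novikov

variable {α : Type*} [MeasurableSpace α]

/-- A sequence of sets is separable if its members have measurable supersets with empty
intersection. -/
def CountablySeparable (s : ℕ → Set α) : Prop :=
  ∃ B : ℕ → Set α, (∀ n, MeasurableSet (B n)) ∧ (∀ n, s n ⊆ B n) ∧ ⋂ n, B n = ∅

theorem CountablySeparable.mono {s t : ℕ → Set α} (h : CountablySeparable t)
    (hst : ∀ n, s n ⊆ t n) : CountablySeparable s := by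
  obtain ⟨B, hB, htB, hi⟩ := h
  exact ⟨B, hB, fun n => (hst n).trans (htB n), hi⟩

theorem CountablySeparable.of_iUnion {s : ℕ → Set α} (i : ℕ) (t : ℕ → Set α)
    (hs : s i ⊆ ⋃ k, t k) (h : ∀ k, CountablySeparable (Function.update s i (t k))) :
    CountablySeparable s := by
  choose B hB hsB hi using h
  refine ⟨Function.update (fun n => ⋂ k, B k n) i (⋃ k, B k i), fun n => ?_, fun n => ?_, ?_⟩
  · by_cases hn : n = i
    · subst hn
      simpa using MeasurableSet.iUnion fun k => hB k n
    · simpa [hn] using MeasurableSet.iInter fun k => hB k n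
  · by_cases hn : n = i
    · subst hn
      simp only [Function.update_self]
      exact hs.trans (iUnion_mono fun k => by simpa using hsB k n)
    · simp only [Function.update_of_ne hn]
      exact subset_iInter fun k => by simpa [hn] using hsB k n
  · refine eq_empty_of_forall_notMem fun x hx => ?_
    rw [mem_iInter] at hx
    have hxi := hx i
    simp only [Function.update_self, mem_iUnion] at hxi
    obtain ⟨k, hk⟩ := hxi
    have : x ∈ ⋂ n, B k n := by
      refine mem_iInter.2 fun n => ?_
      by_cases hn : n = i
      · rwa [hn]
      · have := hx n
        simp only [Function.update_of_ne hn, mem_iInter] at this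
        exact this k
    rw [hi k] at this
    exact this

/-- **Novikov's separation theorem** for continuous images of the Baire space. -/
theorem countablySeparable_range [TopologicalSpace α] [T2Space α] [OpensMeasurableSpace α]
    (f : ℕ → (ℕ → ℕ) → α) (hf : ∀ n, Continuous (f n)) (h : ⋂ n, range (f n) = ∅) :
    CountablySeparable fun n => range (f n) := by
  classical
  by_contra hsep
  let s : (ℕ → ℕ) → ℕ → ℕ → Set α := fun y m n =>
    f n '' {z | ∀ j, Nat.pair n j < m → z j = y (Nat.pair n j)}
  have hstep : ∀ y m, ¬ CountablySeparable (s y m) →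
      ∃ k, ¬ CountablySeparable (s (Function.update y m k) (m + 1)) := by
    intro y m hy
    by_contra! hk
    refine hy (CountablySeparable.of_iUnion (m.unpair).1
      (fun k => s (Function.update y m k) (m + 1) (m.unpair).1) ?_ fun k => (hk k).mono fun n => ?_)
    · rintro _ ⟨z, hz, rfl⟩
      refine mem_iUnion.2 ⟨z (m.unpair).2, z, fun j hj => ?_, rfl⟩
      rcases Nat.lt_succ_iff_lt_or_eq.1 hj with hlt | heq
      · rw [Function.update_of_ne hlt.ne]
        exact hz j hlt
      · have : j = (m.unpair).2 := by rw [← heq, Nat.unpair_pair]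
        rw [heq, Function.update_self, this]
    · by_cases hn : n = (m.unpair).1
      · subst hn; simp
      · simp only [Function.update_of_ne hn]
        rintro _ ⟨z, hz, rfl⟩
        refine ⟨z, fun j hj => ?_, rfl⟩
        rcases Nat.lt_succ_iff_lt_or_eq.1 hj with hlt | heq
        · rw [Function.update_of_ne hlt.ne]
          exact hz j hlt
        · exact absurd (by rw [← heq, Nat.unpair_pair]) hn
  choose! k hk using hstep
  let g : ℕ → ℕ → ℕ := fun m => Nat.rec (fun _ => 0) (fun m y => Function.update y m (k y m)) m
  have hg : ∀ m, g (m + 1) = Function.update (g m) m (k (g m) m) := fun m => rfl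
  have hgs : ∀ m, ¬ CountablySeparable (s (g m) m) := by
    intro m
    induction m with
    | zero =>
      intro hc
      refine hsep (hc.mono fun n => ?_)
      rintro _ ⟨z, rfl⟩
      exact ⟨z, fun j hj => absurd hj (Nat.not_lt_zero _), rfl⟩
    | succ m ih => rw [hg]; exact hk _ _ ih
  have hgj : ∀ j m, j < m → g m j = g (j + 1) j := by
    intro j m hjm
    induction m, hjm using Nat.le_induction with
    | base => rfl
    | succ m hm ih => rw [hg, Function.update_of_ne (by omega), ih]
  let y : ℕ → ℕ → ℕ := fun n j => g (Nat.pair n j + 1) (Nat.pair n j)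
  have hcyl : ∀ n (U : Set α), IsOpen U → f n (y n) ∈ U → ∃ M, ∀ m ≥ M, s (g m) m n ⊆ U := by
    intro n U hU hy
    have hmem : f n ⁻¹' U ∈ 𝓝 (y n) := (hf n).continuousAt.preimage_mem_nhds (hU.mem_nhds hy)
    obtain ⟨_, ⟨x, N, rfl⟩, hyv, hv⟩ :=
      (PiNat.isTopologicalBasis_cylinders (fun _ => ℕ)).mem_nhds_iff.1 hmem
    refine ⟨Nat.pair n N, fun m hm => ?_⟩
    rintro _ ⟨z, hz, rfl⟩
    refine hv fun l hl => ?_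
    have h1 : Nat.pair n l < m := (Nat.pair_lt_pair_right n hl).trans_le hm
    rw [hz l h1, hgj _ _ h1]
    exact hyv l hl
  by_cases hall : ∀ n, f n (y n) = f 0 (y 0)
  · have : f 0 (y 0) ∈ ⋂ n, range (f n) := mem_iInter.2 fun n => ⟨y n, hall n⟩
    rw [h] at this
    exact this
  · push Not at hall
    obtain ⟨n, hn⟩ := hall
    obtain ⟨U, V, hU, hV, hnU, h0V, hUV⟩ := t2_separation hn
    obtain ⟨M, hM⟩ := hcyl n U hU hnU
    obtain ⟨N, hN⟩ := hcyl 0 V hV h0V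
    have hn0 : n ≠ 0 := by rintro rfl; exact hn rfl
    refine hgs (max M N) ⟨fun j => if j = n then U else if j = 0 then V else univ,
      fun j => ?_, fun j => ?_, ?_⟩
    · dsimp only
      split_ifs
      exacts [hU.measurableSet, hV.measurableSet, MeasurableSet.univ]
    · dsimp only
      split_ifs with h1 h2
      · subst h1; exact hM _ (le_max_left _ _)
      · subst h2; exact hN _ (le_max_right _ _)
      · exact subset_univ _
    · refine eq_empty_of_forall_notMem fun x hx => ?_
      rw [mem_iInter] at hx
      have h1 := hx n
      have h2 := hx 0
      simp only [if_true, if_neg hn0.symm] at h1 h2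
      exact (disjoint_left.1 hUV) h1 h2

/-- **Novikov's separation theorem** for a sequence of analytic sets with empty intersection. -/
theorem countablySeparable_of_analyticSet [TopologicalSpace α] [T2Space α]
    [OpensMeasurableSpace α] {s : ℕ → Set α} (hs : ∀ n, AnalyticSet (s n))
    (h : ⋂ n, s n = ∅) : CountablySeparable s := by
  classical
  by_cases he : ∃ n, s n = ∅
  · obtain ⟨n, hn⟩ := he
    refine ⟨fun j => if j = n then ∅ else univ, fun j => ?_, fun j => ?_, ?_⟩
    · dsimp only
      split_ifs
      exacts [MeasurableSet.empty, MeasurableSet.univ]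
    · dsimp only
      split_ifs with h1
      · rw [h1, hn]
      · exact subset_univ _
    · refine eq_empty_of_forall_notMem fun x hx => ?_
      simpa using mem_iInter.1 hx n
  · push Not at he
    have : ∀ n, ∃ f : (ℕ → ℕ) → α, Continuous f ∧ range f = s n := by
      intro n
      have := hs n
      rw [AnalyticSet] at this
      exact this.resolve_left (he n).ne_empty
    choose f hf hfs using this
    have := countablySeparable_range f hf (by simpa only [hfs] using h)
    simpa only [hfs] using this

end Novikov

section Projection

variable {X Y : Type*} [MeasurableSpace X] [StandardBorelSpace X] [TopologicalSpace Y]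
  [CompactSpace Y] [TopologicalSpace.MetrizableSpace Y] [MeasurableSpace Y] [BorelSpace Y]

/-- The complement of a Borel set with closed sections is a countable union of rectangles with
Borel base and open fibre. -/
theorem exists_open_rectangles {Y : Type*} [TopologicalSpace Y] [PolishSpace Y]
    [MeasurableSpace Y] [BorelSpace Y] {E : Set (X × Y)} (hE : MeasurableSet E)
    (hcl : ∀ x, IsClosed (Prod.mk x ⁻¹' E)) :
    ∃ (B : ℕ → Set X) (U : ℕ → Set Y), (∀ n, MeasurableSet (B n)) ∧ (∀ n, IsOpen (U n)) ∧
      Eᶜ = ⋃ n, B n ×ˢ U n := by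
  let := upgradeStandardBorel X
  obtain ⟨b, hb⟩ : ∃ U : ℕ → Set Y, (∀ n, IsOpen (U n)) ∧
      ∀ (y : Y) (V : Set Y), IsOpen V → y ∈ V → ∃ n, y ∈ U n ∧ U n ⊆ V := by
    obtain ⟨u, hu, hne, hub⟩ := TopologicalSpace.exists_countable_basis Y
    obtain ⟨U, hU⟩ := (hu.insert ∅).exists_eq_range (insert_nonempty _ _)
    refine ⟨U, fun n => ?_, fun y V hV hy => ?_⟩
    · have : U n ∈ insert ∅ u := hU ▸ mem_range_self n
      rcases this with h | h
      · rw [h]; exact isOpen_empty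
      · exact hub.isOpen h
    · obtain ⟨v, hv, hyv, hvV⟩ := hub.mem_nhds_iff.1 (hV.mem_nhds hy)
      have : v ∈ range U := hU ▸ mem_insert_of_mem _ hv
      obtain ⟨n, rfl⟩ := this
      exact ⟨n, hyv, hvV⟩
  obtain ⟨hbo, hbb⟩ := hb
  have hpr : ∀ n, AnalyticSet (Prod.fst '' (E ∩ univ ×ˢ b n)) := fun n =>
    ((hE.inter (MeasurableSet.univ.prod (hbo n).measurableSet)).analyticSet).image_of_continuous
      continuous_fst
  let P : ℕ → Set X := fun n => Prod.fst '' (E ∩ univ ×ˢ b n)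
  have hZ : ∀ n, AnalyticSet (Prod.fst ⁻¹' P n ∪ Prod.snd ⁻¹' (b n)ᶜ : Set (X × Y)) := by
    intro n
    have h1 : AnalyticSet (Prod.fst ⁻¹' P n : Set (X × Y)) :=
      (hpr n).preimage continuous_fst
    have h2 : AnalyticSet (Prod.snd ⁻¹' (b n)ᶜ : Set (X × Y)) :=
      (measurable_snd (hbo n).measurableSet.compl).analyticSet
    rw [union_eq_iUnion]
    exact AnalyticSet.iUnion fun c => by cases c <;> assumption
  let Z : ℕ → Set (X × Y) := fun n =>
    Nat.casesOn n Eᶜ fun n => Prod.fst ⁻¹' P n ∪ Prod.snd ⁻¹' (b n)ᶜ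
  obtain ⟨C, hC, hZC, hCe⟩ : CountablySeparable Z := by
    refine countablySeparable_of_analyticSet (fun n => ?_) ?_
    · cases n with
      | zero => exact hE.compl.analyticSet
      | succ n => exact hZ n
    · refine eq_empty_of_forall_notMem ?_
      rintro ⟨x, y⟩ hxy
      rw [mem_iInter] at hxy
      obtain ⟨n, hyn, hn⟩ := hbb y (Prod.mk x ⁻¹' E)ᶜ (hcl x).isOpen_compl (hxy 0)
      rcases hxy (n + 1) with h | h
      · obtain ⟨⟨x', y'⟩, ⟨h1, h2⟩, rfl⟩ := h
        exact hn h2.2 h1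
      · exact h hyn
  have hD : ∀ n, ∃ B : Set X, MeasurableSet B ∧ Prod.fst '' (C (n + 1))ᶜ ⊆ B ∧
      Disjoint (P n) B := by
    intro n
    have h1 : AnalyticSet (Prod.fst '' (C (n + 1))ᶜ) :=
      ((hC (n + 1)).compl.analyticSet).image_of_continuous continuous_fst
    obtain ⟨B, h2, h3, h4⟩ := h1.measurablySeparable (hpr n) (by
      rw [disjoint_left]
      rintro _ ⟨p, hp, rfl⟩ h
      exact hp (hZC (n + 1) (Or.inl h)))
    exact ⟨B, h4, h2, h3⟩
  choose B hB hCB hPB using hD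
  refine ⟨B, b, hB, hbo, Subset.antisymm ?_ ?_⟩
  · rintro ⟨x, y⟩ hxy
    have h0 : (x, y) ∈ C 0 := hZC 0 hxy
    have : ¬ ∀ n, (x, y) ∈ C (n + 1) := by
      intro hall
      have : (x, y) ∈ ⋂ n, C n := mem_iInter.2 fun n => by
        cases n with
        | zero => exact h0
        | succ n => exact hall n
      rw [hCe] at this
      exact this
    push Not at this
    obtain ⟨n, hn⟩ := this
    refine mem_iUnion.2 ⟨n, hCB n ⟨(x, y), hn, rfl⟩, ?_⟩
    by_contra hy
    exact hn (hZC (n + 1) (Or.inr hy))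
  · refine iUnion_subset fun n => ?_
    rintro ⟨x, y⟩ ⟨hx, hy⟩ hxy
    exact (disjoint_left.1 (hPB n)) ⟨(x, y), ⟨hxy, mem_univ _, hy⟩, rfl⟩ hx

/-- The projection of a Borel set with compact sections is Borel. -/
theorem measurableSet_image_fst {E : Set (X × Y)} (hE : MeasurableSet E)
    (hcl : ∀ x, IsClosed (Prod.mk x ⁻¹' E)) : MeasurableSet (Prod.fst '' E) := by
  let := TopologicalSpace.metrizableSpaceMetric Y
  have : PolishSpace Y := inferInstance
  obtain ⟨B, U, hB, hU, hBU⟩ := exists_open_rectangles hE hcl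
  have : (Prod.fst '' E)ᶜ = ⋃ F : {F : Finset ℕ // ⋃ n ∈ F, U n = univ}, ⋂ n ∈ F.1, B n := by
    ext x
    simp only [mem_iUnion, mem_iInter, mem_compl_iff]
    constructor
    · intro hx
      have hx' : ∀ y, ∃ n, x ∈ B n ∧ y ∈ U n := by
        intro y
        have : (x, y) ∈ Eᶜ := fun h => hx ⟨_, h, rfl⟩
        rw [hBU] at this
        exact mem_iUnion.1 this
      obtain ⟨F, hF⟩ := isCompact_univ.elim_finite_subcover
        (fun n : {n // x ∈ B n} => U n.1) (fun n => hU _) (fun y _ => by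
          obtain ⟨n, h1, h2⟩ := hx' y
          exact mem_iUnion.2 ⟨⟨n, h1⟩, h2⟩)
      classical
      refine ⟨⟨F.image Subtype.val, ?_⟩, ?_⟩
      · refine eq_univ_of_univ_subset (hF.trans ?_)
        simp only [Finset.mem_image]
        exact iUnion₂_subset fun n hn y hy => mem_iUnion₂.2 ⟨n.1, ⟨n, hn, rfl⟩, hy⟩
      · intro n hn
        obtain ⟨m, _, rfl⟩ := Finset.mem_image.1 hn
        exact m.2
    · rintro ⟨⟨F, hF⟩, hx⟩ ⟨⟨x', y⟩, hxy, rfl⟩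
      have : y ∈ ⋃ n ∈ F, U n := hF ▸ mem_univ y
      obtain ⟨n, hn, hy⟩ := mem_iUnion₂.1 this
      have : (x', y) ∈ Eᶜ := hBU ▸ mem_iUnion.2 ⟨n, hx n hn, hy⟩
      exact this hxy
  rw [← MeasurableSet.compl_iff, this]
  exact MeasurableSet.iUnion fun F => Finset.measurableSet_biInter _ fun n _ => hB n

/-- A Borel set with nonempty compact sections has a Borel selector. -/
theorem exists_measurable_selector {E : Set (X × Y)} (hE : MeasurableSet E)
    (hcl : ∀ x, IsClosed (Prod.mk x ⁻¹' E)) (hne : ∀ x, ∃ y, (x, y) ∈ E) :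
    ∃ f : X → Y, Measurable f ∧ ∀ x, (x, f x) ∈ E := by
  let := TopologicalSpace.metrizableSpaceMetric Y
  obtain ⟨F, hF⟩ := Metric.PiNatEmbed.exists_embedding_to_hilbert_cube (X := Y)
  let g : ℕ → Y → ℝ := fun n y => F y n
  have hg : ∀ n, Continuous (g n) := fun n =>
    continuous_subtype_val.comp ((continuous_apply n).comp hF.continuous)
  have hginj : ∀ y y', (∀ n, g n y = g n y') → y = y' := fun y y' h =>
    hF.injective (funext fun n => Subtype.ext (h n))
  let G : ℕ → Set (X × Y) → Set (X × Y) := fun n D =>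
    {p | p ∈ D ∧ ∀ y, (p.1, y) ∈ D → g n p.2 ≤ g n y}
  let D : ℕ → Set (X × Y) := fun n => Nat.rec E (fun n D => G n D) n
  have hDs : ∀ n, D (n + 1) = G n (D n) := fun n => rfl
  have hD : ∀ n, MeasurableSet (D n) ∧ (∀ x, IsClosed (Prod.mk x ⁻¹' D n)) ∧
      ∀ x, ∃ y, (x, y) ∈ D n := by
    intro n
    induction n with
    | zero => exact ⟨hE, hcl, hne⟩
    | succ n ih =>
      obtain ⟨h1, h2, h3⟩ := ih
      refine ⟨?_, fun x => ?_, fun x => ?_⟩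
      · have : D (n + 1) = D n \ ⋃ c : ℚ,
            (Prod.fst ⁻¹' (Prod.fst '' (D n ∩ Prod.snd ⁻¹' {y | g n y ≤ c})) ∩
              Prod.snd ⁻¹' {y | (c : ℝ) < g n y}) := by
          ext ⟨x, y⟩
          rw [hDs]
          simp only [G, Set.mem_sdiff, mem_iUnion, not_exists]
          refine and_congr_right fun _ => ⟨fun h c => ?_, fun h y' hy' => ?_⟩
          · rintro ⟨⟨⟨x', y'⟩, ⟨h4, h5⟩, h6⟩, h7⟩
            obtain rfl : x' = x := h6
            have := h y' h4
            have h5' : g n y' ≤ c := h5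
            have h7' : (c : ℝ) < g n y := h7
            dsimp only at this
            linarith
          · by_contra! hlt
            obtain ⟨c, hc1, hc2⟩ := exists_rat_btwn hlt
            exact h c ⟨⟨(x, y'), ⟨hy', hc1.le⟩, rfl⟩, hc2⟩
        rw [this]
        refine h1.diff (MeasurableSet.iUnion fun c => ?_)
        refine (measurable_fst (measurableSet_image_fst ?_ fun x => ?_)).inter
          (measurable_snd (measurableSet_lt measurable_const (hg n).measurable))
        · exact h1.inter (measurable_snd (measurableSet_le (hg n).measurable measurable_const))
        · exact (h2 x).inter (isClosed_le (hg n) continuous_const)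
      · have : Prod.mk x ⁻¹' D (n + 1) =
            Prod.mk x ⁻¹' D n ∩ ⋂ y ∈ Prod.mk x ⁻¹' D n, {y' | g n y' ≤ g n y} := by
          ext y'
          rw [hDs]
          simp [G]
        rw [this]
        exact (h2 x).inter (isClosed_biInter fun y _ => isClosed_le (hg n) continuous_const)
      · obtain ⟨y, hy, hmin⟩ := (h2 x).isCompact.exists_isMinOn (h3 x) (hg n).continuousOn
        exact ⟨y, hy, fun y' hy' => hmin hy'⟩
  have hDm : ∀ n, MeasurableSet (D n) := fun n => (hD n).1
  have hDc : ∀ n x, IsClosed (Prod.mk x ⁻¹' D n) := fun n => (hD n).2.1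
  have hDI : ∀ x, ∃ y, ∀ n, (x, y) ∈ D n := by
    intro x
    obtain ⟨y, hy⟩ := IsCompact.nonempty_iInter_of_sequence_nonempty_isCompact_isClosed
      (fun n => Prod.mk x ⁻¹' D n) (fun n y hy => hy.1) (fun n => (hD n).2.2 x)
      (hDc 0 x).isCompact (hDc · x)
    exact ⟨y, fun n => mem_iInter.1 hy n⟩
  choose f hf using hDI
  have huniq : ∀ x y, (∀ n, (x, y) ∈ D n) → y = f x := by
    intro x y hy
    refine hginj _ _ fun n => le_antisymm ?_ ?_
    · exact (hy (n + 1)).2 _ (hf x n)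
    · exact (hf x (n + 1)).2 _ (hy n)
  refine ⟨f, measurable_of_isClosed fun V hV => ?_, fun x => hf x 0⟩
  have : f ⁻¹' V = Prod.fst '' ((⋂ n, D n) ∩ Prod.snd ⁻¹' V) := by
    ext x
    constructor
    · intro hx
      exact ⟨(x, f x), ⟨mem_iInter.2 (hf x), hx⟩, rfl⟩
    · rintro ⟨⟨x', y⟩, ⟨h1, h2⟩, rfl⟩
      rw [mem_preimage, ← huniq x' y (mem_iInter.1 h1)]
      exact h2
  rw [this]
  refine measurableSet_image_fst ((MeasurableSet.iInter hDm).inter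
    (measurable_snd hV.measurableSet)) fun x => ?_
  have : Prod.mk x ⁻¹' ((⋂ n, D n) ∩ Prod.snd ⁻¹' V) = (⋂ n, Prod.mk x ⁻¹' D n) ∩ V := by
    ext y; simp
  rw [this]
  exact (isClosed_iInter fun n => hDc n x).inter hV

end Projection

section ProbabilityMeasureBorel

variable {H : Type*} [TopologicalSpace H] [CompactSpace H] [TopologicalSpace.MetrizableSpace H]
  [MeasurableSpace H] [BorelSpace H]

omit [TopologicalSpace.MetrizableSpace H] in
theorem continuous_integral_continuousMap_left (μ : Measure H) [IsProbabilityMeasure μ] :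
    Continuous fun g : C(H, ℝ) => ∫ x, g x ∂μ := by
  refine LipschitzWith.continuous (K := 1) (LipschitzWith.of_dist_le_mul fun g g' => ?_)
  have hi : ∀ g : C(H, ℝ), Integrable g μ := fun g =>
    (BoundedContinuousFunction.mkOfCompact g).integrable _
  rw [dist_eq_norm, ← integral_sub (hi g) (hi g'), dist_eq_norm]
  have := norm_integral_le_of_norm_le_const (μ := μ) (f := fun x => g x - g' x) (C := ‖g - g'‖)
    (Eventually.of_forall fun x => (g - g').norm_coe_le_norm x)
  simpa using this

omit [CompactSpace H] in
theorem measurable_borel_probabilityMeasure_apply {F : Set H} (hF : IsClosed F) :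
    Measurable[borel (ProbabilityMeasure H)] fun φ : ProbabilityMeasure H => (φ : Measure H) F := by
  let := TopologicalSpace.metrizableSpaceMetric H
  let : MeasurableSpace (ProbabilityMeasure H) := borel _
  have : BorelSpace (ProbabilityMeasure H) := ⟨rfl⟩
  refine measurable_of_tendsto_metrizable (f := fun n (φ : ProbabilityMeasure H) =>
    ∫⁻ x, hF.apprSeq n x ∂(φ : Measure H)) (fun n => ?_)
    (tendsto_pi_nhds.2 fun φ => HasOuterApproxClosed.tendsto_lintegral_apprSeq hF (φ : Measure H))
  have : Continuous fun φ : ProbabilityMeasure H =>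
      φ.toFiniteMeasure.testAgainstNN (hF.apprSeq n) :=
    ProbabilityMeasure.continuous_testAgainstNN_eval _
  have h2 := (ENNReal.continuous_coe.comp this).measurable
  convert h2 using 2 with φ
  simp only [Function.comp, FiniteMeasure.testAgainstNN_coe_eq]
  rfl

instance borelSpace_probabilityMeasure : BorelSpace (ProbabilityMeasure H) := by
  let := TopologicalSpace.metrizableSpaceMetric H
  refine ⟨le_antisymm ?_ ?_⟩
  · have : Measurable[borel (ProbabilityMeasure H)]
        (fun φ : ProbabilityMeasure H => (φ : Measure H)) := by
      let : MeasurableSpace (ProbabilityMeasure H) := borel _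
      refine Measurable.measure_of_isPiSystem_of_isProbabilityMeasure
        (S := {F : Set H | IsClosed F}) ?_ isPiSystem_isClosed fun F hF =>
          measurable_borel_probabilityMeasure_apply hF
      rw [← borel_eq_generateFrom_isClosed]
      exact BorelSpace.measurable_eq
    exact this.comap_le
  · obtain ⟨f, hf⟩ := TopologicalSpace.exists_dense_seq C(H, ℝ)
    let Φ : ProbabilityMeasure H → ℕ → ℝ := fun φ n => ∫ x, f n x ∂(φ : Measure H)
    have hΦc : Continuous Φ := continuous_pi fun n =>
      ProbabilityMeasure.continuous_integral_continuousMap (f n)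
    have hΦi : Function.Injective Φ := by
      intro φ ψ h
      have hcl : IsClosed {g : C(H, ℝ) | ∫ x, g x ∂(φ : Measure H) = ∫ x, g x ∂(ψ : Measure H)} := by
        exact isClosed_eq (continuous_integral_continuousMap_left _)
          (continuous_integral_continuousMap_left _)
      have huniv : ∀ g : C(H, ℝ), ∫ x, g x ∂(φ : Measure H) = ∫ x, g x ∂(ψ : Measure H) := by
        intro g
        have : g ∈ closure (range f) := hf g
        exact closure_minimal (by rintro _ ⟨n, rfl⟩; exact congrFun h n) hcl this
      have heq : (φ : Measure H) = (ψ : Measure H) :=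
        ext_of_forall_integral_eq_of_IsFiniteMeasure fun g => huniv g.toContinuousMap
      exact Subtype.ext heq
    have hΦe : IsClosedEmbedding Φ := hΦc.isClosedEmbedding hΦi
    have hΦm : Measurable Φ := by
      refine measurable_pi_lambda _ fun n => ?_
      have h1 : StronglyMeasurable fun p : ProbabilityMeasure H × H => f n p.2 :=
        ((f n).continuous.measurable.comp measurable_snd).stronglyMeasurable
      let κ : Kernel (ProbabilityMeasure H) H := ⟨fun φ => φ, measurable_subtype_coe⟩
      have : IsMarkovKernel κ := ⟨fun φ => inferInstanceAs (IsProbabilityMeasure (φ : Measure H))⟩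
      exact (h1.integral_kernel_prod_right' (κ := κ)).measurable
    rw [hΦe.eq_induced, borel_comap, ← BorelSpace.measurable_eq (α := ℕ → ℝ)]
    exact hΦm.comap_le

/-- The tautological kernel from probability measures on `H` to `H`. -/
noncomputable def evalKernel (H : Type*) [MeasurableSpace H] : Kernel (ProbabilityMeasure H) H :=
  ⟨fun φ => φ, measurable_subtype_coe⟩

instance isMarkovKernel_evalKernel (H : Type*) [MeasurableSpace H] :
    IsMarkovKernel (evalKernel H) :=
  ⟨fun φ => inferInstanceAs (IsProbabilityMeasure (φ : Measure H))⟩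

omit [CompactSpace H] in
theorem isClosed_setOf_measure_eq_one {F : Set H} (hF : IsClosed F) :
    IsClosed {φ : ProbabilityMeasure H | (φ : Measure H) F = 1} := by
  let := TopologicalSpace.metrizableSpaceMetric H
  have : {φ : ProbabilityMeasure H | (φ : Measure H) F = 1} =
      ⋂ n, {φ : ProbabilityMeasure H | 1 ≤ ∫⁻ x, hF.apprSeq n x ∂(φ : Measure H)} := by
    ext φ
    simp only [mem_iInter, mem_ofPred_eq]
    constructor
    · intro h n
      rw [← h]
      exact HasOuterApproxClosed.measure_le_lintegral hF _ n
    · intro h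
      exact le_antisymm prob_le_one
        (ge_of_tendsto' (HasOuterApproxClosed.tendsto_lintegral_apprSeq hF (φ : Measure H)) h)
  rw [this]
  refine isClosed_iInter fun n => isClosed_le continuous_const ?_
  have : Continuous fun φ : ProbabilityMeasure H =>
      φ.toFiniteMeasure.testAgainstNN (hF.apprSeq n) :=
    ProbabilityMeasure.continuous_testAgainstNN_eval _
  have h2 := (ENNReal.continuous_coe.comp this)
  convert h2 using 2 with φ
  simp only [Function.comp, FiniteMeasure.testAgainstNN_coe_eq]
  rfl

end ProbabilityMeasureBorel

section Minimax

variable {A B : Type*} [TopologicalSpace A] [CompactSpace A] [TopologicalSpace.MetrizableSpace A]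
  [MeasurableSpace A] [BorelSpace A] [TopologicalSpace B] [CompactSpace B]
  [TopologicalSpace.MetrizableSpace B] [MeasurableSpace B] [BorelSpace B]

/-- The functionals on `C(A, ℝ)` given by probability measures. -/
def probFunctionals (A : Type*) [TopologicalSpace A] [MeasurableSpace A] : Set (C(A, ℝ) → ℝ) :=
  range fun (φ : ProbabilityMeasure A) (f : C(A, ℝ)) => ∫ a, f a ∂(φ : Measure A)

omit [TopologicalSpace.MetrizableSpace A] in
theorem isCompact_probFunctionals [T2Space A] : IsCompact (probFunctionals A) :=
  isCompact_range (continuous_pi fun f => ProbabilityMeasure.continuous_integral_continuousMap f)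

omit [TopologicalSpace.MetrizableSpace A] in
theorem convex_probFunctionals : Convex ℝ (probFunctionals A) := by
  rintro _ ⟨φ, rfl⟩ _ ⟨ψ, rfl⟩ s t hs ht hst
  have hprob : IsProbabilityMeasure (ENNReal.ofReal s • (φ : Measure A) +
      ENNReal.ofReal t • (ψ : Measure A)) := by
    refine ⟨?_⟩
    simp [← ENNReal.ofReal_add hs ht, hst]
  refine ⟨⟨_, hprob⟩, ?_⟩
  ext f
  have hi : ∀ χ : ProbabilityMeasure A, Integrable f (χ : Measure A) := fun χ =>
    (BoundedContinuousFunction.mkOfCompact f).integrable _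
  simp only [ProbabilityMeasure.coe_mk, Pi.add_apply, Pi.smul_apply, smul_eq_mul]
  rw [integral_add_measure ((hi φ).smul_measure (by simp)) ((hi ψ).smul_measure (by simp)),
    integral_smul_measure, integral_smul_measure, ENNReal.toReal_ofReal hs,
    ENNReal.toReal_ofReal ht]
  rfl

/-- Existence of optimal mixed strategies for a continuous payoff on compact spaces. -/
theorem exists_saddle_continuousMap [Nonempty A] [Nonempty B] (C : C(A × B, ℝ)) :
    ∃ (φ : ProbabilityMeasure A) (ψ : ProbabilityMeasure B), ∀ a b,
      ∫ b', C (a, b') ∂(ψ : Measure B) ≤ ∫ a', C (a', b) ∂(φ : Measure A) := by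
  classical
  let mA : (C(A, ℝ) → ℝ) → ProbabilityMeasure A := fun x =>
    if h : x ∈ probFunctionals A then h.choose else ⟨Measure.dirac (Classical.arbitrary A), inferInstance⟩
  let mB : (C(B, ℝ) → ℝ) → ProbabilityMeasure B := fun x =>
    if h : x ∈ probFunctionals B then h.choose else ⟨Measure.dirac (Classical.arbitrary B), inferInstance⟩
  have hmA : ∀ x ∈ probFunctionals A, ∀ f : C(A, ℝ), ∫ a, f a ∂(mA x : Measure A) = x f := by
    intro x hx f
    have : mA x = hx.choose := dif_pos hx
    rw [this]
    exact congrFun hx.choose_spec f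
  have hmB : ∀ x ∈ probFunctionals B, ∀ f : C(B, ℝ), ∫ a, f a ∂(mB x : Measure B) = x f := by
    intro x hx f
    have : mB x = hx.choose := dif_pos hx
    rw [this]
    exact congrFun hx.choose_spec f
  have hCi : ∀ (φ : ProbabilityMeasure A) (ψ : ProbabilityMeasure B),
      Integrable C ((φ : Measure A).prod (ψ : Measure B)) := fun φ ψ =>
    (BoundedContinuousFunction.mkOfCompact C).integrable _
  have hgA : ∀ ψ : ProbabilityMeasure B, Continuous fun a => ∫ b, C (a, b) ∂(ψ : Measure B) := by
    intro ψ
    refine continuous_of_dominated (bound := fun _ => ‖C‖) (fun a => ?_) (fun a => ?_)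
      (integrable_const _) ?_
    · exact (C.continuous.comp (Continuous.prodMk_right a)).aestronglyMeasurable
    · exact Eventually.of_forall fun b => C.norm_coe_le_norm _
    · exact Eventually.of_forall fun b => C.continuous.comp (Continuous.prodMk_left b)
  have hgB : ∀ φ : ProbabilityMeasure A, Continuous fun b => ∫ a, C (a, b) ∂(φ : Measure A) := by
    intro φ
    refine continuous_of_dominated (bound := fun _ => ‖C‖) (fun a => ?_) (fun a => ?_)
      (integrable_const _) ?_
    · exact (C.continuous.comp (Continuous.prodMk_left a)).aestronglyMeasurable
    · exact Eventually.of_forall fun b => C.norm_coe_le_norm _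
    · exact Eventually.of_forall fun b => C.continuous.comp (Continuous.prodMk_right b)
  let gA : ProbabilityMeasure B → C(A, ℝ) := fun ψ => ⟨_, hgA ψ⟩
  let gB : ProbabilityMeasure A → C(B, ℝ) := fun φ => ⟨_, hgB φ⟩
  let f : (C(A, ℝ) → ℝ) → (C(B, ℝ) → ℝ) → ℝ := fun x y =>
    ∫ a, ∫ b, C (a, b) ∂(mB y : Measure B) ∂(mA x : Measure A)
  have hfx : ∀ x ∈ probFunctionals A, ∀ y, f x y = x (gA (mB y)) := fun x hx y =>
    hmA x hx (gA (mB y))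
  have hfy : ∀ y ∈ probFunctionals B, ∀ x, f x y = y (gB (mA x)) := by
    intro y hy x
    rw [← hmB y hy]
    exact integral_integral_swap (hCi (mA x) (mB y))
  obtain ⟨x, hx, y, hy, hxy⟩ := Sion.exists_isSaddlePointOn (X := probFunctionals B)
    (Y := probFunctionals A) (f := fun y x => f x y)
    ⟨_, ⟨⟨Measure.dirac (Classical.arbitrary B), inferInstance⟩, rfl⟩⟩
    convex_probFunctionals isCompact_probFunctionals
    (fun x hx => by
      refine (ContinuousOn.congr (f := fun y => y (gB (mA x)))
        (continuous_apply _).continuousOn fun y hy => hfy y hy x).lowerSemicontinuousOn)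
    (fun x hx => by
      refine ConvexOn.quasiconvexOn ⟨convex_probFunctionals, ?_⟩
      intro y hy y' hy' s t hs ht hst
      dsimp only
      rw [hfy _ (convex_probFunctionals hy hy' hs ht hst), hfy _ hy, hfy _ hy']
      rfl)
    convex_probFunctionals
    ⟨_, ⟨⟨Measure.dirac (Classical.arbitrary A), inferInstance⟩, rfl⟩⟩ isCompact_probFunctionals
    (fun y hy => by
      refine (ContinuousOn.congr (f := fun x => x (gA (mB y)))
        (continuous_apply _).continuousOn fun x hx => hfx x hx y).upperSemicontinuousOn)
    (fun y hy => by
      refine ConcaveOn.quasiconcaveOn ⟨convex_probFunctionals, ?_⟩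
      intro x hx x' hx' s t hs ht hst
      dsimp only
      rw [hfx _ (convex_probFunctionals hx hx' hs ht hst), hfx _ hx, hfx _ hx']
      rfl)
  refine ⟨mA y, mB x, fun a b => ?_⟩
  have hda : (fun g : C(A, ℝ) => ∫ a', g a' ∂(Measure.dirac a)) ∈ probFunctionals A :=
    ⟨⟨Measure.dirac a, inferInstance⟩, rfl⟩
  have hdb : (fun g : C(B, ℝ) => ∫ a', g a' ∂(Measure.dirac b)) ∈ probFunctionals B :=
    ⟨⟨Measure.dirac b, inferInstance⟩, rfl⟩
  have := hxy _ hdb _ hda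
  dsimp only at this
  rw [hfx _ hda, hfy _ hdb] at this
  simpa [integral_dirac, gA, gB] using this

/-- Existence of optimal mixed strategies for a payoff that is continuous on a compact
rectangle. -/
theorem exists_saddle_on {KA : Set A} {KB : Set B} (hKA : IsClosed KA) (hKB : IsClosed KB)
    (hA : KA.Nonempty) (hB : KB.Nonempty) {C : A → B → ℝ}
    (hC : ContinuousOn (Function.uncurry C) (KA ×ˢ KB)) :
    ∃ (φ : ProbabilityMeasure A) (ψ : ProbabilityMeasure B), (φ : Measure A) KA = 1 ∧
      (ψ : Measure B) KB = 1 ∧ ∀ a ∈ KA, ∀ b ∈ KB,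
      ∫ b', C a b' ∂(ψ : Measure B) ≤ ∫ a', C a' b ∂(φ : Measure A) := by
  have : CompactSpace KA := isCompact_iff_compactSpace.1 hKA.isCompact
  have : CompactSpace KB := isCompact_iff_compactSpace.1 hKB.isCompact
  have : Nonempty KA := hA.to_subtype
  have : Nonempty KB := hB.to_subtype
  have hcont : Continuous fun p : KA × KB => C p.1 p.2 := by
    have h1 : Continuous fun p : KA × KB => ((p.1 : A), (p.2 : B)) := by fun_prop
    exact hC.comp_continuous h1 fun p => ⟨p.1.2, p.2.2⟩
  obtain ⟨φ, ψ, h⟩ := exists_saddle_continuousMap ⟨_, hcont⟩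
  have hmA : MeasurableEmbedding (Subtype.val : KA → A) :=
    MeasurableEmbedding.subtype_coe hKA.measurableSet
  have hmB : MeasurableEmbedding (Subtype.val : KB → B) :=
    MeasurableEmbedding.subtype_coe hKB.measurableSet
  refine ⟨φ.map hmA.measurable.aemeasurable, ψ.map hmB.measurable.aemeasurable, ?_, ?_,
    fun a ha b hb => ?_⟩
  · rw [ProbabilityMeasure.toMeasure_map, hmA.map_apply]
    simp
  · rw [ProbabilityMeasure.toMeasure_map, hmB.map_apply]
    simp
  · rw [ProbabilityMeasure.toMeasure_map, ProbabilityMeasure.toMeasure_map, hmA.integral_map,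
      hmB.integral_map]
    exact h ⟨a, ha⟩ ⟨b, hb⟩

end Minimax

section MeasurableSaddle

variable {X A B : Type*} [MeasurableSpace X] [StandardBorelSpace X]

theorem integral_congr_of_measure_eq_one {Y : Type*} [MeasurableSpace Y] {μ : Measure Y}
    [IsProbabilityMeasure μ] {K : Set Y} (hK : MeasurableSet K) (h : μ K = 1) {f g : Y → ℝ}
    (hfg : ∀ y ∈ K, f y = g y) : ∫ y, f y ∂μ = ∫ y, g y ∂μ := by
  refine integral_congr_ae ?_
  filter_upwards [(prob_compl_eq_zero_iff hK).2 h |> measure_eq_zero_iff_ae_notMem.1] with y hy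
  exact hfg y (by simpa using hy)

/-- The integral of a function that is continuous on a closed set depends continuously on
probability measures concentrated on that set. -/
theorem continuousOn_integral_of_continuousOn {H : Type*} [TopologicalSpace H] [CompactSpace H]
    [TopologicalSpace.MetrizableSpace H] [MeasurableSpace H] [BorelSpace H] {K : Set H}
    (hK : IsClosed K) {f : H → ℝ} (hf : ContinuousOn f K) :
    ContinuousOn (fun φ : ProbabilityMeasure H => ∫ y, f y ∂(φ : Measure H))
      {φ | (φ : Measure H) K = 1} := by
  obtain ⟨g, hg⟩ := ContinuousMap.exists_restrict_eq hK ⟨K.domRestrict f, hf.domRestrict⟩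
  refine ((ProbabilityMeasure.continuous_integral_continuousMap g).continuousOn).congr fun φ hφ =>
    integral_congr_of_measure_eq_one hK.measurableSet hφ fun y hy => ?_
  exact (DFunLike.congr_fun hg ⟨y, hy⟩).symm

theorem continuousOn_integral_left {A B : Type*} [TopologicalSpace A] [TopologicalSpace B]
    [FirstCountableTopology A] [MeasurableSpace B] [BorelSpace B]
    {KA : Set A} {KB : Set B} (hKA : IsCompact KA) (hKB : IsCompact KB) (hmB : MeasurableSet KB)
    {C : A → B → ℝ} (hCm : ∀ a, Measurable (C a))
    (hC : ContinuousOn (Function.uncurry C) (KA ×ˢ KB)) (μ : Measure B)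
    [IsProbabilityMeasure μ] (hμ : μ KB = 1) :
    ContinuousOn (fun a => ∫ b, C a b ∂μ) KA := by
  obtain ⟨M, hM⟩ := (hKA.prod hKB).exists_bound_of_continuousOn hC
  have hae : ∀ᵐ b ∂μ, b ∈ KB := by
    filter_upwards [measure_eq_zero_iff_ae_notMem.1 ((prob_compl_eq_zero_iff hmB).2 hμ)] with b hb
    simpa using hb
  refine continuousOn_of_dominated (bound := fun _ => M)
    (fun a _ => (hCm a).aestronglyMeasurable) (fun a ha => ?_) (integrable_const _) ?_
  · filter_upwards [hae] with b hb using hM (a, b) ⟨ha, hb⟩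
  · filter_upwards [hae] with b hb
    exact hC.comp (by fun_prop : Continuous fun a : A => (a, b)).continuousOn
      fun a ha => ⟨ha, hb⟩

section Compact

variable [TopologicalSpace A] [CompactSpace A] [TopologicalSpace.MetrizableSpace A]
  [MeasurableSpace A] [BorelSpace A] [TopologicalSpace B] [CompactSpace B]
  [TopologicalSpace.MetrizableSpace B] [MeasurableSpace B] [BorelSpace B]

theorem exists_measurable_saddle_of_compactSpace {KA : X → Set A} {KB : X → Set B}
    (hKA : ∀ x, IsClosed (KA x)) (hKB : ∀ x, IsClosed (KB x)) (hA : ∀ x, (KA x).Nonempty)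
    (hB : ∀ x, (KB x).Nonempty)
    (hK : MeasurableSet {p : X × A × B | p.2.1 ∈ KA p.1 ∧ p.2.2 ∈ KB p.1})
    {C : X → A → B → ℝ} (hCm : Measurable fun p : X × A × B => C p.1 p.2.1 p.2.2)
    (hC : ∀ x, ContinuousOn (Function.uncurry (C x)) (KA x ×ˢ KB x)) :
    ∃ (φ : Kernel X A) (ψ : Kernel X B), IsMarkovKernel φ ∧ IsMarkovKernel ψ ∧
      (∀ x, φ x (KA x) = 1) ∧ (∀ x, ψ x (KB x) = 1) ∧ ∀ x, ∀ a ∈ KA x, ∀ b ∈ KB x,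
      ∫ b', C x a b' ∂(ψ x) ≤ ∫ a', C x a' b ∂(φ x) := by
  let := TopologicalSpace.metrizableSpaceMetric A
  let := TopologicalSpace.metrizableSpaceMetric B
  let := TopologicalSpace.metrizableSpaceMetric (ProbabilityMeasure A)
  let := TopologicalSpace.metrizableSpaceMetric (ProbabilityMeasure B)
  have hgA : MeasurableSet {p : X × A | p.2 ∈ KA p.1} := by
    have h1 := measurableSet_image_fst (X := X × A) (Y := B)
      (E := {p | p.1.2 ∈ KA p.1.1 ∧ p.2 ∈ KB p.1.1})
      (hK.preimage (by fun_prop : Measurable fun p : (X × A) × B => (p.1.1, p.1.2, p.2)))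
      (fun p => by
        by_cases h : p.2 ∈ KA p.1
        · simpa [h] using hKB p.1
        · simp [h])
    convert h1 using 1
    ext p
    simp only [mem_image, mem_ofPred_eq, Prod.exists, exists_and_right, exists_eq_right]
    exact ⟨fun h => ⟨(hB p.1).some, h, (hB p.1).some_mem⟩, fun ⟨_, h, _⟩ => h⟩
  have hgB : MeasurableSet {p : X × B | p.2 ∈ KB p.1} := by
    have h1 := measurableSet_image_fst (X := X × B) (Y := A)
      (E := {p | p.2 ∈ KA p.1.1 ∧ p.1.2 ∈ KB p.1.1})
      (hK.preimage (by fun_prop : Measurable fun p : (X × B) × A => (p.1.1, p.2, p.1.2)))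
      (fun p => by
        by_cases h : p.2 ∈ KB p.1
        · simpa [h] using hKA p.1
        · simp [h])
    convert h1 using 1
    ext p
    simp only [mem_image, mem_ofPred_eq, Prod.exists, exists_and_right, exists_eq_right]
    exact ⟨fun h => ⟨⟨(hA p.1).some, (hA p.1).some_mem⟩, h⟩, fun ⟨_, h⟩ => h⟩
  let D : Set (X × (ProbabilityMeasure A × ProbabilityMeasure B)) := {p | (p.2.1 : Measure A) (KA p.1) = 1 ∧ (p.2.2 : Measure B) (KB p.1) = 1}
  let κA : Kernel (X × (ProbabilityMeasure A × ProbabilityMeasure B)) A := (evalKernel A).comap (fun p => p.2.1) (by fun_prop)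
  let κB : Kernel (X × (ProbabilityMeasure A × ProbabilityMeasure B)) B := (evalKernel B).comap (fun p => p.2.2) (by fun_prop)
  have hD : MeasurableSet D := by
    have h1 : Measurable fun p : X × (ProbabilityMeasure A × ProbabilityMeasure B) => (p.2.1 : Measure A) (KA p.1) :=
      Kernel.measurable_kernel_prodMk_left (κ := κA) (t := {q | q.2 ∈ KA q.1.1})
        (hgA.preimage (by fun_prop : Measurable fun q : (X × (ProbabilityMeasure A × ProbabilityMeasure B)) × A => (q.1.1, q.2)))
    have h2 : Measurable fun p : X × (ProbabilityMeasure A × ProbabilityMeasure B) => (p.2.2 : Measure B) (KB p.1) :=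
      Kernel.measurable_kernel_prodMk_left (κ := κB) (t := {q | q.2 ∈ KB q.1.1})
        (hgB.preimage (by fun_prop : Measurable fun q : (X × (ProbabilityMeasure A × ProbabilityMeasure B)) × B => (q.1.1, q.2)))
    exact (h1 (measurableSet_singleton 1)).inter (h2 (measurableSet_singleton 1))
  have hIA : Measurable fun q : (X × (ProbabilityMeasure A × ProbabilityMeasure B)) × (A × B) => ∫ b, C q.1.1 q.2.1 b ∂(q.1.2.2 : Measure B) := by
    have h1 : StronglyMeasurable fun q : ((X × (ProbabilityMeasure A × ProbabilityMeasure B)) × (A × B)) × B => C q.1.1.1 q.1.2.1 q.2 :=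
      (hCm.comp (by fun_prop : Measurable fun q : ((X × (ProbabilityMeasure A × ProbabilityMeasure B)) × (A × B)) × B =>
        (q.1.1.1, q.1.2.1, q.2))).stronglyMeasurable
    exact (h1.integral_kernel_prod_right' (κ := κB.comap Prod.fst measurable_fst)).measurable
  have hIB : Measurable fun q : (X × (ProbabilityMeasure A × ProbabilityMeasure B)) × (A × B) => ∫ a, C q.1.1 a q.2.2 ∂(q.1.2.1 : Measure A) := by
    have h1 : StronglyMeasurable fun q : ((X × (ProbabilityMeasure A × ProbabilityMeasure B)) × (A × B)) × A => C q.1.1.1 q.2 q.1.2.2 :=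
      (hCm.comp (by fun_prop : Measurable fun q : ((X × (ProbabilityMeasure A × ProbabilityMeasure B)) × (A × B)) × A =>
        (q.1.1.1, q.2, q.1.2.2))).stronglyMeasurable
    exact (h1.integral_kernel_prod_right' (κ := κA.comap Prod.fst measurable_fst)).measurable
  let W : ℕ → Set ((X × (ProbabilityMeasure A × ProbabilityMeasure B)) × (A × B)) := fun n => {q | q.1 ∈ D ∧ (q.2.1 ∈ KA q.1.1 ∧ q.2.2 ∈ KB q.1.1) ∧
    ∫ a, C q.1.1 a q.2.2 ∂(q.1.2.1 : Measure A) + 1 / ((n : ℝ) + 1) ≤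
      ∫ b, C q.1.1 q.2.1 b ∂(q.1.2.2 : Measure B)}
  have hWm : ∀ n, MeasurableSet (W n) := fun n =>
    (measurable_fst hD).inter ((hK.preimage
      (by fun_prop : Measurable fun q : (X × (ProbabilityMeasure A × ProbabilityMeasure B)) × (A × B) => (q.1.1, q.2.1, q.2.2))).inter
        (measurableSet_le (hIB.add measurable_const) hIA))
  have hcA : ∀ x (ψ : ProbabilityMeasure B), (ψ : Measure B) (KB x) = 1 →
      ContinuousOn (fun a => ∫ b, C x a b ∂(ψ : Measure B)) (KA x) := fun x ψ hψ =>
    continuousOn_integral_left (hKA x).isCompact (hKB x).isCompact (hKB x).measurableSet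
      (fun a => hCm.comp (by fun_prop : Measurable fun b : B => (x, a, b))) (hC x) _ hψ
  have hcB : ∀ x (φ : ProbabilityMeasure A), (φ : Measure A) (KA x) = 1 →
      ContinuousOn (fun b => ∫ a, C x a b ∂(φ : Measure A)) (KB x) := fun x φ hφ => by
    refine continuousOn_integral_left (C := fun b a => C x a b) (hKB x).isCompact
      (hKA x).isCompact (hKA x).measurableSet
      (fun b => hCm.comp (by fun_prop : Measurable fun a : A => (x, a, b))) ?_ _ hφ
    exact (hC x).comp continuous_swap.continuousOn fun p hp => ⟨hp.2, hp.1⟩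
  have hWc : ∀ n p, IsClosed (Prod.mk p ⁻¹' W n) := by
    rintro n ⟨x, φ, ψ⟩
    by_cases hp : (x, φ, ψ) ∈ D
    · have h1 : ContinuousOn (fun q : A × B => ∫ b, C x q.1 b ∂(ψ : Measure B) -
          ∫ a, C x a q.2 ∂(φ : Measure A)) (KA x ×ˢ KB x) :=
        ((hcA x ψ hp.2).comp continuous_fst.continuousOn fun q hq => hq.1).sub
          ((hcB x φ hp.1).comp continuous_snd.continuousOn fun q hq => hq.2)
      have h2 := h1.preimage_isClosed_of_isClosed ((hKA x).prod (hKB x))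
        (isClosed_Ici (a := 1 / ((n : ℝ) + 1)))
      convert h2 using 1
      ext q
      simp only [W, mem_preimage, mem_ofPred_eq, hp, true_and, mem_inter_iff, mem_prod, mem_Ici]
      refine and_congr_right fun _ => ?_
      constructor <;> intro h <;> linarith
    · convert isClosed_empty
      refine eq_empty_of_forall_notMem fun q hq => hp hq.1
  let E : Set (X × (ProbabilityMeasure A × ProbabilityMeasure B)) := D \ ⋃ n, Prod.fst '' W n
  have hE : MeasurableSet E :=
    hD.diff (MeasurableSet.iUnion fun n => measurableSet_image_fst (hWm n) (hWc n))
  have hEiff : ∀ x φ ψ, (x, φ, ψ) ∈ E ↔ (x, φ, ψ) ∈ D ∧ ∀ a ∈ KA x, ∀ b ∈ KB x,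
      ∫ b', C x a b' ∂(ψ : Measure B) ≤ ∫ a', C x a' b ∂(φ : Measure A) := by
    intro x φ ψ
    refine and_congr_right fun hp => ⟨fun h a ha b hb => ?_, fun h hmem => ?_⟩
    · by_contra! hlt
      obtain ⟨n, hn⟩ := exists_nat_one_div_lt (sub_pos.2 hlt)
      refine h (mem_iUnion.2 ⟨n, ((x, φ, ψ), (a, b)), ⟨hp, ⟨ha, hb⟩, ?_⟩, rfl⟩)
      dsimp only
      linarith
    · obtain ⟨n, ⟨⟨x', φ', ψ'⟩, a, b⟩, ⟨_, ⟨ha, hb⟩, hle⟩, heq⟩ := mem_iUnion.1 hmem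
      simp only [Prod.mk.injEq] at heq
      obtain ⟨rfl, rfl, rfl⟩ := heq
      have := h a ha b hb
      have h3 : 0 < 1 / ((n : ℝ) + 1) := by positivity
      dsimp only at hle
      linarith
  obtain ⟨f, hf, hfE⟩ := exists_measurable_selector hE
    (fun x => by
      let T : Set (ProbabilityMeasure A × ProbabilityMeasure B) := {φ : ProbabilityMeasure A | (φ : Measure A) (KA x) = 1} ×ˢ
        {ψ : ProbabilityMeasure B | (ψ : Measure B) (KB x) = 1}
      have hT : IsClosed T := (isClosed_setOf_measure_eq_one (hKA x)).prod
        (isClosed_setOf_measure_eq_one (hKB x))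
      have h1 : ∀ a ∈ KA x, ∀ b ∈ KB x, IsClosed (T ∩ (fun z : (ProbabilityMeasure A × ProbabilityMeasure B) =>
          ∫ a', C x a' b ∂(z.1 : Measure A) - ∫ b', C x a b' ∂(z.2 : Measure B)) ⁻¹' Ici 0) := by
        intro a ha b hb
        refine ContinuousOn.preimage_isClosed_of_isClosed ?_ hT isClosed_Ici
        refine ContinuousOn.sub ?_ ?_
        · refine (continuousOn_integral_of_continuousOn (hKA x) (f := fun a => C x a b)
            ((hC x).comp (by fun_prop : Continuous fun a : A => (a, b)).continuousOn
              fun a ha => ⟨ha, hb⟩)).comp continuous_fst.continuousOn fun z hz => hz.1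
        · refine (continuousOn_integral_of_continuousOn (hKB x) (f := fun b => C x a b)
            ((hC x).comp (by fun_prop : Continuous fun b : B => (a, b)).continuousOn
              fun b hb => ⟨ha, hb⟩)).comp continuous_snd.continuousOn fun z hz => hz.2
      have h2 : Prod.mk x ⁻¹' E = T ∩ ⋂ a ∈ KA x, ⋂ b ∈ KB x, (T ∩ (fun z : (ProbabilityMeasure A × ProbabilityMeasure B) =>
          ∫ a', C x a' b ∂(z.1 : Measure A) - ∫ b', C x a b' ∂(z.2 : Measure B)) ⁻¹' Ici 0) := by
        ext ⟨φ, ψ⟩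
        rw [mem_preimage, hEiff]
        simp only [mem_inter_iff, mem_iInter, mem_preimage, mem_Ici, sub_nonneg]
        refine and_congr_right fun h => forall₄_congr fun a ha b hb => ?_
        exact ⟨fun h3 => ⟨h, h3⟩, fun h3 => h3.2⟩
      rw [h2]
      exact hT.inter (isClosed_biInter fun a ha => isClosed_biInter fun b hb => h1 a ha b hb))
    (fun x => by
      obtain ⟨φ, ψ, h1, h2, h3⟩ := exists_saddle_on (hKA x) (hKB x) (hA x) (hB x) (hC x)
      exact ⟨(φ, ψ), (hEiff x φ ψ).2 ⟨⟨h1, h2⟩, h3⟩⟩)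
  refine ⟨(evalKernel A).comap (fun x => (f x).1) hf.fst, (evalKernel B).comap (fun x => (f x).2)
    hf.snd, inferInstance, inferInstance, fun x => (hfE x).1.1, fun x => (hfE x).1.2, fun x => ?_⟩
  exact ((hEiff x _ _).1 (hfE x)).2

end Compact

variable [TopologicalSpace A] [TopologicalSpace.MetrizableSpace A] [SecondCountableTopology A]
  [MeasurableSpace A] [BorelSpace A] [StandardBorelSpace A]
  [TopologicalSpace B] [TopologicalSpace.MetrizableSpace B] [SecondCountableTopology B]
  [MeasurableSpace B] [BorelSpace B] [StandardBorelSpace B]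

/-- Measurable selection of saddle points in mixed strategies, for a measurable family of games
with compact action sets and continuous payoffs. -/
theorem exists_measurable_saddle {KA : X → Set A} {KB : X → Set B}
    (hKA : ∀ x, IsCompact (KA x)) (hKB : ∀ x, IsCompact (KB x)) (hA : ∀ x, (KA x).Nonempty)
    (hB : ∀ x, (KB x).Nonempty)
    (hK : MeasurableSet {p : X × A × B | p.2.1 ∈ KA p.1 ∧ p.2.2 ∈ KB p.1})
    {C : X → A → B → ℝ} (hCm : Measurable fun p : X × A × B => C p.1 p.2.1 p.2.2)
    (hC : ∀ x, ContinuousOn (Function.uncurry (C x)) (KA x ×ˢ KB x)) :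
    ∃ (φ : Kernel X A) (ψ : Kernel X B), IsMarkovKernel φ ∧ IsMarkovKernel ψ ∧
      (∀ x, φ x (KA x) = 1) ∧ (∀ x, ψ x (KB x) = 1) ∧ ∀ x, ∀ a ∈ KA x, ∀ b ∈ KB x,
      ∫ b', C x a b' ∂(ψ x) ≤ ∫ a', C x a' b ∂(φ x) := by
  let := TopologicalSpace.metrizableSpaceMetric A
  let := TopologicalSpace.metrizableSpaceMetric B
  obtain ⟨i, hi⟩ := Metric.PiNatEmbed.exists_embedding_to_hilbert_cube (X := A)
  obtain ⟨j, hj⟩ := Metric.PiNatEmbed.exists_embedding_to_hilbert_cube (X := B)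
  have him : MeasurableEmbedding i := hi.continuous.measurable.measurableEmbedding hi.injective
  have hjm : MeasurableEmbedding j := hj.continuous.measurable.measurableEmbedding hj.injective
  let e : X × A × B → X × (ℕ → unitInterval) × (ℕ → unitInterval) :=
    Prod.map id (Prod.map i j)
  have he : MeasurableEmbedding e := MeasurableEmbedding.id.prodMap (him.prodMap hjm)
  let C' : X → (ℕ → unitInterval) → (ℕ → unitInterval) → ℝ := fun x a b =>
    Function.extend e (fun p => C p.1 p.2.1 p.2.2) 0 (x, a, b)
  have hC' : ∀ x a b, C' x (i a) (j b) = C x a b := fun x a b =>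
    he.injective.extend_apply (fun p => C p.1 p.2.1 p.2.2) 0 (x, a, b)
  obtain ⟨φ, ψ, h1, h2, h3, h4, h5⟩ := exists_measurable_saddle_of_compactSpace
    (KA := fun x => i '' KA x) (KB := fun x => j '' KB x) (C := C')
    (fun x => ((hKA x).image hi.continuous).isClosed)
    (fun x => ((hKB x).image hj.continuous).isClosed)
    (fun x => (hA x).image _) (fun x => (hB x).image _)
    (by
      convert he.measurableSet_image.2 hK using 1
      ext ⟨x, a, b⟩
      simp only [e, mem_ofPred_eq, mem_image, Prod.exists, Prod.map_apply, id, Prod.mk.injEq]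
      constructor
      · rintro ⟨⟨a, ha, rfl⟩, b, hb, rfl⟩
        exact ⟨x, a, b, ⟨ha, hb⟩, rfl, rfl, rfl⟩
      · rintro ⟨x', a, b, ⟨ha, hb⟩, rfl, rfl, rfl⟩
        exact ⟨⟨a, ha, rfl⟩, b, hb, rfl⟩)
    (he.measurable_extend hCm measurable_const)
    (fun x => by
      rw [← prodMap_image_prod]
      have hij : IsEmbedding (Prod.map i j) := hi.prodMap hj
      intro q hq
      obtain ⟨p, hp, rfl⟩ := hq
      have hcw := hC x p hp
      rw [ContinuousWithinAt, ← hij.map_nhdsWithin_eq, tendsto_map'_iff]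
      have : Function.uncurry (C' x) ∘ Prod.map i j = Function.uncurry (C x) := by
        ext ⟨a, b⟩
        exact hC' x a b
      rw [this]
      have h6 : Function.uncurry (C' x) (Prod.map i j p) = Function.uncurry (C x) p :=
        hC' x p.1 p.2
      rw [h6]
      exact hcw)
  have hmA : ∀ x, MeasurableSet (KA x) := fun x => (hKA x).measurableSet
  have hmB : ∀ x, MeasurableSet (KB x) := fun x => (hKB x).measurableSet
  have hφr : ∀ x, φ x (range i) = 1 := fun x =>
    le_antisymm prob_le_one ((h3 x).symm.le.trans (measure_mono (image_subset_range _ _)))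
  have hψr : ∀ x, ψ x (range j) = 1 := fun x =>
    le_antisymm prob_le_one ((h4 x).symm.le.trans (measure_mono (image_subset_range _ _)))
  have hφm : ∀ x, ((φ.comapRight him) x).map i = φ x := fun x => by
    rw [Kernel.comapRight_apply, him.map_comap, Measure.restrict_eq_self_of_ae_mem]
    filter_upwards [measure_eq_zero_iff_ae_notMem.1
      ((prob_compl_eq_zero_iff him.measurableSet_range).2 (hφr x))] with y hy
    exact not_not.1 hy
  have hψm : ∀ x, ((ψ.comapRight hjm) x).map j = ψ x := fun x => by
    rw [Kernel.comapRight_apply, hjm.map_comap, Measure.restrict_eq_self_of_ae_mem]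
    filter_upwards [measure_eq_zero_iff_ae_notMem.1
      ((prob_compl_eq_zero_iff hjm.measurableSet_range).2 (hψr x))] with y hy
    exact not_not.1 hy
  refine ⟨φ.comapRight him, ψ.comapRight hjm, Kernel.IsMarkovKernel.comapRight _ him hφr,
    Kernel.IsMarkovKernel.comapRight _ hjm hψr, fun x => ?_, fun x => ?_, fun x a ha b hb => ?_⟩
  · rw [Kernel.comapRight_apply' _ him _ (hmA x)]
    exact h3 x
  · rw [Kernel.comapRight_apply' _ hjm _ (hmB x)]
    exact h4 x
  · have := h5 x (i a) ⟨a, ha, rfl⟩ (j b) ⟨b, hb, rfl⟩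
    rw [← hφm, ← hψm, him.integral_map, hjm.integral_map] at this
    simpa only [hC'] using this

end MeasurableSaddle

section OneStage

variable {S A B : Type*} [MeasurableSpace S] [StandardBorelSpace S] [MeasurableSpace A]
  [MeasurableSpace B]

instance Model.isFiniteMeasure_jumpKernel (G : Model S A B) (p : S × A × B) :
    IsFiniteMeasure (G.jumpKernel p) :=
  ⟨(G.jumpKernel_univ_le p).trans_lt ENNReal.ofReal_lt_top⟩

open Classical in
/-- The payoff rate, extended by `0` outside the graph. -/
noncomputable def Model.rate (G : Model S A B) (p : S × A × B) : ℝ :=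
  if p ∈ G.graph then G.r p.1 p.2.1 p.2.2 else 0

omit [StandardBorelSpace S] in
theorem Model.measurable_rate (G : Model S A B) : Measurable G.rate := by
  classical
  exact Measurable.dite (s := G.graph) (f := fun p : G.graph => G.r p.1.1 p.1.2.1 p.1.2.2)
    (g := fun _ => (0 : ℝ)) G.measurable_r measurable_const G.measurableSet_graph

omit [StandardBorelSpace S] in
theorem Model.rate_eq (G : Model S A B) {x : S} {a : A} {b : B} (ha : a ∈ G.actA x)
    (hb : b ∈ G.actB x) : G.rate (x, a, b) = G.r x a b :=
  if_pos ⟨ha, hb⟩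

omit [StandardBorelSpace S] in
theorem Model.rNorm_nonneg (G : Model S A B) : 0 ≤ G.rNorm :=
  Real.iSup_nonneg fun _ => abs_nonneg _

omit [StandardBorelSpace S] in
theorem Model.abs_rate_le (G : Model S A B) (hG : G.IsBounded) (p : S × A × B) :
    |G.rate p| ≤ G.rNorm := by
  by_cases hp : p ∈ G.graph
  · rw [Model.rate, if_pos hp]
    exact le_ciSup hG.2.1 ⟨p, hp⟩
  · rw [Model.rate, if_neg hp, abs_zero]
    exact G.rNorm_nonneg

theorem Model.qStar_nonneg (G : Model S A B) (x : S) : 0 ≤ G.qStar x := by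
  obtain ⟨a, ha⟩ := G.nonempty_actA x
  obtain ⟨b, hb⟩ := G.nonempty_actB x
  have h1 := VectorMeasure.of_add_of_sdiff (v := G.q x a b)
    (measurableSet_singleton x) MeasurableSet.univ (subset_univ _)
  rw [G.q_conservative x a ha b hb, ← Set.compl_eq_univ_sdiff] at h1
  have h2 := G.q_nonneg x a ha b hb {x}ᶜ (measurableSet_singleton x).compl (by simp)
  exact le_csSup_of_le (G.q_stable x) ⟨a, ha, b, hb, rfl⟩ (by linarith)

theorem Model.qNorm_nonneg (G : Model S A B) : 0 ≤ G.qNorm :=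
  Real.iSup_nonneg G.qStar_nonneg

theorem Model.jumpKernel_real_univ_le (G : Model S A B) (hG : G.IsBounded) (p : S × A × B) :
    (G.jumpKernel p).real univ ≤ G.qNorm :=
  (ENNReal.toReal_le_of_le_ofReal (G.qStar_nonneg p.1) (G.jumpKernel_univ_le p)).trans
    (le_ciSup hG.1 p.1)

theorem Model.jumpKernel_real_apply (G : Model S A B) {x : S} {a : A} {b : B}
    (ha : a ∈ G.actA x) (hb : b ∈ G.actB x) {D : Set S} (hD : MeasurableSet D) :
    (G.jumpKernel (x, a, b)).real D = G.q x a b ({x}ᶜ ∩ D) := by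
  rw [measureReal_def, G.jumpKernel_apply ha hb hD, ENNReal.toReal_ofReal]
  exact G.q_nonneg x a ha b hb _ ((measurableSet_singleton x).compl.inter hD) (by simp)

/-- The Lipschitz constant `θ‖r‖ + 2‖q‖` of the one-stage payoff. -/
noncomputable def Model.lip (G : Model S A B) (θ : ℝ) : ℝ := θ * G.rNorm + 2 * G.qNorm

theorem Model.lip_nonneg (G : Model S A B) {θ : ℝ} (hθ : 0 ≤ θ) : 0 ≤ G.lip θ :=
  add_nonneg (mul_nonneg hθ G.rNorm_nonneg) (mul_nonneg zero_le_two G.qNorm_nonneg)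

/-- The one-stage payoff of pure actions, `θ r w(x) + ∫ (w(y) - w(x)) q(dy)`. -/
noncomputable def Model.stage (G : Model S A B) (θ : ℝ) (w : S → ℝ) (x : S) (a : A) (b : B) : ℝ :=
  θ * G.rate (x, a, b) * w x + ∫ y, (w y - w x) ∂(G.jumpKernel (x, a, b))

theorem integrable_of_abs_le {Y : Type*} [MeasurableSpace Y] {μ : Measure Y} [IsFiniteMeasure μ]
    {f : Y → ℝ} (hf : Measurable f) {M : ℝ} (hM : ∀ y, |f y| ≤ M) : Integrable f μ :=
  Integrable.of_bound hf.aestronglyMeasurable M (Eventually.of_forall hM)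

theorem Model.integral_q (G : Model S A B) {x : S} {a : A} {b : B} (ha : a ∈ G.actA x)
    (hb : b ∈ G.actB x) {w : S → ℝ} (hw : Measurable w) {M : ℝ} (hM : ∀ y, |w y| ≤ M) :
    (G.q x a b).integral w (ContinuousLinearMap.lsmul ℝ ℝ) =
      ∫ y, (w y - w x) ∂(G.jumpKernel (x, a, b)) := by
  have : IsFiniteMeasure ((G.jumpKernel (x, a, b) univ) • Measure.dirac x) :=
    Measure.smul_finite _ (measure_ne_top _ _)
  have hq : G.q x a b = (G.jumpKernel (x, a, b)).toSignedMeasure -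
      ((G.jumpKernel (x, a, b) univ) • Measure.dirac x).toSignedMeasure := by
    ext D hD
    rw [Measure.toSignedMeasure_sub_apply hD, G.jumpKernel_real_apply ha hb hD,
      measureReal_ennreal_smul_apply, ← measureReal_def,
      G.jumpKernel_real_apply ha hb MeasurableSet.univ, inter_univ]
    have h1 := VectorMeasure.of_add_of_sdiff (v := G.q x a b)
      (measurableSet_singleton x) MeasurableSet.univ (subset_univ _)
    rw [G.q_conservative x a ha b hb, ← Set.compl_eq_univ_sdiff] at h1
    by_cases hx : x ∈ D
    · have h2 := VectorMeasure.of_add_of_sdiff (v := G.q x a b)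
        (measurableSet_singleton x) hD (singleton_subset_iff.2 hx)
      have h3 : {x}ᶜ ∩ D = D \ {x} := by ext; simp [and_comm]
      have h4 : (Measure.dirac x).real D = 1 := by simp [measureReal_def, hx]
      rw [h3, h4]
      linarith
    · have h3 : {x}ᶜ ∩ D = D := by
        refine inter_eq_right.2 fun y hy => ?_
        rintro rfl
        exact hx hy
      have h4 : (Measure.dirac x).real D = 0 := by
        rw [measureReal_def, Measure.dirac_apply' _ hD]; simp [hx]
      rw [h3, h4]
      simp
  have hflip : (ContinuousLinearMap.lsmul ℝ ℝ : ℝ →L[ℝ] ℝ →L[ℝ] ℝ) =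
      (ContinuousLinearMap.lsmul ℝ ℝ : ℝ →L[ℝ] ℝ →L[ℝ] ℝ).flip := by
    ext; simp
  have hint : ∀ (μ : Measure S) [IsFiniteMeasure μ], μ.toSignedMeasure.Integrable w := by
    intro μ _
    rw [VectorMeasure.Integrable, Measure.variation_toSignedMeasure]
    exact integrable_of_abs_le hw hM
  rw [hq, VectorMeasure.integral_sub_vectorMeasure (hint _) (hint _), hflip,
    VectorMeasure.integral_toSignedMeasure, VectorMeasure.integral_toSignedMeasure,
    integral_smul_measure, integral_dirac, integral_sub (integrable_of_abs_le hw hM)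
      (integrable_const _), integral_const, measureReal_def, smul_eq_mul]

theorem Model.abs_integral_jump_le (G : Model S A B) (hG : G.IsBounded) {w : S → ℝ}
    {M : ℝ} (hM : ∀ y, |w y| ≤ M) (p : S × A × B) :
    |∫ y, (w y - w p.1) ∂(G.jumpKernel p)| ≤ 2 * M * G.qNorm := by
  have hM0 : 0 ≤ M := (abs_nonneg _).trans (hM p.1)
  have h : ∀ y, ‖w y - w p.1‖ ≤ 2 * M := fun y => by
    rw [Real.norm_eq_abs]
    refine (abs_sub _ _).trans ?_
    linarith [hM y, hM p.1]
  exact (norm_integral_le_of_norm_le_const (Eventually.of_forall h)).trans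
    (mul_le_mul_of_nonneg_left (G.jumpKernel_real_univ_le hG p) (by positivity))

theorem Model.abs_stage_le (G : Model S A B) (hG : G.IsBounded) {θ : ℝ} (hθ : 0 ≤ θ) {w : S → ℝ}
    {M : ℝ} (hM : ∀ y, |w y| ≤ M) (x : S) (a : A) (b : B) :
    |G.stage θ w x a b| ≤ G.lip θ * M := by
  have h1 : |θ * G.rate (x, a, b) * w x| ≤ θ * G.rNorm * M := by
    rw [abs_mul, abs_mul, abs_of_nonneg hθ]
    exact mul_le_mul (mul_le_mul_of_nonneg_left (G.abs_rate_le hG _) hθ) (hM x) (abs_nonneg _)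
      (mul_nonneg hθ G.rNorm_nonneg)
  have h2 := G.abs_integral_jump_le hG hM (x, a, b)
  dsimp only at h2
  rw [Model.stage, Model.lip]
  refine (abs_add_le _ _).trans ?_
  linarith

theorem Model.stage_sub (G : Model S A B) {θ : ℝ} {w w' : S → ℝ} (hw : Measurable w)
    (hw' : Measurable w') {M : ℝ} (hM : ∀ y, |w y| ≤ M) (hM' : ∀ y, |w' y| ≤ M) (x : S) (a : A)
    (b : B) : G.stage θ w x a b - G.stage θ w' x a b = G.stage θ (fun y => w y - w' y) x a b := by
  have h : ∀ {f : S → ℝ}, Measurable f → (∀ y, |f y| ≤ M) →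
      Integrable (fun y => f y - f x) (G.jumpKernel (x, a, b)) := fun hf hfM =>
    (integrable_of_abs_le hf hfM).sub (integrable_const _)
  simp only [Model.stage]
  have := integral_sub (h hw hM) (h hw' hM')
  have h2 : ∫ y, (w y - w' y - (w x - w' x)) ∂(G.jumpKernel (x, a, b)) =
      ∫ y, (w y - w x - (w' y - w' x)) ∂(G.jumpKernel (x, a, b)) :=
    integral_congr_ae (Eventually.of_forall fun y => by ring)
  rw [h2, this]
  ring

theorem Model.measurable_stage (G : Model S A B) (θ : ℝ) {v : ℝ → S → ℝ}
    (hv : Measurable (Function.uncurry v)) :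
    Measurable fun p : (ℝ × S) × A × B => G.stage θ (v p.1.1) p.1.2 p.2.1 p.2.2 := by
  have h1 : Measurable fun p : (ℝ × S) × A × B => (p.1.2, p.2.1, p.2.2) := by fun_prop
  have h2 : Measurable fun p : (ℝ × S) × A × B => v p.1.1 p.1.2 := hv.comp measurable_fst
  refine ((measurable_const.mul (G.measurable_rate.comp h1)).mul h2).add ?_
  have h3 : StronglyMeasurable fun q : ((ℝ × S) × A × B) × S => v q.1.1.1 q.2 - v q.1.1.1 q.1.1.2 := by
    refine Measurable.stronglyMeasurable (Measurable.sub ?_ ?_)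
    · exact hv.comp (by fun_prop : Measurable fun q : ((ℝ × S) × A × B) × S => (q.1.1.1, q.2))
    · exact h2.comp measurable_fst
  exact (h3.integral_kernel_prod_right' (κ := G.jumpKernel.comap _ h1)).measurable

/-- A bounded measurable function is a uniform limit of simple functions. -/
theorem exists_simpleFunc_uniform {Y : Type*} [MeasurableSpace Y] {f : Y → ℝ} (hf : Measurable f)
    {M : ℝ} (hM : ∀ y, |f y| ≤ M) {ε : ℝ} (hε : 0 < ε) :
    ∃ s : SimpleFunc Y ℝ, ∀ y, |f y - s y| ≤ ε := by
  have hfin : (range fun y => ⌊f y / ε⌋).Finite := by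
    refine (finite_Icc ⌊-(M / ε)⌋ ⌊M / ε⌋).subset ?_
    rintro _ ⟨y, rfl⟩
    have h := abs_le.1 (hM y)
    refine ⟨Int.floor_mono ?_, Int.floor_mono ?_⟩
    · rw [← neg_div]; gcongr; exact h.1
    · gcongr; exact h.2
  have hm : Measurable fun y => ⌊f y / ε⌋ := (hf.div_const ε).floor
  let s : SimpleFunc Y ℤ := ⟨fun y => ⌊f y / ε⌋, fun n => hm (measurableSet_singleton n), hfin⟩
  refine ⟨s.map fun n : ℤ => (n : ℝ) * ε, fun y => ?_⟩
  change |f y - (⌊f y / ε⌋ : ℝ) * ε| ≤ ε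
  have h1 := Int.floor_le (f y / ε)
  have h2 := Int.lt_floor_add_one (f y / ε)
  rw [le_div_iff₀ hε] at h1
  rw [div_lt_iff₀ hε] at h2
  rw [abs_le]
  constructor <;> nlinarith

theorem Model.continuousOn_stage [TopologicalSpace A] [TopologicalSpace B] (G : Model S A B)
    (hc : G.CompactContinuous) (θ : ℝ) {w : S → ℝ} (hw : Measurable w) {M : ℝ}
    (hM : ∀ y, |w y| ≤ M) (x : S) :
    ContinuousOn (Function.uncurry (G.stage θ w x)) (G.actA x ×ˢ G.actB x) := by
  refine ContinuousOn.add ?_ ?_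
  · refine ((continuousOn_const (c := θ)).mul (hc.2.2 x) |>.mul
      (continuousOn_const (c := w x))).congr fun p hp => ?_
    simp [G.rate_eq hp.1 hp.2]
  · refine continuousOn_of_uniform_approx_of_continuousOn fun u hu => ?_
    obtain ⟨ε, hε, hεu⟩ := Metric.mem_uniformity_dist.1 hu
    have hq := G.qStar_nonneg x
    obtain ⟨s, hs⟩ := exists_simpleFunc_uniform (f := fun y => w y - w x) (hw.sub_const _)
      (M := M + M) (fun y => (abs_sub _ _).trans (add_le_add (hM y) (hM x)))
      (ε := ε / (G.qStar x + 1)) (by positivity)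
    refine ⟨fun p => ∑ c ∈ s.range, G.q x p.1 p.2 ({x}ᶜ ∩ s ⁻¹' {c}) * c, ?_, fun p hp => ?_⟩
    · refine continuousOn_finsetSum _ fun c _ => ContinuousOn.mul (hc.2.1 x _ ?_) continuousOn_const
      exact (measurableSet_singleton x).compl.inter (s.measurableSet_preimage _)
    · refine hεu ?_
      have h1 : ∑ c ∈ s.range, G.q x p.1 p.2 ({x}ᶜ ∩ s ⁻¹' {c}) * c =
          ∫ y, s y ∂(G.jumpKernel (x, p.1, p.2)) := by
        rw [SimpleFunc.integral_eq_integral _ (SimpleFunc.integrable_of_isFiniteMeasure s) |>.symm,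
          SimpleFunc.integral_eq]
        refine Finset.sum_congr rfl fun c _ => ?_
        rw [G.jumpKernel_real_apply hp.1 hp.2 (s.measurableSet_preimage _), smul_eq_mul]
      rw [Real.dist_eq]
      change |∫ y, (w y - w x) ∂(G.jumpKernel (x, p.1, p.2)) - ∑ c ∈ s.range, _| < ε
      rw [h1]
      rw [← integral_sub (f := fun y => w y - w x)
        ((integrable_of_abs_le hw hM).sub (integrable_const _))
        (SimpleFunc.integrable_of_isFiniteMeasure s)]
      have h2 := norm_integral_le_of_norm_le_const (μ := G.jumpKernel (x, p.1, p.2))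
        (f := fun y => w y - w x - s y) (Eventually.of_forall hs)
      have h3 : (G.jumpKernel (x, p.1, p.2)).real univ ≤ G.qStar x :=
        ENNReal.toReal_le_of_le_ofReal hq (G.jumpKernel_univ_le (x, p.1, p.2))
      refine (h2.trans (mul_le_mul_of_nonneg_left h3 (by positivity))).trans_lt ?_
      rw [div_mul_eq_mul_div, div_lt_iff₀ (by positivity)]
      nlinarith

theorem ae_mem_of_mem_probOn {Y : Type*} [MeasurableSpace Y] {C : Set Y} (hC : MeasurableSet C)
    {μ : Measure Y} (hμ : μ ∈ probOn C) : ∀ᵐ y ∂μ, y ∈ C := by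
  have := hμ.1
  filter_upwards [measure_eq_zero_iff_ae_notMem.1 ((prob_compl_eq_zero_iff hC).2 hμ.2)] with y hy
  exact not_not.1 hy

/-- The mixed payoff as a double integral of the payoff of pure actions. -/
theorem Model.payoff_eq (G : Model S A B) (hG : G.IsBounded) (θ : ℝ) {v : ℝ → S → ℝ}
    {t : ℝ} (hv : Measurable (v t)) {M : ℝ} (hM : ∀ y, |v t y| ≤ M) (x : S)
    {φ : Measure A} {ψ : Measure B} (hφ : φ ∈ probOn (G.actA x)) (hψ : ψ ∈ probOn (G.actB x)) :
    G.payoff θ v t x φ ψ = ∫ a, ∫ b, G.stage θ (v t) x a b ∂ψ ∂φ := by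
  have := hφ.1
  have := hψ.1
  have haA := ae_mem_of_mem_probOn (G.measurableSet_actA x) hφ
  have haB := ae_mem_of_mem_probOn (G.measurableSet_actB x) hψ
  have h1 : ∫ a, ∫ b, G.r x a b ∂ψ ∂φ = ∫ a, ∫ b, G.rate (x, a, b) ∂ψ ∂φ := by
    refine integral_congr_ae ?_
    filter_upwards [haA] with a ha
    refine integral_congr_ae ?_
    filter_upwards [haB] with b hb
    exact (G.rate_eq ha hb).symm
  have h2 : ∫ a, ∫ b, (G.q x a b).integral (v t) (ContinuousLinearMap.lsmul ℝ ℝ) ∂ψ ∂φ =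
      ∫ a, ∫ b, ∫ y, (v t y - v t x) ∂(G.jumpKernel (x, a, b)) ∂ψ ∂φ := by
    refine integral_congr_ae ?_
    filter_upwards [haA] with a ha
    refine integral_congr_ae ?_
    filter_upwards [haB] with b hb
    exact G.integral_q ha hb hv hM
  have hx : Measurable fun p : A × B => (x, p.1, p.2) := by fun_prop
  have hi1 : Integrable (fun p : A × B => G.rate (x, p.1, p.2)) (φ.prod ψ) :=
    integrable_of_abs_le (G.measurable_rate.comp hx) fun p => G.abs_rate_le hG _
  have hm2 : Measurable fun p : A × B => ∫ y, (v t y - v t x) ∂(G.jumpKernel (x, p.1, p.2)) := by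
    have h3 : StronglyMeasurable fun q : (A × B) × S => v t q.2 - v t x :=
      ((hv.comp measurable_snd).sub_const _).stronglyMeasurable
    exact (h3.integral_kernel_prod_right' (κ := G.jumpKernel.comap _ hx)).measurable
  have hi2 : Integrable (fun p : A × B => ∫ y, (v t y - v t x) ∂(G.jumpKernel (x, p.1, p.2)))
      (φ.prod ψ) :=
    integrable_of_abs_le hm2 fun p => G.abs_integral_jump_le hG hM (x, p.1, p.2)
  rw [Model.payoff, h1, h2]
  have h5 := integral_prod _ hi1
  have h6 := integral_prod _ hi2
  have hi3 : Integrable (fun p : A × B => θ * G.rate (x, p.1, p.2) * v t x) (φ.prod ψ) :=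
    (hi1.const_mul θ).mul_const _
  have h7 := integral_prod _ (hi3.add hi2)
  simp only [Pi.add_apply] at h7
  simp only [Model.stage]
  rw [← h7, ← h5, ← h6, integral_add hi3 hi2, integral_mul_const, integral_const_mul]

theorem Model.measurable_stage_actions (G : Model S A B) (θ : ℝ) {w : S → ℝ} (hw : Measurable w)
    (x : S) : Measurable fun p : A × B => G.stage θ w x p.1 p.2 :=
  (G.measurable_stage θ (v := fun _ => w) (hw.comp measurable_snd)).comp
    (by fun_prop : Measurable fun p : A × B => (((0 : ℝ), x), p.1, p.2))

theorem Model.integrable_stage (G : Model S A B) (hG : G.IsBounded) {θ : ℝ} (hθ : 0 ≤ θ)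
    {w : S → ℝ} (hw : Measurable w) {M : ℝ} (hM : ∀ y, |w y| ≤ M) (x : S)
    (μ : Measure (A × B)) [IsFiniteMeasure μ] :
    Integrable (fun p : A × B => G.stage θ w x p.1 p.2) μ :=
  integrable_of_abs_le (G.measurable_stage_actions θ hw x) fun p => G.abs_stage_le hG hθ hM x p.1 p.2

theorem Model.abs_integral_stage_le (G : Model S A B) (hG : G.IsBounded) {θ : ℝ} (hθ : 0 ≤ θ)
    {w : S → ℝ} {M : ℝ} (hM : ∀ y, |w y| ≤ M) (x : S)
    (φ : Measure A) (ψ : Measure B) [IsProbabilityMeasure φ] [IsProbabilityMeasure ψ] :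
    |∫ a, ∫ b, G.stage θ w x a b ∂ψ ∂φ| ≤ G.lip θ * M := by
  have h1 : ∀ a, ‖∫ b, G.stage θ w x a b ∂ψ‖ ≤ G.lip θ * M := fun a => by
    simpa using norm_integral_le_of_norm_le_const (μ := ψ) (f := fun b => G.stage θ w x a b)
      (Eventually.of_forall fun b => G.abs_stage_le hG hθ hM x a b)
  simpa using norm_integral_le_of_norm_le_const (μ := φ) (Eventually.of_forall h1)

theorem Model.abs_payoff_le (G : Model S A B) (hG : G.IsBounded) {θ : ℝ} (hθ : 0 ≤ θ)
    {v : ℝ → S → ℝ} {t : ℝ} (hv : Measurable (v t)) {M : ℝ} (hM : ∀ y, |v t y| ≤ M) (x : S)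
    {φ : Measure A} {ψ : Measure B} (hφ : φ ∈ probOn (G.actA x)) (hψ : ψ ∈ probOn (G.actB x)) :
    |G.payoff θ v t x φ ψ| ≤ G.lip θ * M := by
  have := hφ.1
  have := hψ.1
  rw [G.payoff_eq hG θ hv hM x hφ hψ]
  exact G.abs_integral_stage_le hG hθ hM x φ ψ

/-- The mixed payoff is Lipschitz in the continuation values. -/
theorem Model.abs_payoff_sub_le (G : Model S A B) (hG : G.IsBounded) {θ : ℝ} (hθ : 0 ≤ θ)
    {v v' : ℝ → S → ℝ} {t : ℝ} (hv : Measurable (v t)) (hv' : Measurable (v' t)) {M : ℝ}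
    (hM : ∀ y, |v t y| ≤ M) (hM' : ∀ y, |v' t y| ≤ M) {δ : ℝ} (hδ : ∀ y, |v t y - v' t y| ≤ δ)
    (x : S) {φ : Measure A} {ψ : Measure B} (hφ : φ ∈ probOn (G.actA x))
    (hψ : ψ ∈ probOn (G.actB x)) :
    |G.payoff θ v t x φ ψ - G.payoff θ v' t x φ ψ| ≤ G.lip θ * δ := by
  have := hφ.1
  have := hψ.1
  rw [G.payoff_eq hG θ hv hM x hφ hψ, G.payoff_eq hG θ hv' hM' x hφ hψ,
    ← integral_prod _ (G.integrable_stage hG hθ hv hM x _),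
    ← integral_prod _ (G.integrable_stage hG hθ hv' hM' x _),
    ← integral_sub (G.integrable_stage hG hθ hv hM x _) (G.integrable_stage hG hθ hv' hM' x _)]
  simp only [G.stage_sub hv hv' hM hM' x]
  rw [integral_prod _ (G.integrable_stage hG hθ (w := fun y => v t y - v' t y) (hv.sub hv') hδ x _)]
  exact G.abs_integral_stage_le hG hθ hδ x φ ψ

/-- The one-stage value. -/
noncomputable def Model.supInf (G : Model S A B) (θ : ℝ) (v : ℝ → S → ℝ) (t : ℝ) (x : S) : ℝ :=
  ⨆ φ : probOn (G.actA x), ⨅ ψ : probOn (G.actB x), G.payoff θ v t x φ ψ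

omit [StandardBorelSpace S] in
theorem Model.RealisesSupInf.congr {G : Model S A B} {θ : ℝ} {v v' : ℝ → S → ℝ} {t t' : ℝ} {x : S}
    {φ : Measure A} {ψ : Measure B} (h : G.RealisesSupInf θ v t x φ ψ) (hv : v t = v' t') :
    G.RealisesSupInf θ v' t' x φ ψ := by
  simpa only [Model.RealisesSupInf, Model.payoff, hv] using h

omit [StandardBorelSpace S] in
theorem Model.supInf_congr {G : Model S A B} {θ : ℝ} {v v' : ℝ → S → ℝ} {t t' : ℝ} {x : S}
    (hv : v t = v' t') : G.supInf θ v t x = G.supInf θ v' t' x := by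
  simp only [Model.supInf, Model.payoff, hv]

theorem Model.realisesSupInf_of_saddle (G : Model S A B) (hG : G.IsBounded) {θ : ℝ} (hθ : 0 ≤ θ)
    {v : ℝ → S → ℝ} {t : ℝ} (hv : Measurable (v t)) {M : ℝ} (hM : ∀ y, |v t y| ≤ M) {x : S}
    {φ : Measure A} {ψ : Measure B} (hφ : φ ∈ probOn (G.actA x)) (hψ : ψ ∈ probOn (G.actB x))
    (h : ∀ a ∈ G.actA x, ∀ b ∈ G.actB x, ∫ b', G.stage θ (v t) x a b' ∂ψ ≤
      ∫ a', G.stage θ (v t) x a' b ∂φ) :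
    G.RealisesSupInf θ v t x φ ψ := by
  have hφp := hφ.1
  have hψp := hψ.1
  have key : ∀ φ' ∈ probOn (G.actA x), ∀ ψ' ∈ probOn (G.actB x),
      G.payoff θ v t x φ' ψ ≤ G.payoff θ v t x φ ψ' := by
    intro φ' hφ' ψ' hψ'
    have := hφ'.1
    have := hψ'.1
    have hswap := integral_integral_swap (f := G.stage θ (v t) x)
      (G.integrable_stage hG hθ hv hM x (φ.prod ψ'))
    rw [G.payoff_eq hG θ hv hM x hφ' hψ, G.payoff_eq hG θ hv hM x hφ hψ', hswap]
    have hi1 := (G.integrable_stage hG hθ hv hM x (φ'.prod ψ)).integral_prod_left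
    have hi2 := (G.integrable_stage hG hθ hv hM x (φ.prod ψ')).integral_prod_right
    have h1 : ∀ a ∈ G.actA x, ∫ b', G.stage θ (v t) x a b' ∂ψ ≤
        ∫ b, ∫ a', G.stage θ (v t) x a' b ∂φ ∂ψ' := by
      intro a ha
      have := integral_mono_ae (μ := ψ') (integrable_const (∫ b', G.stage θ (v t) x a b' ∂ψ)) hi2 (by
        filter_upwards [ae_mem_of_mem_probOn (G.measurableSet_actB x) hψ'] with b hb
        exact h a ha b hb)
      simpa using this
    have := integral_mono_ae (μ := φ') hi1
      (integrable_const (∫ b, ∫ a', G.stage θ (v t) x a' b ∂φ ∂ψ')) (by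
        filter_upwards [ae_mem_of_mem_probOn (G.measurableSet_actA x) hφ'] with a ha
        exact h1 a ha)
    simpa using this
  have hb := fun (φ' : probOn (G.actA x)) (ψ' : probOn (G.actB x)) =>
    abs_le.1 (G.abs_payoff_le hG hθ hv hM x φ'.2 ψ'.2)
  have : Nonempty (probOn (G.actA x)) := ⟨⟨φ, hφ⟩⟩
  have : Nonempty (probOn (G.actB x)) := ⟨⟨ψ, hψ⟩⟩
  have hbb : ∀ φ' : probOn (G.actA x), BddBelow (range fun ψ' : probOn (G.actB x) =>
      G.payoff θ v t x φ' ψ') := fun φ' => ⟨-(G.lip θ * M), by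
    rintro _ ⟨ψ', rfl⟩
    exact (hb φ' ψ').1⟩
  refine ⟨hφ, hψ, le_antisymm ?_ ?_, fun φ' hφ' => key φ' hφ' ψ hψ, fun ψ' hψ' => key φ hφ ψ' hψ'⟩
  · refine le_ciSup_of_le ⟨G.lip θ * M, ?_⟩ (⟨φ, hφ⟩ : probOn (G.actA x)) ?_
    · rintro _ ⟨φ', rfl⟩
      exact (ciInf_le (hbb φ') ⟨ψ, hψ⟩).trans (hb φ' ⟨ψ, hψ⟩).2
    · exact le_ciInf fun ψ' => key φ hφ ψ' ψ'.2
  · exact ciSup_le fun φ' => (ciInf_le (hbb φ') ⟨ψ, hψ⟩).trans (key φ' φ'.2 ψ hψ)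

variable [TopologicalSpace A] [TopologicalSpace.MetrizableSpace A] [SecondCountableTopology A]
  [BorelSpace A] [StandardBorelSpace A]
  [TopologicalSpace B] [TopologicalSpace.MetrizableSpace B] [SecondCountableTopology B]
  [BorelSpace B] [StandardBorelSpace B]

/-- Existence of Markov policies that are optimal in every one-stage game. -/
theorem Model.exists_realisesSupInf (G : Model S A B) (hc : G.CompactContinuous)
    (hG : G.IsBounded) {θ : ℝ} (hθ : 0 ≤ θ) {v : ℝ → S → ℝ}
    (hv : Measurable (Function.uncurry v)) {M : ℝ} (hM : ∀ t y, |v t y| ≤ M) :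
    ∃ (φ : MarkovPolicy G.actA) (ψ : MarkovPolicy G.actB), ∀ t x,
      G.RealisesSupInf θ v t x (φ.ker (x, t)) (ψ.ker (x, t)) := by
  have hvt : ∀ t, Measurable (v t) := fun t => hv.comp measurable_prodMk_left
  obtain ⟨φ, ψ, h1, h2, h3, h4, h5⟩ := exists_measurable_saddle (X := ℝ × S)
    (KA := fun p => G.actA p.2) (KB := fun p => G.actB p.2)
    (C := fun p => G.stage θ (v p.1) p.2)
    (fun p => (hc.1 p.2).1) (fun p => (hc.1 p.2).2) (fun p => G.nonempty_actA p.2)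
    (fun p => G.nonempty_actB p.2)
    (G.measurableSet_graph.preimage
      (by fun_prop : Measurable fun p : (ℝ × S) × A × B => (p.1.2, p.2.1, p.2.2)))
    (G.measurable_stage θ hv) (fun p => G.continuousOn_stage hc θ (hvt p.1) (hM p.1) p.2)
  refine ⟨⟨φ.comap Prod.swap measurable_swap, inferInstance, fun x t => h3 (t, x)⟩,
    ⟨ψ.comap Prod.swap measurable_swap, inferInstance, fun x t => h4 (t, x)⟩, fun t x => ?_⟩
  exact G.realisesSupInf_of_saddle hG hθ (hvt t) (hM t)
    ⟨h1.isProbabilityMeasure (t, x), h3 (t, x)⟩ ⟨h2.isProbabilityMeasure (t, x), h4 (t, x)⟩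
    (h5 (t, x))

theorem Model.measurable_supInf (G : Model S A B) (hc : G.CompactContinuous)
    (hG : G.IsBounded) {θ : ℝ} (hθ : 0 ≤ θ) {v : ℝ → S → ℝ}
    (hv : Measurable (Function.uncurry v)) {M : ℝ} (hM : ∀ t y, |v t y| ≤ M) :
    Measurable fun p : ℝ × S => G.supInf θ v p.1 p.2 := by
  obtain ⟨φ, ψ, h⟩ := G.exists_realisesSupInf hc hG hθ hv hM
  have := φ.isMarkov
  have := ψ.isMarkov
  have h1 : (fun p : ℝ × S => G.supInf θ v p.1 p.2) = fun p : ℝ × S =>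
      ∫ a, ∫ b, G.stage θ (v p.1) p.2 a b ∂(ψ.ker (p.2, p.1)) ∂(φ.ker (p.2, p.1)) := by
    ext ⟨t, x⟩
    obtain ⟨h1, h2, h3, -⟩ := h t x
    rw [Model.supInf, ← h3]
    exact G.payoff_eq hG θ (hv.comp measurable_prodMk_left) (hM t) x h1 h2
  rw [h1]
  have h2 : StronglyMeasurable fun q : ((ℝ × S) × A) × B =>
      G.stage θ (v q.1.1.1) q.1.1.2 q.1.2 q.2 :=
    ((G.measurable_stage θ hv).comp (by fun_prop : Measurable fun q : ((ℝ × S) × A) × B =>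
      (q.1.1, q.1.2, q.2))).stronglyMeasurable
  have h3 := h2.integral_kernel_prod_right'
    (κ := (ψ.ker.comap Prod.swap measurable_swap).comap (Prod.fst : (ℝ × S) × A → ℝ × S)
      measurable_fst)
  exact (h3.integral_kernel_prod_right' (κ := φ.ker.comap Prod.swap measurable_swap)).measurable

theorem Model.exists_realisesSupInf_at (G : Model S A B) (hc : G.CompactContinuous)
    (hG : G.IsBounded) {θ : ℝ} (hθ : 0 ≤ θ) {v : ℝ → S → ℝ} {t : ℝ}
    (hv : Measurable (v t)) {M : ℝ} (hM : ∀ y, |v t y| ≤ M) (x : S) :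
    ∃ φ ψ, G.RealisesSupInf θ v t x φ ψ := by
  obtain ⟨φ, ψ, h⟩ := G.exists_realisesSupInf hc hG hθ (v := fun _ => v t)
    (hv.comp measurable_snd) (fun _ => hM)
  exact ⟨_, _, (h t x).congr rfl⟩

/-- The one-stage value is Lipschitz in the continuation values. -/
theorem Model.abs_supInf_sub_le (G : Model S A B) (hc : G.CompactContinuous)
    (hG : G.IsBounded) {θ : ℝ} (hθ : 0 ≤ θ) {v v' : ℝ → S → ℝ} {t : ℝ} (hv : Measurable (v t))
    (hv' : Measurable (v' t)) {M : ℝ} (hM : ∀ y, |v t y| ≤ M) (hM' : ∀ y, |v' t y| ≤ M) {δ : ℝ}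
    (hδ : ∀ y, |v t y - v' t y| ≤ δ) (x : S) :
    |G.supInf θ v t x - G.supInf θ v' t x| ≤ G.lip θ * δ := by
  obtain ⟨φ, ψ, h1, h2, h3, h4, h5⟩ := G.exists_realisesSupInf_at hc hG hθ hv hM x
  obtain ⟨φ', ψ', h1', h2', h3', h4', h5'⟩ := G.exists_realisesSupInf_at hc hG hθ hv' hM' x
  have e1 := abs_le.1 (G.abs_payoff_sub_le hG hθ hv hv' hM hM' hδ x h1 h2')
  have e2 := abs_le.1 (G.abs_payoff_sub_le hG hθ hv hv' hM hM' hδ x h1' h2)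
  have e3 := h5 ψ' h2'
  have e4 := h4 φ' h1'
  have e5 := h5' ψ h2
  have e6 := h4' φ h1
  rw [Model.supInf, Model.supInf, ← h3, ← h3', abs_le]
  constructor <;> linarith

theorem Model.abs_supInf_le (G : Model S A B) (hc : G.CompactContinuous)
    (hG : G.IsBounded) {θ : ℝ} (hθ : 0 ≤ θ) {v : ℝ → S → ℝ} {t : ℝ} (hv : Measurable (v t))
    {M : ℝ} (hM : ∀ y, |v t y| ≤ M) (x : S) : |G.supInf θ v t x| ≤ G.lip θ * M := by
  obtain ⟨φ, ψ, h1, h2, h3, -⟩ := G.exists_realisesSupInf_at hc hG hθ hv hM x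
  rw [Model.supInf, ← h3]
  exact G.abs_payoff_le hG hθ hv hM x h1 h2

end OneStage

section Primitive

theorem intervalIntegrable_of_abs_le {f : ℝ → ℝ} (hf : Measurable f) {c : ℝ}
    (hc : ∀ s, |f s| ≤ c) (a b : ℝ) : IntervalIntegrable f volume a b :=
  (intervalIntegrable_const (c := c)).mono_fun hf.aestronglyMeasurable
    (Eventually.of_forall fun s => (hc s).trans (le_abs_self c))

theorem abs_intervalIntegral_le {f : ℝ → ℝ} {c : ℝ} (hc : ∀ s, |f s| ≤ c) (a b : ℝ) :
    |∫ s in a..b, f s| ≤ c * |b - a| :=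
  intervalIntegral.norm_integral_le_of_norm_le_const (f := f) fun s _ => hc s

theorem locallyIntegrable_of_abs_le {f : ℝ → ℝ} (hf : Measurable f) {c : ℝ}
    (hc : ∀ s, |f s| ≤ c) : LocallyIntegrable f volume :=
  (locallyIntegrable_const c).mono hf.aestronglyMeasurable
    (Eventually.of_forall fun s => (hc s).trans (le_abs_self c))

theorem continuous_primitive_of_abs_le {f : ℝ → ℝ} (hf : Measurable f) {c : ℝ}
    (hc : ∀ s, |f s| ≤ c) : Continuous fun s => ∫ u in (0 : ℝ)..s, f u :=
  intervalIntegral.continuous_primitive (intervalIntegrable_of_abs_le hf hc) 0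

theorem absolutelyContinuous_exp_primitive {f : ℝ → ℝ} (hf : Measurable f) {c : ℝ}
    (hc : ∀ s, |f s| ≤ c) (a : ℝ) :
    AbsolutelyContinuousOnInterval (fun s => Real.exp (∫ u in (0 : ℝ)..s, f u)) 0 a := by
  have hc0 : 0 ≤ c := (abs_nonneg _).trans (hc 0)
  set R := c * |a| with hR
  have hexp : LipschitzOnWith (Real.toNNReal (Real.exp R)) Real.exp (Icc (-R) R) := by
    refine (convex_Icc _ _).lipschitzOnWith_of_nnnorm_deriv_le
      (fun x _ => Real.differentiableAt_exp) fun x hx => ?_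
    rw [Real.deriv_exp, ← NNReal.coe_le_coe, coe_nnnorm, Real.coe_toNNReal _ (Real.exp_pos _).le,
      Real.norm_of_nonneg (Real.exp_pos _).le]
    exact Real.exp_le_exp.2 hx.2
  have hprim : LipschitzOnWith (Real.toNNReal c) (fun s => ∫ u in (0 : ℝ)..s, f u) (uIcc 0 a) := by
    refine LipschitzOnWith.of_dist_le_mul fun x _ y _ => ?_
    rw [Real.dist_eq, Real.dist_eq, Real.coe_toNNReal _ hc0, intervalIntegral.integral_interval_sub_left
      (intervalIntegrable_of_abs_le hf hc 0 x) (intervalIntegrable_of_abs_le hf hc 0 y)]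
    exact abs_intervalIntegral_le hc y x
  refine (hexp.comp hprim fun s hs => ?_).absolutelyContinuousOnInterval
  have h1 := abs_intervalIntegral_le hc 0 s
  have h2 : |s - 0| ≤ |a| := by
    rw [sub_zero]
    rcases le_total 0 a with h | h
    · rw [uIcc_of_le h] at hs
      rw [abs_of_nonneg hs.1, abs_of_nonneg h]
      exact hs.2
    · rw [uIcc_of_ge h] at hs
      rw [abs_of_nonpos hs.2, abs_of_nonpos h]
      linarith [hs.1]
  exact abs_le.1 (h1.trans (mul_le_mul_of_nonneg_left h2 hc0))

/-- Variation of constants for bounded measurable coefficients. -/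
theorem exp_primitive_mul_sub {κ η : ℝ → ℝ} (hκ : Measurable κ) (hη : Measurable η) {c c' : ℝ}
    (hc : ∀ s, |κ s| ≤ c) (hc' : ∀ s, |η s| ≤ c') (z a : ℝ) :
    Real.exp (∫ u in (0 : ℝ)..a, κ u) * (z - ∫ u in (0 : ℝ)..a, η u) - z =
      ∫ s in (0 : ℝ)..a, Real.exp (∫ u in (0 : ℝ)..s, κ u) *
        (κ s * (z - ∫ u in (0 : ℝ)..s, η u) - η s) := by
  have h1 := absolutelyContinuous_exp_primitive hκ hc a
  have h2 : AbsolutelyContinuousOnInterval (fun s => z - ∫ u in (0 : ℝ)..s, η u) 0 a := by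
    have h3 : AbsolutelyContinuousOnInterval (fun _ : ℝ => z) 0 a :=
      (LipschitzOnWith.of_dist_le_mul (K := 0) fun x _ y _ => by simp).absolutelyContinuousOnInterval
    exact h3.sub ((intervalIntegrable_of_abs_le hη hc' 0
      a).absolutelyContinuousOnInterval_intervalIntegral left_mem_uIcc)
  have h3 := h1.integral_deriv_mul_eq_sub h2
  simp only [intervalIntegral.integral_same, Real.exp_zero, sub_zero, one_mul] at h3
  rw [← h3]
  refine intervalIntegral.integral_congr_ae ?_
  filter_upwards [LocallyIntegrable.ae_hasDerivAt_integral (locallyIntegrable_of_abs_le hκ hc),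
    LocallyIntegrable.ae_hasDerivAt_integral (locallyIntegrable_of_abs_le hη hc')] with s hs1 hs2 _
  rw [(hs1 0).exp.deriv, ((hs2 0).const_sub z).deriv]
  ring

end Primitive

section Step

variable {S A B : Type*} [MeasurableSpace S] [StandardBorelSpace S] [MeasurableSpace A]
  [MeasurableSpace B] (G : Model S A B) (π₁ : Policy G.actA) (π₂ : Policy G.actB)

/-- The payoff rate in the current state under a pair of policies. -/
noncomputable def Model.meanRate (k : ℕ) (p : Hist S k × ℝ) : ℝ :=
  ∫ a, ∫ b, G.rate (lastState p.1, a, b) ∂(π₂.ker k p) ∂(π₁.ker k p)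

/-- The total jump rate under a pair of policies. -/
noncomputable def Model.intensity (k : ℕ) (p : Hist S k × ℝ) : ℝ :=
  (G.jumpRate π₁ π₂ k p).real univ

instance Model.isFiniteMeasure_jumpRate (k : ℕ) (p : Hist S k × ℝ) :
    IsFiniteMeasure (G.jumpRate π₁ π₂ k p) :=
  ⟨(G.jumpRate_univ_le π₁ π₂ k p.1 p.2).trans_lt ENNReal.ofReal_lt_top⟩

omit [StandardBorelSpace S] in
theorem Policy.mem_probOn {C : Type*} [MeasurableSpace C] {act : S → Set C} (π : Policy act)
    (k : ℕ) (p : Hist S k × ℝ) : π.ker k p ∈ probOn (act (lastState p.1)) :=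
  ⟨(π.isMarkov k).isProbabilityMeasure p, π.ker_act k p.1 p.2⟩

omit [StandardBorelSpace S] in
theorem Model.meanRate_eq (k : ℕ) (p : Hist S k × ℝ) :
    ∫ a, ∫ b, G.r (lastState p.1) a b ∂(π₂.ker k p) ∂(π₁.ker k p) = G.meanRate π₁ π₂ k p := by
  refine integral_congr_ae ?_
  filter_upwards [ae_mem_of_mem_probOn (G.measurableSet_actA _) (π₁.mem_probOn k p)] with a ha
  refine integral_congr_ae ?_
  filter_upwards [ae_mem_of_mem_probOn (G.measurableSet_actB _) (π₂.mem_probOn k p)] with b hb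
  exact (G.rate_eq ha hb).symm

omit [StandardBorelSpace S] in
theorem Model.measurable_meanRate (k : ℕ) : Measurable (G.meanRate π₁ π₂ k) := by
  have := π₁.isMarkov k
  have := π₂.isMarkov k
  have h : StronglyMeasurable fun q : ((Hist S k × ℝ) × A) × B =>
      G.rate (lastState q.1.1.1, q.1.2, q.2) := by
    refine (G.measurable_rate.comp ?_).stronglyMeasurable
    exact (measurable_lastState.comp (measurable_fst.comp (measurable_fst.comp
      measurable_fst))).prodMk ((measurable_snd.comp measurable_fst).prodMk measurable_snd)
  have h3 := h.integral_kernel_prod_right' (κ := (π₂.ker k).comap Prod.fst measurable_fst)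
  exact (h3.integral_kernel_prod_right' (κ := π₁.ker k)).measurable

omit [StandardBorelSpace S] in
theorem Model.abs_meanRate_le (hG : G.IsBounded) (k : ℕ) (p : Hist S k × ℝ) :
    |G.meanRate π₁ π₂ k p| ≤ G.rNorm := by
  have := (π₁.isMarkov k).isProbabilityMeasure p
  have := (π₂.isMarkov k).isProbabilityMeasure p
  have h1 : ∀ a, ‖∫ b, G.rate (lastState p.1, a, b) ∂(π₂.ker k p)‖ ≤ G.rNorm := fun a => by
    simpa using norm_integral_le_of_norm_le_const (μ := π₂.ker k p)
      (f := fun b => G.rate (lastState p.1, a, b)) (Eventually.of_forall fun b => G.abs_rate_le hG _)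
  simpa [Model.meanRate] using
    norm_integral_le_of_norm_le_const (μ := π₁.ker k p) (Eventually.of_forall h1)

theorem Model.measurable_intensity (k : ℕ) : Measurable (G.intensity π₁ π₂ k) :=
  ((G.jumpRate π₁ π₂ k).measurable_coe MeasurableSet.univ).ennreal_toReal

theorem Model.intensity_nonneg (k : ℕ) (p : Hist S k × ℝ) : 0 ≤ G.intensity π₁ π₂ k p :=
  measureReal_nonneg

theorem Model.abs_intensity_le (hG : G.IsBounded) (k : ℕ) (p : Hist S k × ℝ) :
    |G.intensity π₁ π₂ k p| ≤ G.qNorm := by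
  rw [abs_of_nonneg (G.intensity_nonneg π₁ π₂ k p)]
  exact (ENNReal.toReal_le_of_le_ofReal (G.qStar_nonneg _)
    (G.jumpRate_univ_le π₁ π₂ k p.1 p.2)).trans (le_ciSup hG.1 _)

theorem Model.integral_jumpRate (k : ℕ) (p : Hist S k × ℝ) {w : S → ℝ}
    (hw : Measurable w) {M : ℝ} (hM : ∀ y, |w y| ≤ M) :
    ∫ y, w y ∂(G.jumpRate π₁ π₂ k p) = ∫ ab, ∫ y, w y ∂(G.jumpKernel (lastState p.1, ab))
      ∂((π₁.ker k p).prod (π₂.ker k p)) := by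
  have := π₁.isMarkov k
  have := π₂.isMarkov k
  have hi : Integrable w (G.jumpRate π₁ π₂ k p) := integrable_of_abs_le hw hM
  rw [Model.jumpRate] at hi ⊢
  rw [Kernel.integral_comp hi, Kernel.prod_apply, Kernel.deterministic_apply, Measure.dirac_prod,
    integral_map measurable_prodMk_left.aemeasurable, Kernel.prod_apply]
  exact (hw.comp measurable_snd).stronglyMeasurable.integral_kernel_prod_right'.aestronglyMeasurable

/-- The mixed one-stage payoff under a pair of policies. -/
theorem Model.payoff_policy (hG : G.IsBounded) {θ : ℝ} (k : ℕ) (p : Hist S k × ℝ)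
    {v : ℝ → S → ℝ} {t : ℝ} (hv : Measurable (v t)) {M : ℝ} (hM : ∀ y, |v t y| ≤ M) :
    G.payoff θ v t (lastState p.1) (π₁.ker k p) (π₂.ker k p) =
      (θ * G.meanRate π₁ π₂ k p - G.intensity π₁ π₂ k p) * v t (lastState p.1) +
        ∫ y, v t y ∂(G.jumpRate π₁ π₂ k p) := by
  have := (π₁.isMarkov k).isProbabilityMeasure p
  have := (π₂.isMarkov k).isProbabilityMeasure p
  set x := lastState p.1
  have hx : Measurable fun p : A × B => (x, p.1, p.2) := by fun_prop
  have hi1 : Integrable (fun ab : A × B => G.rate (x, ab)) ((π₁.ker k p).prod (π₂.ker k p)) :=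
    integrable_of_abs_le (G.measurable_rate.comp hx) fun p => G.abs_rate_le hG _
  have hm2 : Measurable fun p : A × B => ∫ y, (v t y - v t x) ∂(G.jumpKernel (x, p)) := by
    have h3 : StronglyMeasurable fun q : (A × B) × S => v t q.2 - v t x :=
      ((hv.comp measurable_snd).sub_const _).stronglyMeasurable
    exact (h3.integral_kernel_prod_right' (κ := G.jumpKernel.comap _ hx)).measurable
  have hi2 : Integrable (fun p : A × B => ∫ y, (v t y - v t x) ∂(G.jumpKernel (x, p)))
      ((π₁.ker k p).prod (π₂.ker k p)) :=
    integrable_of_abs_le hm2 fun p => G.abs_integral_jump_le hG hM (x, p)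
  have hi3 : Integrable (fun ab : A × B => θ * G.rate (x, ab) * v t x)
      ((π₁.ker k p).prod (π₂.ker k p)) := (hi1.const_mul θ).mul_const _
  rw [G.payoff_eq hG θ hv hM x (π₁.mem_probOn k p) (π₂.mem_probOn k p)]
  have h7 := integral_prod _ (hi3.add hi2)
  simp only [Pi.add_apply] at h7
  have h5 := integral_prod _ hi1
  have h8 := G.integral_jumpRate π₁ π₂ k p (w := fun y => v t y - v t x) (hv.sub_const _)
    (M := M + M) (fun y => (abs_sub _ _).trans (add_le_add (hM y) (hM x)))
  rw [integral_sub (integrable_of_abs_le hv hM) (integrable_const _), integral_const,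
    smul_eq_mul] at h8
  simp only [Model.stage]
  rw [← h7, integral_add hi3 hi2, integral_mul_const, integral_const_mul, h5, ← h8]
  simp only [Model.meanRate, Model.intensity]
  ring

theorem Model.survival_toReal (k : ℕ) (h : Hist S k) {s : ℝ} (hs : 0 ≤ s) :
    (G.survival π₁ π₂ k h s).toReal =
      Real.exp (-∫ u in (0 : ℝ)..s, G.intensity π₁ π₂ k (h, u)) := by
  rw [Model.survival, ENNReal.toReal_ofReal (Real.exp_pos _).le, intervalIntegral.integral_of_le hs]
  congr 2
  refine (integral_toReal ?_ ?_).symm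
  · exact (((G.jumpRate π₁ π₂ k).measurable_coe MeasurableSet.univ).comp
      measurable_prodMk_left).aemeasurable
  · exact Eventually.of_forall fun u => measure_lt_top _ _

theorem Model.integral_nextJump (k : ℕ) (h : Hist S k) {f : ℝ × S → ℝ}
    (hf : Measurable f) {M : ℝ} (hM : ∀ z, |f z| ≤ M) :
    ∫ z, f z ∂(G.nextJump π₁ π₂ k h) = ∫ s in Ioi (0 : ℝ), (G.survival π₁ π₂ k h s).toReal *
      ∫ y, f (s, y) ∂(G.jumpRate π₁ π₂ k (h, s)) := by
  have hfin : IsFiniteMeasure (G.nextJump π₁ π₂ k h) :=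
    ⟨(G.nextJump_univ_le π₁ π₂ k h).trans_lt ENNReal.one_lt_top⟩
  have hs := G.measurable_survival π₁ π₂ k
  have hs2 : ∀ h' s, G.survival π₁ π₂ k h' s < ∞ := fun h' s => by
    rw [Model.survival]
    exact ENNReal.ofReal_lt_top
  have hsf : IsSFiniteKernel (Kernel.withDensity
      (Kernel.const (Hist S k) (volume.restrict (Ioi (0 : ℝ)))) (G.survival π₁ π₂ k)) :=
    Kernel.IsSFiniteKernel.withDensity _ fun h' s => (hs2 h' s).ne
  have hi : Integrable f (G.nextJump π₁ π₂ k h) := integrable_of_abs_le hf hM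
  have h1 : ∫ z, f z ∂(G.nextJump π₁ π₂ k h) = ∫ s, ∫ y, f (s, y) ∂(G.jumpRate π₁ π₂ k (h, s))
      ∂(Kernel.withDensity (Kernel.const (Hist S k) (volume.restrict (Ioi (0 : ℝ))))
        (G.survival π₁ π₂ k) h) := ProbabilityTheory.integral_compProd hi
  have hs1 : Measurable (G.survival π₁ π₂ k h) := hs.of_uncurry_left
  rw [h1, Kernel.withDensity_apply _ hs, Kernel.const_apply]
  exact integral_withDensity_eq_integral_toReal_smul hs1 (Eventually.of_forall (hs2 h)) _

theorem Model.integral_step (k : ℕ) (h : Hist S k) {f : ℝ≥0∞ × S → ℝ}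
    (hf : Measurable f) {M : ℝ} (hM : ∀ z, |f z| ≤ M) (hf0 : f (∞, lastState h) = 0) :
    ∫ z, f z ∂(G.step π₁ π₂ k h) = ∫ s in Ioi (0 : ℝ), (G.survival π₁ π₂ k h s).toReal *
      ∫ y, f (ENNReal.ofReal s, y) ∂(G.jumpRate π₁ π₂ k (h, s)) := by
  have hmap : Measurable (Prod.map ENNReal.ofReal (id : S → S)) :=
    ENNReal.measurable_ofReal.prodMap measurable_id
  have hfin : IsFiniteMeasure (G.nextJump π₁ π₂ k h) :=
    ⟨(G.nextJump_univ_le π₁ π₂ k h).trans_lt ENNReal.one_lt_top⟩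
  have hstep : G.step π₁ π₂ k h = (G.nextJump π₁ π₂ k h).map (Prod.map ENNReal.ofReal id) +
    (1 - G.nextJump π₁ π₂ k h univ) • Measure.dirac (∞, lastState h) := rfl
  have hfd : IsFiniteMeasure ((1 - G.nextJump π₁ π₂ k h univ) •
      Measure.dirac ((∞ : ℝ≥0∞), lastState h)) :=
    Measure.smul_finite _ (tsub_le_self.trans_lt ENNReal.one_lt_top).ne
  rw [hstep, integral_add_measure (integrable_of_abs_le hf hM) (integrable_of_abs_le hf hM),
    integral_smul_measure, integral_dirac' _ _ hf.stronglyMeasurable, hf0, smul_zero, add_zero,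
    integral_map hmap.aemeasurable hf.aestronglyMeasurable]
  exact G.integral_nextJump π₁ π₂ k h (hf.comp hmap) fun z => hM _

end Step

section OneStep

variable {S A B : Type*} [MeasurableSpace S] [StandardBorelSpace S] [MeasurableSpace A]
  [MeasurableSpace B] (G : Model S A B) (π₁ : Policy G.actA) (π₂ : Policy G.actB)

/-- The continuation value after the next jump, within a remaining horizon `a`. -/
noncomputable def Model.stepValue (θ : ℝ) (k : ℕ) (h : Hist S k) (a : ℝ) (w : ℝ → S → ℝ)
    (z : ℝ≥0∞ × S) : ℝ :=
  open Classical in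
  if z.1 ≤ ENNReal.ofReal a then
    Real.exp (θ * ∫ u in (0 : ℝ)..z.1.toReal, G.meanRate π₁ π₂ k (h, u)) * w z.1.toReal z.2
  else Real.exp (θ * ∫ u in (0 : ℝ)..a, G.meanRate π₁ π₂ k (h, u)) * w a (lastState h)

omit [StandardBorelSpace S] in
theorem Model.continuous_primitive_meanRate (hG : G.IsBounded) (k : ℕ) (h : Hist S k) :
    Continuous fun s => ∫ u in (0 : ℝ)..s, G.meanRate π₁ π₂ k (h, u) :=
  continuous_primitive_of_abs_le ((G.measurable_meanRate π₁ π₂ k).comp measurable_prodMk_left)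
    fun s => G.abs_meanRate_le π₁ π₂ hG k (h, s)

omit [StandardBorelSpace S] in
theorem Model.measurable_stepValue (hG : G.IsBounded) (θ : ℝ) (k : ℕ) (h : Hist S k) (a : ℝ)
    {w : ℝ → S → ℝ} (hw : Measurable (Function.uncurry w)) :
    Measurable (G.stepValue π₁ π₂ θ k h a w) := by
  have h1 := (G.continuous_primitive_meanRate π₁ π₂ hG k h).measurable
  have h2 : Measurable fun z : ℝ≥0∞ × S => z.1.toReal := measurable_fst.ennreal_toReal
  refine Measurable.ite (measurableSet_le measurable_fst measurable_const) ?_ measurable_const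
  exact (Real.measurable_exp.comp ((h1.comp h2).const_mul θ)).mul
    (hw.comp (h2.prodMk measurable_snd))

omit [StandardBorelSpace S] in
theorem Model.abs_stepValue_le (hG : G.IsBounded) {θ : ℝ} (hθ : 0 ≤ θ) (k : ℕ) (h : Hist S k)
    {a : ℝ} (ha : 0 ≤ a) {w : ℝ → S → ℝ} {M : ℝ} (hM : ∀ s y, |w s y| ≤ M) (z : ℝ≥0∞ × S) :
    |G.stepValue π₁ π₂ θ k h a w z| ≤ Real.exp (θ * (G.rNorm * a)) * M := by
  have key : ∀ s, 0 ≤ s → s ≤ a → ∀ y,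
      |Real.exp (θ * ∫ u in (0 : ℝ)..s, G.meanRate π₁ π₂ k (h, u)) * w s y| ≤
        Real.exp (θ * (G.rNorm * a)) * M := by
    intro s hs hsa y
    rw [abs_mul, abs_of_pos (Real.exp_pos _)]
    refine mul_le_mul (Real.exp_le_exp.2 (mul_le_mul_of_nonneg_left ?_ hθ)) (hM s y) (abs_nonneg _)
      (Real.exp_pos _).le
    have h1 := abs_intervalIntegral_le (fun u => G.abs_meanRate_le π₁ π₂ hG k (h, u)) 0 s
    rw [sub_zero, abs_of_nonneg hs] at h1
    exact (le_abs_self _).trans (h1.trans (mul_le_mul_of_nonneg_left hsa G.rNorm_nonneg))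
  rw [Model.stepValue]
  split_ifs with hz
  · exact key _ ENNReal.toReal_nonneg (ENNReal.toReal_le_of_le_ofReal ha hz) _
  · exact key a ha le_rfl _

theorem Model.integral_stepValue (hG : G.IsBounded) {θ : ℝ} (hθ : 0 ≤ θ) (k : ℕ) (h : Hist S k)
    {a : ℝ} (ha : 0 ≤ a) {w : ℝ → S → ℝ} (hw : Measurable (Function.uncurry w)) {M : ℝ}
    (hM : ∀ s y, |w s y| ≤ M) {η : ℝ → ℝ} (hη : Measurable η) {c : ℝ} (hc : ∀ s, |η s| ≤ c)
    (hwη : ∀ s ∈ Icc 0 a, w s (lastState h) = w 0 (lastState h) - ∫ u in (0 : ℝ)..s, η u) :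
    ∫ z, G.stepValue π₁ π₂ θ k h a w z ∂(G.step π₁ π₂ k h) = w 0 (lastState h) +
      ∫ s in (0 : ℝ)..a,
        Real.exp (∫ u in (0 : ℝ)..s, (θ * G.meanRate π₁ π₂ k (h, u) - G.intensity π₁ π₂ k (h, u))) *
        (G.payoff θ w s (lastState h) (π₁.ker k (h, s)) (π₂.ker k (h, s)) - η s) := by
  set x := lastState h with hx
  set ρ : ℝ → ℝ := fun s => G.meanRate π₁ π₂ k (h, s) with hρ
  set Λ : ℝ → ℝ := fun s => G.intensity π₁ π₂ k (h, s) with hΛ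
  have hρm : Measurable ρ := (G.measurable_meanRate π₁ π₂ k).comp measurable_prodMk_left
  have hΛm : Measurable Λ := (G.measurable_intensity π₁ π₂ k).comp measurable_prodMk_left
  have hρb : ∀ s, |ρ s| ≤ G.rNorm := fun s => G.abs_meanRate_le π₁ π₂ hG k (h, s)
  have hΛb : ∀ s, |Λ s| ≤ G.qNorm := fun s => G.abs_intensity_le π₁ π₂ hG k (h, s)
  have hws : ∀ s, Measurable (w s) := fun s => hw.of_uncurry_left
  set κ : ℝ → ℝ := fun s => θ * ρ s - Λ s with hκ
  have hκm : Measurable κ := (hρm.const_mul θ).sub hΛm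
  have hκb : ∀ s, |κ s| ≤ θ * G.rNorm + G.qNorm := fun s => by
    refine (abs_sub _ _).trans (add_le_add ?_ (hΛb s))
    rw [abs_mul, abs_of_nonneg hθ]
    exact mul_le_mul_of_nonneg_left (hρb s) hθ
  set I : ℝ → ℝ := fun s => ∫ y, w s y ∂(G.jumpRate π₁ π₂ k (h, s)) with hI
  have hIm : Measurable I := by
    have h1 := (hw.comp (by fun_prop : Measurable fun q : ℝ × S => (q.1, q.2))).stronglyMeasurable
    exact (h1.integral_kernel_prod_right' (κ := (G.jumpRate π₁ π₂ k).comap (Prod.mk h)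
      measurable_prodMk_left)).measurable
  have hM0 : 0 ≤ M := (abs_nonneg _).trans (hM 0 x)
  have hIb : ∀ s, |I s| ≤ M * G.qNorm := fun s =>
    (norm_integral_le_of_norm_le_const (f := w s) (Eventually.of_forall (hM s))).trans
      (mul_le_mul_of_nonneg_left ((le_abs_self _).trans (hΛb s)) hM0)
  set U : ℝ → ℝ := fun s => w 0 x - ∫ u in (0 : ℝ)..s, η u with hU
  have hUc : Continuous U := continuous_const.sub (continuous_primitive_of_abs_le hη hc)
  set D : ℝ → ℝ := fun s => Real.exp (∫ u in (0 : ℝ)..s, κ u) with hD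
  have hDc : Continuous D := Real.continuous_exp.comp (continuous_primitive_of_abs_le hκm hκb)
  set e : ℝ → ℝ := fun s => Real.exp (θ * ∫ u in (0 : ℝ)..s, ρ u) with he
  set R : ℝ → ℝ := fun s => Real.exp (-∫ u in (0 : ℝ)..s, Λ u) with hR
  have hRc : Continuous R :=
    Real.continuous_exp.comp (continuous_primitive_of_abs_le hΛm hΛb).neg
  have heR : ∀ s, R s * e s = D s := by
    intro s
    simp only [hR, he, hD, hκ]
    rw [← Real.exp_add, intervalIntegral.integral_sub
      ((intervalIntegrable_of_abs_le hρm hρb 0 s).const_mul θ)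
      (intervalIntegrable_of_abs_le hΛm hΛb 0 s), intervalIntegral.integral_const_mul]
    congr 1
    ring
  set E : ℝ := e a * w a x with hE
  have hFm := G.measurable_stepValue π₁ π₂ hG θ k h a hw
  have hFb := G.abs_stepValue_le π₁ π₂ hG hθ k h ha hM
  have hFtop : G.stepValue π₁ π₂ θ k h a w (∞, x) = E := by
    rw [Model.stepValue, if_neg (by simp)]
  have h1 : ∫ z, G.stepValue π₁ π₂ θ k h a w z ∂(G.step π₁ π₂ k h) =
      ∫ z, (G.stepValue π₁ π₂ θ k h a w z - E) ∂(G.step π₁ π₂ k h) + E := by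
    rw [integral_sub (integrable_of_abs_le hFm hFb) (integrable_const _)]
    simp
  have h2 := G.integral_step π₁ π₂ k h (f := fun z => G.stepValue π₁ π₂ θ k h a w z - E)
    (hFm.sub_const _) (M := Real.exp (θ * (G.rNorm * a)) * M + |E|)
    (fun z => (abs_sub _ _).trans (by gcongr; exact hFb z)) (by rw [← hx, hFtop, sub_self])
  have h3 : ∫ s in Ioi (0 : ℝ), (G.survival π₁ π₂ k h s).toReal *
      ∫ y, (G.stepValue π₁ π₂ θ k h a w (ENNReal.ofReal s, y) - E) ∂(G.jumpRate π₁ π₂ k (h, s)) =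
      ∫ s in Ioc 0 a, (D s * I s - E * (R s * Λ s)) := by
    rw [← integral_indicator measurableSet_Ioi, ← integral_indicator measurableSet_Ioc]
    refine integral_congr_ae (Eventually.of_forall fun s => ?_)
    by_cases hs : 0 < s
    · rw [indicator_of_mem (show s ∈ Ioi (0 : ℝ) from hs)]
      by_cases hsa : s ≤ a
      · rw [indicator_of_mem (show s ∈ Ioc 0 a from ⟨hs, hsa⟩), G.survival_toReal π₁ π₂ k h hs.le]
        have h4 : ∀ y, G.stepValue π₁ π₂ θ k h a w (ENNReal.ofReal s, y) = e s * w s y := by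
          intro y
          rw [Model.stepValue, if_pos (ENNReal.ofReal_le_ofReal hsa)]
          simp only [ENNReal.toReal_ofReal hs.le]
          rfl
        simp only [h4]
        rw [integral_sub ((integrable_of_abs_le (hws s) (hM s)).const_mul _) (integrable_const _),
          integral_const_mul, integral_const, smul_eq_mul]
        change R s * (e s * I s - Λ s * E) = _
        rw [← heR s]
        ring
      · rw [indicator_of_notMem (show s ∉ Ioc 0 a from fun h => hsa h.2)]
        have h4 : ∀ y, G.stepValue π₁ π₂ θ k h a w (ENNReal.ofReal s, y) = E := by
          intro y
          rw [Model.stepValue, if_neg]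
          rw [not_le]
          exact (ENNReal.ofReal_lt_ofReal_iff hs).2 (not_le.1 hsa)
        simp [h4]
    · rw [indicator_of_notMem (show s ∉ Ioi (0 : ℝ) from hs),
        indicator_of_notMem (show s ∉ Ioc 0 a from fun h => hs h.1)]
  rw [h1, h2, h3, ← intervalIntegral.integral_of_le ha]
  have hDη := exp_primitive_mul_sub hκm hη hκb hc (w 0 x) a
  have hRΛ := exp_primitive_mul_sub hΛm.neg (measurable_const (a := (0 : ℝ)))
    (fun s => by simpa using hΛb s) (c' := 0) (by simp) 1 a
  simp only [intervalIntegral.integral_zero, sub_zero, mul_one,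
    intervalIntegral.integral_neg, Pi.neg_apply, mul_neg] at hRΛ
  change R a - 1 = -∫ s in (0 : ℝ)..a, R s * Λ s at hRΛ
  change D a * U a - w 0 x = ∫ s in (0 : ℝ)..a, D s * (κ s * U s - η s) at hDη
  have hp : ∀ s ∈ Icc 0 a, G.payoff θ w s x (π₁.ker k (h, s)) (π₂.ker k (h, s)) =
      κ s * U s + I s := by
    intro s hs
    have := G.payoff_policy π₁ π₂ hG (θ := θ) k (h, s) (v := w) (t := s) (hws s) (hM s)
    rw [this]
    change κ s * w s x + I s = _
    rw [hwη s hs]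
  have h5 : ∫ s in (0 : ℝ)..a, D s *
      (G.payoff θ w s x (π₁.ker k (h, s)) (π₂.ker k (h, s)) - η s) =
      ∫ s in (0 : ℝ)..a, (D s * I s + D s * (κ s * U s - η s)) := by
    refine intervalIntegral.integral_congr fun s hs => ?_
    rw [uIcc_of_le ha] at hs
    rw [hp s hs]
    ring
  have hiI : IntervalIntegrable (fun s => D s * I s) volume 0 a :=
    (intervalIntegrable_of_abs_le hIm hIb 0 a).continuousOn_mul hDc.continuousOn
  have hiR : IntervalIntegrable (fun s => R s * Λ s) volume 0 a :=
    (intervalIntegrable_of_abs_le hΛm hΛb 0 a).continuousOn_mul hRc.continuousOn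
  have hiU : IntervalIntegrable (fun s => D s * (κ s * U s - η s)) volume 0 a :=
    (((intervalIntegrable_of_abs_le hκm hκb 0 a).mul_continuousOn hUc.continuousOn).sub
      (intervalIntegrable_of_abs_le hη hc 0 a)).continuousOn_mul hDc.continuousOn
  rw [intervalIntegral.integral_sub hiI (hiR.const_mul E), intervalIntegral.integral_const_mul]
  change _ = w 0 x + ∫ s in (0 : ℝ)..a, D s *
      (G.payoff θ w s x (π₁.ker k (h, s)) (π₂.ker k (h, s)) - η s)
  rw [h5, intervalIntegral.integral_add hiI hiU, ← hDη]
  have h6 : E * R a = D a * U a := by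
    rw [← heR a, hE, hwη a (right_mem_Icc.2 ha)]
    ring
  linear_combination h6 - E * hRΛ

end OneStep

theorem measurable_primitive {X : Type*} [MeasurableSpace X] {f : X × ℝ → ℝ} (hf : Measurable f) :
    Measurable fun p : X × ℝ => ∫ u in (0 : ℝ)..p.2, f (p.1, u) := by
  have key : ∀ {s : Set ((X × ℝ) × ℝ)}, MeasurableSet s →
      Measurable fun p : X × ℝ => ∫ u, s.indicator (fun q => f (q.1.1, q.2)) (p, u) := by
    intro s hs
    have h1 : Measurable (s.indicator fun q : (X × ℝ) × ℝ => f (q.1.1, q.2)) :=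
      (hf.comp (by fun_prop)).indicator hs
    exact h1.stronglyMeasurable.integral_prod_right'.measurable
  have h1 := key (s := {q | 0 < q.2 ∧ q.2 ≤ q.1.2})
    ((measurableSet_lt measurable_const measurable_snd).inter
      (measurableSet_le measurable_snd (measurable_snd.comp measurable_fst)))
  have h2 := key (s := {q | q.1.2 < q.2 ∧ q.2 ≤ 0})
    ((measurableSet_lt (measurable_snd.comp measurable_fst) measurable_snd).inter
      (measurableSet_le measurable_snd measurable_const))
  refine (congrArg Measurable (funext fun p => ?_)).mp (h1.sub h2)
  rw [Pi.sub_apply, intervalIntegral, ← integral_indicator measurableSet_Ioc,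
    ← integral_indicator measurableSet_Ioc]
  rfl

section History

variable {S : Type*} [MeasurableSpace S]

/-- The history of a path up to the `k`-th jump. -/
def hist (ω : Path S) (k : ℕ) : Hist S k := fun i => ω i

/-- The history up to the previous jump. -/
def trunc {k : ℕ} (h : Hist S (k + 1)) : Hist S k :=
  fun i => h ⟨i.1, Finset.mem_Iic.2 ((Finset.mem_Iic.1 i.2).trans k.le_succ)⟩

/-- The last sojourn time and the last state of a history. -/
def lastJump {k : ℕ} (h : Hist S k) : ℝ≥0∞ × S := h ⟨k, Finset.mem_Iic.2 le_rfl⟩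

/-- The time of the last jump, with values in `[0,∞]`. -/
noncomputable def etime {k : ℕ} (h : Hist S k) : ℝ≥0∞ := ∑ i, (h i).1

theorem measurable_hist (k : ℕ) : Measurable fun ω : Path S => hist ω k :=
  measurable_pi_lambda _ fun _ => measurable_pi_apply _

theorem measurable_trunc (k : ℕ) : Measurable (trunc (S := S) (k := k)) :=
  measurable_pi_lambda _ fun _ => measurable_pi_apply _

theorem measurable_lastJump (k : ℕ) : Measurable (lastJump (S := S) (k := k)) :=
  measurable_pi_apply _

theorem measurable_etime (k : ℕ) : Measurable (etime (S := S) (k := k)) :=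
  Finset.measurable_sum _ fun i _ => measurable_fst.comp (measurable_pi_apply i)

omit [MeasurableSpace S] in
theorem etime_hist (ω : Path S) (k : ℕ) : etime (hist ω k) = ∑ i ∈ Finset.range (k + 1), (ω i).1 := by
  rw [etime]
  have h : Finset.range (k + 1) = Finset.Iic k := by ext; simp
  rw [h]
  exact Finset.sum_coe_sort (Finset.Iic k) fun i => (ω i).1

omit [MeasurableSpace S] in
theorem etime_hist_succ (ω : Path S) (k : ℕ) :
    etime (hist ω (k + 1)) = etime (hist ω k) + (ω (k + 1)).1 := by
  rw [etime_hist, etime_hist, Finset.sum_range_succ]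

omit [MeasurableSpace S] in
theorem etime_eq_trunc_add {k : ℕ} (h : Hist S (k + 1)) :
    etime h = etime (trunc h) + (lastJump h).1 := by
  have h1 := etime_hist_succ
    (fun i => if hi : i ≤ k + 1 then h ⟨i, Finset.mem_Iic.2 hi⟩ else lastJump h) k
  have h2 : hist (fun i => if hi : i ≤ k + 1 then h ⟨i, Finset.mem_Iic.2 hi⟩ else lastJump h)
      (k + 1) = h := by
    funext i
    exact dif_pos (Finset.mem_Iic.1 i.2)
  have h3 : hist (fun i => if hi : i ≤ k + 1 then h ⟨i, Finset.mem_Iic.2 hi⟩ else lastJump h)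
      k = trunc h := by
    funext i
    exact dif_pos ((Finset.mem_Iic.1 i.2).trans k.le_succ)
  rw [h2, h3] at h1
  rw [h1]
  simp [lastJump]

omit [MeasurableSpace S] in
theorem etime_hist_eq_jumpTime {ω : Path S} (h0 : (ω 0).1 = 0) (k : ℕ) :
    etime (hist ω k) = jumpTime ω k := by
  rw [etime_hist, Finset.sum_range_succ', h0, add_zero, jumpTime]

omit [MeasurableSpace S] in
theorem histTime_nonneg {k : ℕ} (h : Hist S k) : 0 ≤ histTime h := ENNReal.toReal_nonneg

variable {A B : Type*} [MeasurableSpace A] [MeasurableSpace B]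
  (G : Model S A B) (π₁ : Policy G.actA) (π₂ : Policy G.actB)

/-- The payoff accumulated up to the last jump. -/
noncomputable def Model.logWeight : (k : ℕ) → Hist S k → ℝ
  | 0, _ => 0
  | k + 1, h => Model.logWeight k (trunc h) +
      ∫ u in (0 : ℝ)..(lastJump h).1.toReal, G.meanRate π₁ π₂ k (trunc h, u)

theorem Model.measurable_primitive_meanRate (k : ℕ) : Measurable fun p : Hist S k × ℝ =>
    ∫ u in (0 : ℝ)..p.2, G.meanRate π₁ π₂ k (p.1, u) :=
  measurable_primitive (G.measurable_meanRate π₁ π₂ k)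

theorem Model.measurable_logWeight (k : ℕ) : Measurable (G.logWeight π₁ π₂ k) := by
  induction k with
  | zero => exact measurable_const
  | succ k ih =>
    exact (ih.comp (measurable_trunc k)).add ((G.measurable_primitive_meanRate π₁ π₂ k).comp
      ((measurable_trunc k).prodMk (measurable_lastJump (k + 1)).fst.ennreal_toReal))

theorem Model.abs_primitive_meanRate_le (hG : G.IsBounded) (k : ℕ) (h : Hist S k) {s : ℝ}
    (hs : 0 ≤ s) : |∫ u in (0 : ℝ)..s, G.meanRate π₁ π₂ k (h, u)| ≤ G.rNorm * s := by
  have h1 := abs_intervalIntegral_le (fun u => G.abs_meanRate_le π₁ π₂ hG k (h, u)) 0 s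
  rwa [sub_zero, abs_of_nonneg hs] at h1

theorem Model.abs_logWeight_le (hG : G.IsBounded) (k : ℕ) (h : Hist S k) (hh : etime h ≠ ∞) :
    |G.logWeight π₁ π₂ k h| ≤ G.rNorm * (etime h).toReal := by
  induction k with
  | zero => simpa [Model.logWeight] using mul_nonneg G.rNorm_nonneg ENNReal.toReal_nonneg
  | succ k ih =>
    rw [etime_eq_trunc_add] at hh ⊢
    obtain ⟨h1, h2⟩ := ENNReal.add_ne_top.1 hh
    rw [ENNReal.toReal_add h1 h2, mul_add]
    exact (abs_add_le _ _).trans (add_le_add (ih _ h1)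
      (G.abs_primitive_meanRate_le π₁ π₂ hG k _ ENNReal.toReal_nonneg))

end History

section Law

variable {S A B : Type*} [MeasurableSpace S] [StandardBorelSpace S] [MeasurableSpace A]
  [MeasurableSpace B] (G : Model S A B) (π₁ : Policy G.actA) (π₂ : Policy G.actB)

instance Model.isProbabilityMeasure_law (x : S) : IsProbabilityMeasure (G.law π₁ π₂ x) := by
  rw [Model.law]
  infer_instance

theorem Model.law_map_hist_zero (x : S) :
    (G.law π₁ π₂ x).map (fun ω => hist ω 0) = Measure.dirac fun _ => (0, x) := by
  have h := Kernel.traj_map_frestrictLe_apply (X := fun _ => ℝ≥0∞ × S) (κ := G.step π₁ π₂) 0 0 (fun _ => ((0 : ℝ≥0∞), x))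
  rw [Kernel.partialTraj_self, Kernel.id_apply] at h
  exact h

theorem Model.ae_law_hist_zero (x : S) :
    ∀ᵐ ω ∂(G.law π₁ π₂ x), hist ω 0 = fun _ => (0, x) := by
  have h : ∀ᵐ h ∂((G.law π₁ π₂ x).map (fun ω => hist ω 0)), h = fun _ => (0, x) := by
    rw [G.law_map_hist_zero π₁ π₂ x]
    exact ae_dirac_iff (measurableSet_singleton _) |>.2 rfl
  exact ae_of_ae_map (measurable_hist 0).aemeasurable h

/-- Conditioning on the history up to the `k`-th jump. -/
theorem Model.integral_law_succ (x : S) (k : ℕ) {F : Hist S k × (ℝ≥0∞ × S) → ℝ}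
    (hF : Measurable F) {C : ℝ} (hC : ∀ p, |F p| ≤ C) :
    ∫ ω, F (hist ω k, ω (k + 1)) ∂(G.law π₁ π₂ x) =
      ∫ ω, ∫ z, F (hist ω k, z) ∂(G.step π₁ π₂ k (hist ω k)) ∂(G.law π₁ π₂ x) := by
  have h1 := Kernel.partialTraj_compProd_eq_map_traj (X := fun _ => ℝ≥0∞ × S)
    (κ := G.step π₁ π₂) (Nat.zero_le k)
    (x₀ := fun _ => ((0 : ℝ≥0∞), x))
  have h2 := Kernel.traj_map_frestrictLe_apply (X := fun _ => ℝ≥0∞ × S) (κ := G.step π₁ π₂) 0 k (fun _ => ((0 : ℝ≥0∞), x))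
  have hm : Measurable fun ω : Path S => (hist ω k, ω (k + 1)) :=
    (measurable_hist k).prodMk (measurable_pi_apply _)
  have h3 : ∫ p, F p ∂((G.law π₁ π₂ x).map fun ω => (hist ω k, ω (k + 1))) =
      ∫ ω, F (hist ω k, ω (k + 1)) ∂(G.law π₁ π₂ x) :=
    integral_map hm.aemeasurable hF.aestronglyMeasurable
  have h4 : (G.law π₁ π₂ x).map (fun ω => (hist ω k, ω (k + 1))) =
      ((G.law π₁ π₂ x).map fun ω => hist ω k) ⊗ₘ G.step π₁ π₂ k := by
    rw [Model.law]
    exact h1.symm.trans (congrArg (fun μ => μ ⊗ₘ G.step π₁ π₂ k) h2.symm)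
  have : IsProbabilityMeasure ((G.law π₁ π₂ x).map fun ω => hist ω k) :=
    Measure.isProbabilityMeasure_map (measurable_hist k).aemeasurable
  rw [← h3, h4, Measure.integral_compProd (integrable_of_abs_le hF hC)]
  exact integral_map (measurable_hist k).aemeasurable
    hF.stronglyMeasurable.integral_kernel_prod_right'.aestronglyMeasurable

end Law

section Verification

variable {S A B : Type*} [MeasurableSpace S] [MeasurableSpace A] [MeasurableSpace B]
  (G : Model S A B) (π₁ : Policy G.actA) (π₂ : Policy G.actB) (θ H : ℝ)

open Classical in
/-- The discounted continuation value at the `k`-th jump, if this happens before the horizon. -/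
noncomputable def Model.atJump (u : ℝ → S → ℝ) (k : ℕ) (h : Hist S k) : ℝ :=
  if etime h ≤ ENNReal.ofReal H then
    Real.exp (θ * G.logWeight π₁ π₂ k h) * u (histTime h) (lastState h) else 0

open Classical in
/-- The exponential payoff, if the horizon is reached between the `k`-th and the next jump. -/
noncomputable def Model.atHorizon (k : ℕ) (p : Hist S k × (ℝ≥0∞ × S)) : ℝ :=
  if etime p.1 ≤ ENNReal.ofReal H ∧ ENNReal.ofReal H < etime p.1 + p.2.1 then
    Real.exp (θ * (G.logWeight π₁ π₂ k p.1 +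
      ∫ s in (0 : ℝ)..(H - histTime p.1), G.meanRate π₁ π₂ k (p.1, s)) + θ * G.g (lastState p.1))
  else 0

open Classical in
/-- The discounted value after the next jump or at the horizon. -/
noncomputable def Model.afterJump (u : ℝ → S → ℝ) (k : ℕ) (p : Hist S k × (ℝ≥0∞ × S)) : ℝ :=
  if etime p.1 ≤ ENNReal.ofReal H then
    Real.exp (θ * G.logWeight π₁ π₂ k p.1) *
      G.stepValue π₁ π₂ θ k p.1 (H - histTime p.1) (fun s => u (histTime p.1 + s)) p.2
  else 0

variable {θ H}

omit [MeasurableSpace S] in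
theorem histTime_le_of_etime_le {k : ℕ} {h : Hist S k} (hH : 0 ≤ H)
    (hh : etime h ≤ ENNReal.ofReal H) : histTime h ≤ H :=
  ENNReal.toReal_le_of_le_ofReal hH hh

theorem Model.afterJump_hist {u : ℝ → S → ℝ} (hH : 0 ≤ H)
    (hu : ∀ x, u H x = Real.exp (θ * G.g x)) (k : ℕ) (ω : Path S) :
    G.afterJump π₁ π₂ θ H u k (hist ω k, ω (k + 1)) =
      G.atJump π₁ π₂ θ H u (k + 1) (hist ω (k + 1)) +
        G.atHorizon π₁ π₂ θ H k (hist ω k, ω (k + 1)) := by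
  have htr : trunc (hist ω (k + 1)) = hist ω k := rfl
  have hlj : lastJump (hist ω (k + 1)) = ω (k + 1) := rfl
  have hls : lastState (hist ω (k + 1)) = (ω (k + 1)).2 := rfl
  by_cases h1 : etime (hist ω k) ≤ ENNReal.ofReal H
  · have hτ := histTime_le_of_etime_le hH h1
    have hfin : etime (hist ω k) ≠ ∞ := (h1.trans_lt ENNReal.ofReal_lt_top).ne
    have hiff : (ω (k + 1)).1 ≤ ENNReal.ofReal (H - histTime (hist ω k)) ↔
        etime (hist ω (k + 1)) ≤ ENNReal.ofReal H := by
      rw [etime_hist_succ, ENNReal.ofReal_sub _ (histTime_nonneg _)]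
      have h2 : ENNReal.ofReal (histTime (hist ω k)) = etime (hist ω k) :=
        ENNReal.ofReal_toReal hfin
      rw [h2, ENNReal.le_sub_iff_add_le_left hfin h1]
    by_cases h2 : etime (hist ω (k + 1)) ≤ ENNReal.ofReal H
    · have h3 : (ω (k + 1)).1 ≠ ∞ := by
        have := (h2.trans_lt ENNReal.ofReal_lt_top).ne
        rw [etime_hist_succ] at this
        exact (ENNReal.add_ne_top.1 this).2
      have h4 : histTime (hist ω (k + 1)) = histTime (hist ω k) + (ω (k + 1)).1.toReal := by
        change (etime (hist ω (k + 1))).toReal = (etime (hist ω k)).toReal + _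
        rw [etime_hist_succ, ENNReal.toReal_add hfin h3]
      rw [Model.afterJump, Model.atJump, Model.atHorizon, if_pos h1, if_pos h2, if_neg, add_zero,
        Model.stepValue, if_pos (hiff.2 h2), Model.logWeight, htr, hlj, h4, hls, mul_add,
        Real.exp_add, mul_assoc]
      rintro ⟨-, h5⟩
      rw [← etime_hist_succ] at h5
      exact absurd h2 (not_le.2 h5)
    · rw [Model.afterJump, Model.atJump, Model.atHorizon, if_pos h1, if_neg h2, if_pos, zero_add,
        Model.stepValue, if_neg (mt hiff.1 h2)]
      · dsimp only
        rw [add_sub_cancel, hu, ← Real.exp_add, ← Real.exp_add]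
        congr 1
        ring
      · refine ⟨h1, ?_⟩
        rw [← etime_hist_succ]
        exact not_le.1 h2
  · have h2 : ¬ etime (hist ω (k + 1)) ≤ ENNReal.ofReal H := fun h => h1 (by
      rw [etime_hist_succ] at h
      exact le_self_add.trans h)
    rw [Model.afterJump, Model.atJump, Model.atHorizon, if_neg h1, if_neg h2, if_neg fun h => h1 h.1,
      add_zero]

theorem Model.measurable_atJump {u : ℝ → S → ℝ} (hu : Measurable (Function.uncurry u)) (k : ℕ) :
    Measurable (G.atJump π₁ π₂ θ H u k) :=
  Measurable.ite (measurableSet_le (measurable_etime k) measurable_const)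
    ((Real.measurable_exp.comp ((G.measurable_logWeight π₁ π₂ k).const_mul θ)).mul
      (hu.comp (measurable_histTime.prodMk measurable_lastState))) measurable_const

theorem Model.measurable_atHorizon (k : ℕ) : Measurable (G.atHorizon π₁ π₂ θ H k) := by
  refine Measurable.ite ((measurableSet_le ((measurable_etime k).comp measurable_fst)
    measurable_const).inter (measurableSet_lt measurable_const
      (((measurable_etime k).comp measurable_fst).add measurable_snd.fst))) ?_ measurable_const
  refine Real.measurable_exp.comp (((Measurable.add ?_ ?_).const_mul θ).add
    ((G.measurable_g.comp (measurable_lastState.comp measurable_fst)).const_mul θ))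
  · exact (G.measurable_logWeight π₁ π₂ k).comp measurable_fst
  · exact (G.measurable_primitive_meanRate π₁ π₂ k).comp
      (measurable_fst.prodMk ((measurable_histTime.comp measurable_fst).const_sub H))

theorem Model.measurable_afterJump {u : ℝ → S → ℝ} (hu : Measurable (Function.uncurry u)) (k : ℕ) :
    Measurable (G.afterJump π₁ π₂ θ H u k) := by
  have hτ : Measurable fun p : Hist S k × (ℝ≥0∞ × S) => histTime p.1 :=
    measurable_histTime.comp measurable_fst
  have hx : Measurable fun p : Hist S k × (ℝ≥0∞ × S) => lastState p.1 :=
    measurable_lastState.comp measurable_fst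
  have hδ : Measurable fun p : Hist S k × (ℝ≥0∞ × S) => p.2.1.toReal :=
    measurable_snd.fst.ennreal_toReal
  have hP := G.measurable_primitive_meanRate π₁ π₂ k
  refine Measurable.ite (measurableSet_le ((measurable_etime k).comp measurable_fst)
    measurable_const) (Measurable.mul ?_ (Measurable.ite (measurableSet_le measurable_snd.fst
      (hτ.const_sub H).ennreal_ofReal) ?_ ?_)) measurable_const
  · exact Real.measurable_exp.comp (((G.measurable_logWeight π₁ π₂ k).comp
      measurable_fst).const_mul θ)
  · exact (Real.measurable_exp.comp ((hP.comp (measurable_fst.prodMk hδ)).const_mul θ)).mul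
      (hu.comp ((hτ.add hδ).prodMk measurable_snd.snd))
  · exact (Real.measurable_exp.comp ((hP.comp (measurable_fst.prodMk
      (hτ.const_sub H))).const_mul θ)).mul (hu.comp ((hτ.add (hτ.const_sub H)).prodMk hx))

theorem Model.exp_logWeight_le (hG : G.IsBounded) (hθ : 0 ≤ θ) (k : ℕ) (h : Hist S k)
    (hh : etime h ≤ ENNReal.ofReal H) :
    Real.exp (θ * G.logWeight π₁ π₂ k h) ≤ Real.exp (θ * (G.rNorm * histTime h)) :=
  Real.exp_le_exp.2 (mul_le_mul_of_nonneg_left ((le_abs_self _).trans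
    (G.abs_logWeight_le π₁ π₂ hG k h (hh.trans_lt ENNReal.ofReal_lt_top).ne)) hθ)

theorem Model.abs_atJump_le (hG : G.IsBounded) (hθ : 0 ≤ θ) (hH : 0 ≤ H) {u : ℝ → S → ℝ} {M : ℝ}
    (hM : ∀ t y, |u t y| ≤ M) (k : ℕ) (h : Hist S k) :
    |G.atJump π₁ π₂ θ H u k h| ≤ Real.exp (θ * (G.rNorm * H)) * M *
      {h : Hist S k | etime h ≤ ENNReal.ofReal H}.indicator 1 h := by
  rw [Model.atJump]
  split_ifs with hh
  · rw [indicator_of_mem (by exact hh), Pi.one_apply, mul_one, abs_mul, abs_of_pos (Real.exp_pos _)]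
    refine mul_le_mul ((G.exp_logWeight_le π₁ π₂ hG hθ k h hh).trans (Real.exp_le_exp.2 ?_))
      (hM _ _) (abs_nonneg _) (Real.exp_pos _).le
    exact mul_le_mul_of_nonneg_left (mul_le_mul_of_nonneg_left (histTime_le_of_etime_le hH hh)
      G.rNorm_nonneg) hθ
  · rw [indicator_of_notMem (by exact hh)]
    simp

theorem Model.abs_afterJump_le (hG : G.IsBounded) (hθ : 0 ≤ θ) (hH : 0 ≤ H) {u : ℝ → S → ℝ} {M : ℝ}
    (hM : ∀ t y, |u t y| ≤ M) (k : ℕ) (p : Hist S k × (ℝ≥0∞ × S)) :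
    |G.afterJump π₁ π₂ θ H u k p| ≤ Real.exp (θ * (G.rNorm * H)) * M := by
  have hM0 : 0 ≤ M := (abs_nonneg _).trans (hM 0 (lastState p.1))
  rw [Model.afterJump]
  split_ifs with hh
  · have hτ := histTime_le_of_etime_le hH hh
    rw [abs_mul, abs_of_pos (Real.exp_pos _)]
    refine (mul_le_mul (G.exp_logWeight_le π₁ π₂ hG hθ k p.1 hh)
      (G.abs_stepValue_le π₁ π₂ hG hθ k p.1 (sub_nonneg.2 hτ) (fun s y => hM _ y) p.2)
      (abs_nonneg _) (Real.exp_pos _).le).trans_eq ?_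
    rw [← mul_assoc, ← Real.exp_add]
    congr 2
    ring
  · rw [abs_zero]
    positivity

theorem Model.atHorizon_nonneg (k : ℕ) (p : Hist S k × (ℝ≥0∞ × S)) :
    0 ≤ G.atHorizon π₁ π₂ θ H k p := by
  rw [Model.atHorizon]
  split_ifs
  · exact (Real.exp_pos _).le
  · exact le_rfl

theorem Model.atHorizon_le (hG : G.IsBounded) (hθ : 0 ≤ θ) (hH : 0 ≤ H) {M : ℝ}
    (hM : ∀ y, Real.exp (θ * G.g y) ≤ M) (k : ℕ) (p : Hist S k × (ℝ≥0∞ × S)) :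
    G.atHorizon π₁ π₂ θ H k p ≤ Real.exp (θ * (G.rNorm * H)) * M := by
  have hM0 : 0 ≤ M := (Real.exp_pos _).le.trans (hM (lastState p.1))
  rw [Model.atHorizon]
  split_ifs with hh
  · have hτ := histTime_le_of_etime_le hH hh.1
    rw [Real.exp_add]
    refine mul_le_mul (Real.exp_le_exp.2 (mul_le_mul_of_nonneg_left ?_ hθ)) (hM _)
      (Real.exp_pos _).le (Real.exp_pos _).le
    have h1 := (le_abs_self _).trans
      (G.abs_logWeight_le π₁ π₂ hG k p.1 (hh.1.trans_lt ENNReal.ofReal_lt_top).ne)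
    have h2 := (le_abs_self _).trans
      (G.abs_primitive_meanRate_le π₁ π₂ hG k p.1 (sub_nonneg.2 hτ))
    have h3 : (etime p.1).toReal = histTime p.1 := rfl
    rw [h3] at h1
    linarith
  · positivity

variable [StandardBorelSpace S]

theorem Model.integral_afterJump_le (hG : G.IsBounded) (hθ : 0 ≤ θ) (hH : 0 ≤ H)
    {u : ℝ → S → ℝ} (hu : Measurable (Function.uncurry u)) {M : ℝ} (hM : ∀ t y, |u t y| ≤ M)
    {η : ℝ → S → ℝ} (hη : ∀ x, Measurable fun s => η s x) {c : ℝ} (hc : ∀ s x, |η s x| ≤ c)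
    (huη : ∀ t ∈ Icc 0 H, ∀ x, u t x = Real.exp (θ * G.g x) + ∫ s in t..H, η s x)
    {σ : ℝ} (k : ℕ) (h : Hist S k)
    (hσ : ∀ s, 0 ≤ s → histTime h + s ≤ H → 0 ≤ σ * (η (histTime h + s) (lastState h) -
      G.payoff θ u (histTime h + s) (lastState h) (π₁.ker k (h, s)) (π₂.ker k (h, s)))) :
    0 ≤ σ * (G.atJump π₁ π₂ θ H u k h -
      ∫ z, G.afterJump π₁ π₂ θ H u k (h, z) ∂(G.step π₁ π₂ k h)) := by
  by_cases hh : etime h ≤ ENNReal.ofReal H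
  · have hτ := histTime_le_of_etime_le hH hh
    have hτ0 := histTime_nonneg h
    set τ := histTime h with hτdef
    set x := lastState h with hx
    have hηi := fun a b => intervalIntegrable_of_abs_le (hη x) (fun s => hc s x) a b
    have h1 := G.integral_stepValue π₁ π₂ hG hθ k h (sub_nonneg.2 hτ) (w := fun s => u (τ + s))
      (hu.comp ((measurable_fst.const_add τ).prodMk measurable_snd)) (fun s y => hM _ y)
      (η := fun s => η (τ + s) x) ((hη x).comp (measurable_const_add τ)) (fun s => hc _ x) (by
        intro s hs
        rw [← hx, huη (τ + s) ⟨by linarith [hs.1], by linarith [hs.2]⟩, huη (τ + 0)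
          ⟨by linarith, by linarith⟩, intervalIntegral.integral_comp_add_left (fun s => η s x),
          ← intervalIntegral.integral_add_adjacent_intervals (hηi (τ + 0) (τ + s)) (hηi (τ + s) H)]
        ring)
    have h2 : ∀ z, G.afterJump π₁ π₂ θ H u k (h, z) = Real.exp (θ * G.logWeight π₁ π₂ k h) *
        G.stepValue π₁ π₂ θ k h (H - τ) (fun s => u (τ + s)) z := fun z => if_pos hh
    simp only [h2]
    rw [integral_const_mul, h1, Model.atJump, if_pos hh, add_zero]
    rw [← hx, ← hτdef, mul_add, sub_add_cancel_left, mul_neg, ← mul_neg, ← mul_neg,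
      mul_left_comm, ← intervalIntegral.integral_neg, ← intervalIntegral.integral_const_mul]
    refine mul_nonneg (Real.exp_pos _).le (intervalIntegral.integral_nonneg (sub_nonneg.2 hτ) ?_)
    intro s hs
    have h3 := hσ s hs.1 (by linarith [hs.2])
    have h4 : G.payoff θ (fun s => u (τ + s)) s x (π₁.ker k (h, s)) (π₂.ker k (h, s)) =
      G.payoff θ u (τ + s) x (π₁.ker k (h, s)) (π₂.ker k (h, s)) := rfl
    rw [h4, ← mul_neg, neg_sub, mul_left_comm]
    exact mul_nonneg (Real.exp_pos _).le h3
  · have h2 : ∀ z, G.afterJump π₁ π₂ θ H u k (h, z) = 0 := fun z => if_neg hh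
    simp [h2, Model.atJump, if_neg hh]

theorem Model.integral_atJump_succ_le (hG : G.IsBounded) (hθ : 0 ≤ θ) (hH : 0 ≤ H)
    {u : ℝ → S → ℝ} (hu : Measurable (Function.uncurry u)) {M : ℝ} (hM : ∀ t y, |u t y| ≤ M)
    {η : ℝ → S → ℝ} (hη : ∀ x, Measurable fun s => η s x) {c : ℝ} (hc : ∀ s x, |η s x| ≤ c)
    (huη : ∀ t ∈ Icc 0 H, ∀ x, u t x = Real.exp (θ * G.g x) + ∫ s in t..H, η s x)
    {σ : ℝ} (hσ : ∀ k (h : Hist S k) s, 0 ≤ s → histTime h + s ≤ H →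
      0 ≤ σ * (η (histTime h + s) (lastState h) -
      G.payoff θ u (histTime h + s) (lastState h) (π₁.ker k (h, s)) (π₂.ker k (h, s))))
    (x : S) (k : ℕ) :
    0 ≤ σ * (∫ ω, G.atJump π₁ π₂ θ H u k (hist ω k) ∂(G.law π₁ π₂ x) -
      ∫ ω, G.atJump π₁ π₂ θ H u (k + 1) (hist ω (k + 1)) ∂(G.law π₁ π₂ x) -
      ∫ ω, G.atHorizon π₁ π₂ θ H k (hist ω k, ω (k + 1)) ∂(G.law π₁ π₂ x)) := by
  have hm : Measurable fun ω : Path S => (hist ω k, ω (k + 1)) :=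
    (measurable_hist k).prodMk (measurable_pi_apply _)
  have huH : ∀ x, u H x = Real.exp (θ * G.g x) := fun x => by
    rw [huη H (right_mem_Icc.2 hH), intervalIntegral.integral_same, add_zero]
  have hgM : ∀ y, Real.exp (θ * G.g y) ≤ M := fun y => by
    rw [← huH]
    exact (le_abs_self _).trans (hM _ _)
  have hM0 : 0 ≤ M := (abs_nonneg _).trans (hM 0 x)
  have hVi : ∀ k, Integrable (fun ω => G.atJump π₁ π₂ θ H u k (hist ω k)) (G.law π₁ π₂ x) :=
    fun k => integrable_of_abs_le ((G.measurable_atJump π₁ π₂ hu k).comp (measurable_hist k))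
      (M := Real.exp (θ * (G.rNorm * H)) * M) fun ω =>
        (G.abs_atJump_le π₁ π₂ hG hθ hH hM k _).trans (mul_le_of_le_one_right (by positivity)
          (indicator_le_self' (fun _ _ => zero_le_one) _))
  have hXi : Integrable (fun ω => G.atHorizon π₁ π₂ θ H k (hist ω k, ω (k + 1))) (G.law π₁ π₂ x) :=
    integrable_of_abs_le ((G.measurable_atHorizon π₁ π₂ k).comp hm) fun ω => by
      rw [abs_of_nonneg (G.atHorizon_nonneg π₁ π₂ k _)]
      exact G.atHorizon_le π₁ π₂ hG hθ hH hgM k _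
  have hΦm := G.measurable_afterJump π₁ π₂ (θ := θ) (H := H) hu k
  have hΦb := G.abs_afterJump_le π₁ π₂ hG hθ hH hM k
  have h1 := G.integral_law_succ π₁ π₂ x k hΦm hΦb
  simp only [G.afterJump_hist π₁ π₂ hH huH k] at h1
  rw [integral_add (hVi (k + 1)) hXi] at h1
  have hIi : Integrable (fun ω => ∫ z, G.afterJump π₁ π₂ θ H u k (hist ω k, z)
      ∂(G.step π₁ π₂ k (hist ω k))) (G.law π₁ π₂ x) := by
    refine integrable_of_abs_le (M := Real.exp (θ * (G.rNorm * H)) * M)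
      ((hΦm.stronglyMeasurable.integral_kernel_prod_right' (κ := G.step π₁ π₂ k)).measurable.comp
        (measurable_hist k)) fun ω => ?_
    simpa using norm_integral_le_of_norm_le_const (μ := G.step π₁ π₂ k (hist ω k))
      (f := fun z => G.afterJump π₁ π₂ θ H u k (hist ω k, z)) (Eventually.of_forall fun z => hΦb _)
  rw [sub_sub, h1, ← integral_sub (hVi k) hIi, ← integral_const_mul]
  exact integral_nonneg fun ω => G.integral_afterJump_le π₁ π₂ hG hθ hH hu hM hη hc huη k _
    (hσ k (hist ω k))

end Verification

section NonExplosion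

open Classical in
/-- The discount factor `exp(-c δ)`, equal to `0` for `δ = ∞`. -/
noncomputable def discount (c : ℝ) (δ : ℝ≥0∞) : ℝ := if δ = ∞ then 0 else Real.exp (-c * δ.toReal)

theorem discount_add (c : ℝ) (δ δ' : ℝ≥0∞) :
    discount c (δ + δ') = discount c δ * discount c δ' := by
  by_cases h : δ = ∞
  · simp [discount, h]
  by_cases h' : δ' = ∞
  · simp [discount, h']
  rw [discount, discount, discount, if_neg (ENNReal.add_ne_top.2 ⟨h, h'⟩), if_neg h, if_neg h',
    ENNReal.toReal_add h h', ← Real.exp_add]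
  congr 1
  ring

theorem measurable_discount (c : ℝ) : Measurable (discount c) :=
  Measurable.ite (measurableSet_singleton _) measurable_const
    (Real.measurable_exp.comp (ENNReal.measurable_toReal.const_mul (-c)))

theorem discount_nonneg (c : ℝ) (δ : ℝ≥0∞) : 0 ≤ discount c δ := by
  rw [discount]
  split_ifs
  · exact le_rfl
  · exact (Real.exp_pos _).le

theorem abs_discount_le {c : ℝ} (hc : 0 ≤ c) (δ : ℝ≥0∞) : |discount c δ| ≤ 1 := by
  rw [abs_of_nonneg (discount_nonneg c δ), discount]
  split_ifs
  · exact zero_le_one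
  · rw [Real.exp_le_one_iff, neg_mul, neg_nonpos]
    exact mul_nonneg hc ENNReal.toReal_nonneg

variable {S A B : Type*} [MeasurableSpace S] [StandardBorelSpace S] [MeasurableSpace A]
  [MeasurableSpace B] (G : Model S A B) (π₁ : Policy G.actA) (π₂ : Policy G.actB)

theorem Model.integral_discount_step_le (hG : G.IsBounded) (k : ℕ) (h : Hist S k) :
    ∫ z, discount (2 * G.qNorm + 1) z.1 ∂(G.step π₁ π₂ k h) ≤ 1 / 2 := by
  have hq := G.qNorm_nonneg
  set c := 2 * G.qNorm + 1 with hc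
  have hc0 : 0 < c := by positivity
  rw [G.integral_step π₁ π₂ k h (f := fun z => discount c z.1)
    ((measurable_discount c).comp measurable_fst) (fun z => abs_discount_le hc0.le _)
    (by simp [discount])]
  have hbound : ∫ s in Ioi (0 : ℝ), G.qNorm * Real.exp (-c * s) ≤ 1 / 2 := by
    rw [integral_const_mul, integral_exp_mul_Ioi (by linarith), mul_zero, Real.exp_zero, neg_div_neg_eq,
      mul_one_div, div_le_div_iff₀ hc0 two_pos]
    linarith
  have hi : IntegrableOn (fun s => G.qNorm * Real.exp (-c * s)) (Ioi (0 : ℝ)) :=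
    (integrableOn_exp_mul_Ioi (by linarith) 0).const_mul _
  refine (integral_mono_of_nonneg ?_ hi ?_).trans hbound
  · exact Eventually.of_forall fun s => mul_nonneg ENNReal.toReal_nonneg
      (integral_nonneg fun y => discount_nonneg c _)
  · refine (ae_restrict_iff' measurableSet_Ioi).2 (Eventually.of_forall fun s hs => ?_)
    have hs0 : 0 ≤ s := le_of_lt hs
    have h1 : discount c (ENNReal.ofReal s) = Real.exp (-c * s) := by
      rw [discount, if_neg ENNReal.ofReal_ne_top, ENNReal.toReal_ofReal hs0]
    dsimp only
    rw [integral_const, h1, smul_eq_mul, G.survival_toReal π₁ π₂ k h hs0, ← mul_assoc]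
    refine mul_le_mul_of_nonneg_right ?_ (Real.exp_pos _).le
    have h2 : Real.exp (-∫ u in (0 : ℝ)..s, G.intensity π₁ π₂ k (h, u)) ≤ 1 := by
      rw [Real.exp_le_one_iff, neg_nonpos]
      exact intervalIntegral.integral_nonneg hs0 fun u _ => G.intensity_nonneg π₁ π₂ k _
    exact (mul_le_of_le_one_left measureReal_nonneg h2).trans
      ((le_abs_self _).trans (G.abs_intensity_le π₁ π₂ hG k (h, s)))

theorem Model.integral_discount_le (hG : G.IsBounded) (x : S) (k : ℕ) :
    ∫ ω, discount (2 * G.qNorm + 1) (etime (hist ω k)) ∂(G.law π₁ π₂ x) ≤ (1 / 2) ^ k := by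
  have hc0 : 0 ≤ 2 * G.qNorm + 1 := by linarith [G.qNorm_nonneg]
  set c := 2 * G.qNorm + 1 with hc
  have hm : ∀ k, Measurable fun h : Hist S k => discount c (etime h) := fun k =>
    (measurable_discount c).comp (measurable_etime k)
  induction k with
  | zero =>
    have h1 := norm_integral_le_of_norm_le_const (μ := G.law π₁ π₂ x)
      (f := fun ω => discount c (etime (hist ω 0)))
      (Eventually.of_forall fun ω => abs_discount_le hc0 _)
    have h2 := (le_abs_self _).trans h1
    simpa using h2
  | succ k ih =>
    have h1 := G.integral_law_succ π₁ π₂ x k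
      (F := fun p => discount c (etime p.1) * discount c p.2.1)
      (((hm k).comp measurable_fst).mul ((measurable_discount c).comp measurable_snd.fst))
      (C := 1 * 1) (fun p => by
        rw [abs_mul]
        exact mul_le_mul (abs_discount_le hc0 _) (abs_discount_le hc0 _) (abs_nonneg _) zero_le_one)
    simp only [etime_hist_succ, discount_add]
    rw [h1, pow_succ]
    simp only [integral_const_mul]
    refine le_trans ?_ (mul_le_mul_of_nonneg_right ih (by norm_num))
    rw [← integral_mul_const]
    refine integral_mono_of_nonneg (Eventually.of_forall fun ω => mul_nonneg (discount_nonneg c _)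
      (integral_nonneg fun z => discount_nonneg c _)) ?_ (Eventually.of_forall fun ω => ?_)
    · exact (integrable_of_abs_le ((hm k).comp (measurable_hist k))
        fun ω => abs_discount_le hc0 _).mul_const _
    · exact mul_le_mul_of_nonneg_left (G.integral_discount_step_le π₁ π₂ hG k _)
        (discount_nonneg c _)

theorem Model.law_real_etime_le (hG : G.IsBounded) {H : ℝ} (hH : 0 ≤ H) (x : S) (k : ℕ) :
    (G.law π₁ π₂ x).real {ω | etime (hist ω k) ≤ ENNReal.ofReal H} ≤
      Real.exp ((2 * G.qNorm + 1) * H) * (1 / 2) ^ k := by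
  have hc0 : 0 ≤ 2 * G.qNorm + 1 := by linarith [G.qNorm_nonneg]
  have h0 := G.integral_discount_le π₁ π₂ hG x k
  set c := 2 * G.qNorm + 1 with hc
  have hset : MeasurableSet {ω : Path S | etime (hist ω k) ≤ ENNReal.ofReal H} :=
    measurableSet_le ((measurable_etime k).comp (measurable_hist k)) measurable_const
  refine le_trans ?_ (mul_le_mul_of_nonneg_left h0 (Real.exp_pos _).le)
  rw [← integral_indicator_one hset, ← integral_const_mul]
  refine integral_mono_of_nonneg (Eventually.of_forall fun ω =>
    indicator_nonneg (fun _ _ => zero_le_one) _) ?_ (Eventually.of_forall fun ω => ?_)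
  · exact (integrable_of_abs_le ((measurable_discount c).comp ((measurable_etime k).comp
      (measurable_hist k))) fun ω => abs_discount_le hc0 _).const_mul _
  · dsimp only
    by_cases hω : etime (hist ω k) ≤ ENNReal.ofReal H
    · rw [indicator_of_mem (by exact hω), discount, if_neg (hω.trans_lt ENNReal.ofReal_lt_top).ne,
        ← Real.exp_add, Pi.one_apply, Real.one_le_exp_iff]
      have := mul_le_mul_of_nonneg_left (ENNReal.toReal_le_of_le_ofReal hH hω) hc0
      linarith
    · rw [indicator_of_notMem (by exact hω)]
      exact mul_nonneg (Real.exp_pos _).le (discount_nonneg c _)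

theorem Model.tendsto_law_real_etime_le (hG : G.IsBounded) {H : ℝ} (hH : 0 ≤ H) (x : S) :
    Tendsto (fun k => (G.law π₁ π₂ x).real {ω | etime (hist ω k) ≤ ENNReal.ofReal H}) atTop
      (𝓝 0) := by
  refine squeeze_zero (fun _ => measureReal_nonneg)
    (fun k => G.law_real_etime_le π₁ π₂ hG hH x k) ?_
  simpa using (tendsto_pow_atTop_nhds_zero_of_lt_one (r := (1 / 2 : ℝ)) (by norm_num)
    (by norm_num)).const_mul (Real.exp ((2 * G.qNorm + 1) * H))

/-- The process does not explode. -/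
theorem Model.ae_eventually_lt_etime (hG : G.IsBounded) {H : ℝ} (hH : 0 ≤ H) (x : S) :
    ∀ᵐ ω ∂(G.law π₁ π₂ x), ∀ᶠ k in atTop, ENNReal.ofReal H < etime (hist ω k) := by
  have h1 : ∑' k, G.law π₁ π₂ x {ω | etime (hist ω k) ≤ ENNReal.ofReal H} ≠ ∞ := by
    have hs : Summable fun k : ℕ => Real.exp ((2 * G.qNorm + 1) * H) * (1 / 2 : ℝ) ^ k :=
      (summable_geometric_of_lt_one (by norm_num) (by norm_num)).mul_left _
    refine ne_top_of_le_ne_top hs.tsum_ofReal_ne_top (ENNReal.tsum_le_tsum fun k => ?_)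
    rw [← ENNReal.ofReal_toReal (measure_ne_top (G.law π₁ π₂ x) _)]
    exact ENNReal.ofReal_le_ofReal (G.law_real_etime_le π₁ π₂ hG hH x k)
  filter_upwards [ae_eventually_notMem h1] with ω hω
  filter_upwards [hω] with k hk
  exact not_le.1 hk

end NonExplosion

section Pathwise

variable {S A B : Type*} [MeasurableSpace S] [MeasurableSpace A] [MeasurableSpace B]
  (G : Model S A B) (π₁ : Policy G.actA) (π₂ : Policy G.actB)

omit [MeasurableSpace S] in
theorem monotone_jumpTime (ω : Path S) : Monotone (jumpTime ω) :=
  monotone_nat_of_le_succ fun k => by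
    rw [jumpTime, jumpTime, Finset.sum_range_succ]
    exact le_self_add

omit [MeasurableSpace S] in
theorem eq_of_jumpTime_le_lt {ω : Path S} {j k : ℕ} {t : ℝ≥0∞} (hj : jumpTime ω j ≤ t)
    (hj' : t < jumpTime ω (j + 1)) (hk : jumpTime ω k ≤ t) (hk' : t < jumpTime ω (k + 1)) :
    j = k := by
  by_contra hne
  rcases lt_or_gt_of_ne hne with h | h
  · exact absurd (hj'.trans_le (monotone_jumpTime ω h)) (not_lt.2 hk)
  · exact absurd (hk'.trans_le (monotone_jumpTime ω h)) (not_lt.2 hj)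

omit [MeasurableSpace S] in
theorem current_eq {ω : Path S} {k : ℕ} {t : ℝ} (hk : jumpTime ω k ≤ ENNReal.ofReal t)
    (hk' : ENNReal.ofReal t < jumpTime ω (k + 1)) (f : ℕ → ℝ → ℝ) :
    current ω f t = f k (t - (jumpTime ω k).toReal) := by
  rw [current, tsum_eq_single k fun j hj => if_neg fun h => hj
    (eq_of_jumpTime_le_lt h.1 h.2 hk hk'), if_pos ⟨hk, hk'⟩]

theorem Model.payoffRate_eq {ω : Path S} {k : ℕ} {t : ℝ} (hk : jumpTime ω k ≤ ENNReal.ofReal t)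
    (hk' : ENNReal.ofReal t < jumpTime ω (k + 1)) :
    G.payoffRate π₁ π₂ ω t = G.meanRate π₁ π₂ k (hist ω k, t - (jumpTime ω k).toReal) := by
  rw [Model.payoffRate, current_eq hk hk', ← G.meanRate_eq]
  rfl

theorem Model.integral_payoffRate_sojourn (hG : G.IsBounded) {ω : Path S} {k : ℕ} {b : ℝ}
    (hk : jumpTime ω k ≤ ENNReal.ofReal b) (hb : 0 ≤ b)
    (hk' : ENNReal.ofReal b ≤ jumpTime ω (k + 1)) :
    IntervalIntegrable (G.payoffRate π₁ π₂ ω) volume (jumpTime ω k).toReal b ∧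
      ∫ t in (jumpTime ω k).toReal..b, G.payoffRate π₁ π₂ ω t =
        ∫ s in (0 : ℝ)..(b - (jumpTime ω k).toReal), G.meanRate π₁ π₂ k (hist ω k, s) := by
  have hkb : (jumpTime ω k).toReal ≤ b := ENNReal.toReal_le_of_le_ofReal hb hk
  have heq : EqOn (fun t => G.meanRate π₁ π₂ k (hist ω k, t - (jumpTime ω k).toReal))
      (G.payoffRate π₁ π₂ ω) (uIoo (jumpTime ω k).toReal b) := by
    intro t ht
    rw [uIoo_of_le hkb] at ht
    refine (G.payoffRate_eq π₁ π₂ ?_ ?_).symm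
    · exact (ENNReal.le_ofReal_iff_toReal_le (hk.trans_lt ENNReal.ofReal_lt_top).ne
        (ENNReal.toReal_nonneg.trans ht.1.le)).2 ht.1.le
    · exact ((ENNReal.ofReal_lt_ofReal_iff (ENNReal.toReal_nonneg.trans_lt (ht.1.trans ht.2))).2
        ht.2).trans_le hk'
  refine ⟨IntervalIntegrable.congr_uIoo (intervalIntegrable_of_abs_le ?_
    (fun t => G.abs_meanRate_le π₁ π₂ hG k _) _ _) heq, ?_⟩
  · exact (G.measurable_meanRate π₁ π₂ k).comp (measurable_const.prodMk (measurable_id.sub_const _))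
  · rw [← intervalIntegral.integral_congr_uIoo heq, intervalIntegral.integral_comp_sub_right
      (fun s => G.meanRate π₁ π₂ k (hist ω k, s)), sub_self]

theorem Model.integral_payoffRate_jumpTime (hG : G.IsBounded) {ω : Path S} (k : ℕ)
    (hk : jumpTime ω k ≠ ∞) :
    IntervalIntegrable (G.payoffRate π₁ π₂ ω) volume 0 (jumpTime ω k).toReal ∧
      ∫ t in (0 : ℝ)..(jumpTime ω k).toReal, G.payoffRate π₁ π₂ ω t =
        G.logWeight π₁ π₂ k (hist ω k) := by
  induction k with
  | zero => simp [jumpTime, Model.logWeight]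
  | succ k ih =>
    have h1 : jumpTime ω (k + 1) = jumpTime ω k + (ω (k + 1)).1 := by
      rw [jumpTime, jumpTime, Finset.sum_range_succ]
    have h2 : jumpTime ω k ≠ ∞ ∧ (ω (k + 1)).1 ≠ ∞ := by
      rw [h1] at hk
      exact ENNReal.add_ne_top.1 hk
    obtain ⟨ih1, ih2⟩ := ih h2.1
    obtain ⟨h3, h4⟩ := G.integral_payoffRate_sojourn π₁ π₂ hG (ω := ω) (k := k)
      (b := (jumpTime ω (k + 1)).toReal)
      (by rw [ENNReal.ofReal_toReal hk]; exact monotone_jumpTime ω k.le_succ)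
      ENNReal.toReal_nonneg (by rw [ENNReal.ofReal_toReal hk])
    refine ⟨ih1.trans h3, ?_⟩
    rw [← intervalIntegral.integral_add_adjacent_intervals ih1 h3, ih2, h4, h1,
      ENNReal.toReal_add h2.1 h2.2, add_sub_cancel_left]
    rfl

/-- The integrand of the value. -/
noncomputable def Model.reward (θ H : ℝ) (ω : Path S) : ℝ :=
  Real.exp (θ * (∫ t in (0 : ℝ)..H, G.payoffRate π₁ π₂ ω t) +
    θ * current ω (fun k _ => G.g (ω k).2) H)

theorem Model.reward_eq_atHorizon (hG : G.IsBounded) (θ : ℝ) {H : ℝ} (hH : 0 ≤ H) {ω : Path S}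
    (h0 : (ω 0).1 = 0) {k : ℕ} (hk : jumpTime ω k ≤ ENNReal.ofReal H)
    (hk' : ENNReal.ofReal H < jumpTime ω (k + 1)) :
    G.reward π₁ π₂ θ H ω = G.atHorizon π₁ π₂ θ H k (hist ω k, ω (k + 1)) := by
  obtain ⟨h1, h2⟩ := G.integral_payoffRate_jumpTime π₁ π₂ hG k
    (hk.trans_lt ENNReal.ofReal_lt_top).ne
  obtain ⟨h3, h4⟩ := G.integral_payoffRate_sojourn π₁ π₂ hG hk hH hk'.le
  have h5 : etime (hist ω k) = jumpTime ω k := etime_hist_eq_jumpTime h0 k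
  have h6 : histTime (hist ω k) = (jumpTime ω k).toReal := congrArg ENNReal.toReal h5
  rw [Model.reward, Model.atHorizon, if_pos, ← intervalIntegral.integral_add_adjacent_intervals h1 h3,
    h2, h4, current_eq hk hk', h6]
  · rfl
  · refine ⟨h5.trans_le hk, ?_⟩
    rw [← etime_hist_succ, etime_hist_eq_jumpTime h0]
    exact hk'

theorem Model.sum_atHorizon_eq_reward (hG : G.IsBounded) (θ : ℝ) {H : ℝ} (hH : 0 ≤ H) {ω : Path S}
    (h0 : (ω 0).1 = 0) {k : ℕ} (hk : ENNReal.ofReal H < etime (hist ω k)) :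
    ∑ j ∈ Finset.range k, G.atHorizon π₁ π₂ θ H j (hist ω j, ω (j + 1)) =
      G.reward π₁ π₂ θ H ω := by
  classical
  rw [etime_hist_eq_jumpTime h0] at hk
  have hex : ∃ m, ENNReal.ofReal H < jumpTime ω m := ⟨k, hk⟩
  obtain ⟨n, hn⟩ : ∃ n, Nat.find hex = n + 1 := by
    refine Nat.exists_eq_succ_of_ne_zero fun h => ?_
    have := Nat.find_spec hex
    rw [h] at this
    simp [jumpTime] at this
  have hn1 : ENNReal.ofReal H < jumpTime ω (n + 1) := hn ▸ Nat.find_spec hex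
  have hn2 : jumpTime ω n ≤ ENNReal.ofReal H := not_lt.1 (Nat.find_min hex (by omega))
  have hnk : n ∈ Finset.range k := by
    rw [Finset.mem_range]
    have := Nat.find_min' hex hk
    omega
  rw [G.reward_eq_atHorizon π₁ π₂ hG θ hH h0 hn2 hn1, Finset.sum_eq_single_of_mem n hnk]
  intro j _ hj
  rw [Model.atHorizon, if_neg]
  rintro ⟨h1, h2⟩
  rw [← etime_hist_succ] at h2
  dsimp only at h1
  rw [etime_hist_eq_jumpTime h0] at h1 h2
  exact hj (eq_of_jumpTime_le_lt h1 h2 hn2 hn1)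

theorem Model.sum_atHorizon_le (hG : G.IsBounded) {θ : ℝ} (hθ : 0 ≤ θ) {H : ℝ} (hH : 0 ≤ H) {M : ℝ}
    (hM : ∀ y, Real.exp (θ * G.g y) ≤ M) {ω : Path S} (h0 : (ω 0).1 = 0) (k : ℕ) :
    ∑ j ∈ Finset.range k, G.atHorizon π₁ π₂ θ H j (hist ω j, ω (j + 1)) ≤
      Real.exp (θ * (G.rNorm * H)) * M := by
  have hM0 : 0 ≤ M := (Real.exp_pos _).le.trans (hM (ω 0).2)
  by_cases h : ∃ n ∈ Finset.range k, jumpTime ω n ≤ ENNReal.ofReal H ∧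
      ENNReal.ofReal H < jumpTime ω (n + 1)
  · obtain ⟨n, hnk, hn2, hn1⟩ := h
    rw [Finset.sum_eq_single_of_mem n hnk]
    · exact G.atHorizon_le π₁ π₂ hG hθ hH hM n _
    · intro j _ hj
      rw [Model.atHorizon, if_neg]
      rintro ⟨h1, h2⟩
      rw [← etime_hist_succ] at h2
      dsimp only at h1
      rw [etime_hist_eq_jumpTime h0] at h1 h2
      exact hj (eq_of_jumpTime_le_lt h1 h2 hn2 hn1)
  · rw [Finset.sum_eq_zero]
    · positivity
    · intro j hj
      rw [Model.atHorizon, if_neg]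
      rintro ⟨h1, h2⟩
      rw [← etime_hist_succ] at h2
      dsimp only at h1
      rw [etime_hist_eq_jumpTime h0] at h1 h2
      exact h ⟨j, hj, h1, h2⟩

end Pathwise

section VerificationTheorem

variable {S A B : Type*} [MeasurableSpace S] [StandardBorelSpace S] [MeasurableSpace A]
  [MeasurableSpace B] (G : Model S A B) (π₁ : Policy G.actA) (π₂ : Policy G.actB)

theorem Model.integral_atHorizon_tendsto (hG : G.IsBounded) {θ : ℝ} (hθ : 0 ≤ θ) {H : ℝ}
    (hH : 0 ≤ H) (x : S) :
    G.value θ H π₁ π₂ x ≠ ∞ ∧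
      Tendsto (fun k => ∑ j ∈ Finset.range k,
        ∫ ω, G.atHorizon π₁ π₂ θ H j (hist ω j, ω (j + 1)) ∂(G.law π₁ π₂ x)) atTop
        (𝓝 (G.value θ H π₁ π₂ x).toReal) := by
  obtain ⟨Mg, hMg⟩ := hG.2.2
  have hgM : ∀ y, Real.exp (θ * G.g y) ≤ Real.exp (θ * Mg) := fun y =>
    Real.exp_le_exp.2 (mul_le_mul_of_nonneg_left
      ((le_abs_self _).trans (hMg ⟨y, rfl⟩)) hθ)
  have hm : ∀ k, Measurable fun ω : Path S => G.atHorizon π₁ π₂ θ H k (hist ω k, ω (k + 1)) :=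
    fun k => (G.measurable_atHorizon π₁ π₂ k).comp
      ((measurable_hist k).prodMk (measurable_pi_apply _))
  have hi : ∀ k, Integrable (fun ω : Path S => G.atHorizon π₁ π₂ θ H k (hist ω k, ω (k + 1)))
      (G.law π₁ π₂ x) := fun k => integrable_of_abs_le (hm k) fun ω => by
    rw [abs_of_nonneg (G.atHorizon_nonneg π₁ π₂ k _)]
    exact G.atHorizon_le π₁ π₂ hG hθ hH hgM k _
  have h0 : ∀ᵐ ω ∂(G.law π₁ π₂ x), (ω 0).1 = 0 := by
    filter_upwards [G.ae_law_hist_zero π₁ π₂ x] with ω hω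
    have := congrFun hω ⟨0, by simp⟩
    exact congrArg Prod.fst this
  have hlim : ∀ᵐ ω ∂(G.law π₁ π₂ x), Tendsto (fun k => ∑ j ∈ Finset.range k,
      G.atHorizon π₁ π₂ θ H j (hist ω j, ω (j + 1))) atTop (𝓝 (G.reward π₁ π₂ θ H ω)) := by
    filter_upwards [h0, G.ae_eventually_lt_etime π₁ π₂ hG hH x] with ω hω0 hω
    refine tendsto_const_nhds.congr' ?_
    filter_upwards [hω] with k hk
    exact (G.sum_atHorizon_eq_reward π₁ π₂ hG θ hH hω0 hk).symm
  have hsm : ∀ k, Measurable fun ω : Path S => ∑ j ∈ Finset.range k,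
      G.atHorizon π₁ π₂ θ H j (hist ω j, ω (j + 1)) := fun k =>
    Finset.measurable_sum _ fun j _ => hm j
  have hb : ∀ k, ∀ᵐ ω ∂(G.law π₁ π₂ x), ‖∑ j ∈ Finset.range k,
      G.atHorizon π₁ π₂ θ H j (hist ω j, ω (j + 1))‖ ≤
        Real.exp (θ * (G.rNorm * H)) * Real.exp (θ * Mg) := by
    intro k
    filter_upwards [h0] with ω hω0
    rw [Real.norm_of_nonneg (Finset.sum_nonneg fun j _ => G.atHorizon_nonneg π₁ π₂ j _)]
    exact G.sum_atHorizon_le π₁ π₂ hG hθ hH hgM hω0 k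
  have hrm : AEStronglyMeasurable (G.reward π₁ π₂ θ H) (G.law π₁ π₂ x) :=
    aestronglyMeasurable_of_tendsto_ae atTop (fun k => (hsm k).aestronglyMeasurable) hlim
  have hrb : ∀ᵐ ω ∂(G.law π₁ π₂ x), ‖G.reward π₁ π₂ θ H ω‖ ≤
      Real.exp (θ * (G.rNorm * H)) * Real.exp (θ * Mg) := by
    filter_upwards [hlim, ae_all_iff.2 hb] with ω h1 h2
    exact le_of_tendsto h1.norm (Eventually.of_forall h2)
  have hri : Integrable (G.reward π₁ π₂ θ H) (G.law π₁ π₂ x) := Integrable.of_bound hrm _ hrb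
  have hval : G.value θ H π₁ π₂ x =
      ENNReal.ofReal (∫ ω, G.reward π₁ π₂ θ H ω ∂(G.law π₁ π₂ x)) :=
    (ofReal_integral_eq_lintegral_ofReal hri
      (Eventually.of_forall fun ω => (Real.exp_pos _).le)).symm
  refine ⟨hval ▸ ENNReal.ofReal_ne_top, ?_⟩
  have hr0 : 0 ≤ ∫ ω, G.reward π₁ π₂ θ H ω ∂(G.law π₁ π₂ x) :=
    integral_nonneg fun ω => (Real.exp_pos _).le
  rw [hval, ENNReal.toReal_ofReal hr0]
  have h1 := tendsto_integral_of_dominated_convergence _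
    (fun k => (hsm k).aestronglyMeasurable) (integrable_const _) hb hlim
  refine h1.congr fun k => ?_
  exact integral_finsetSum _ fun j _ => hi j

/-- The verification theorem: a solution `u` of the backward equation with right-hand side `η`
bounds the value from above (`σ = 1`) or below (`σ = -1`), if `η` bounds the one-stage payoff. -/
theorem Model.verification (hG : G.IsBounded) {θ : ℝ} (hθ : 0 ≤ θ) {H : ℝ} (hH : 0 ≤ H)
    {u : ℝ → S → ℝ} (hu : Measurable (Function.uncurry u)) {M : ℝ} (hM : ∀ t y, |u t y| ≤ M)
    {η : ℝ → S → ℝ} (hη : ∀ x, Measurable fun s => η s x) {c : ℝ} (hc : ∀ s x, |η s x| ≤ c)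
    (huη : ∀ t ∈ Icc 0 H, ∀ x, u t x = Real.exp (θ * G.g x) + ∫ s in t..H, η s x)
    {σ : ℝ} (hσ : ∀ k (h : Hist S k) s, 0 ≤ s → histTime h + s ≤ H →
      0 ≤ σ * (η (histTime h + s) (lastState h) -
      G.payoff θ u (histTime h + s) (lastState h) (π₁.ker k (h, s)) (π₂.ker k (h, s))))
    (x : S) : 0 ≤ σ * (u 0 x - (G.value θ H π₁ π₂ x).toReal) := by
  have hM0 : 0 ≤ M := (abs_nonneg _).trans (hM 0 x)
  set V : ℕ → ℝ := fun k => ∫ ω, G.atJump π₁ π₂ θ H u k (hist ω k) ∂(G.law π₁ π₂ x) with hV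
  set X : ℕ → ℝ := fun j => ∫ ω, G.atHorizon π₁ π₂ θ H j (hist ω j, ω (j + 1)) ∂(G.law π₁ π₂ x)
    with hX
  have hV0 : V 0 = u 0 x := by
    have : ∀ᵐ ω ∂(G.law π₁ π₂ x), G.atJump π₁ π₂ θ H u 0 (hist ω 0) = u 0 x := by
      filter_upwards [G.ae_law_hist_zero π₁ π₂ x] with ω hω
      rw [hω]
      simp [Model.atJump, etime, histTime, lastState, Model.logWeight]
    rw [hV]
    dsimp only
    rw [integral_congr_ae this]
    simp
  have hstep : ∀ k, 0 ≤ σ * (V k - V (k + 1) - X k) := fun k =>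
    G.integral_atJump_succ_le π₁ π₂ hG hθ hH hu hM hη hc huη hσ x k
  have htel : ∀ k, 0 ≤ σ * (u 0 x - V k - ∑ j ∈ Finset.range k, X j) := by
    intro k
    induction k with
    | zero => simp [hV0]
    | succ k ih =>
      rw [Finset.sum_range_succ]
      linarith [hstep k]
  have hVlim : Tendsto V atTop (𝓝 0) := by
    have h1 := (G.tendsto_law_real_etime_le π₁ π₂ hG hH x).const_mul
      (Real.exp (θ * (G.rNorm * H)) * M)
    rw [mul_zero] at h1
    refine squeeze_zero_norm (fun k => ?_) h1
    have hset : MeasurableSet {ω : Path S | etime (hist ω k) ≤ ENNReal.ofReal H} :=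
      measurableSet_le ((measurable_etime k).comp (measurable_hist k)) measurable_const
    rw [← integral_indicator_one hset, ← integral_const_mul]
    refine norm_integral_le_of_norm_le ?_ (Eventually.of_forall fun ω =>
      G.abs_atJump_le π₁ π₂ hG hθ hH hM k (hist ω k))
    exact ((integrable_const (1 : ℝ)).indicator hset).const_mul _
  have h2 := ((tendsto_const_nhds (x := u 0 x)).sub hVlim).sub
    (G.integral_atHorizon_tendsto π₁ π₂ hG hθ hH x).2
  rw [sub_zero] at h2
  exact ge_of_tendsto' (h2.const_mul σ) htel

end VerificationTheorem

section Clip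

variable {S : Type*} [MeasurableSpace S] {T : ℝ}

/-- Projection of the time to `[0,T]`. -/
noncomputable def clip (T t : ℝ) : ℝ := max 0 (min t T)

theorem clip_mem (hT : 0 ≤ T) (t : ℝ) : clip T t ∈ Icc 0 T :=
  ⟨le_max_left _ _, max_le hT (min_le_right _ _)⟩

theorem clip_of_mem {t : ℝ} (ht : t ∈ Icc 0 T) : clip T t = t := by
  rw [clip, min_eq_left ht.2, max_eq_right ht.1]

theorem measurable_clip (T : ℝ) : Measurable (clip T) :=
  measurable_const.max (measurable_id.min measurable_const)

/-- A bounded measurable function on `ℝ × S`. -/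
structure IsBddMeas (v : ℝ → S → ℝ) : Prop where
  meas : Measurable (Function.uncurry v)
  bdd : ∃ M, ∀ t y, |v t y| ≤ M

theorem isBddMeas_clip (hT : 0 ≤ T) {v : ℝ → S → ℝ}
    (hv : Measurable fun p : Icc (0 : ℝ) T × S => v p.1 p.2)
    (hb : ∃ C, ∀ t ∈ Icc 0 T, ∀ x, |v t x| ≤ C) : IsBddMeas fun t => v (clip T t) := by
  obtain ⟨C, hC⟩ := hb
  refine ⟨?_, C, fun t y => hC _ (clip_mem hT t) y⟩
  have h1 : Measurable fun p : ℝ × S => ((⟨clip T p.1, clip_mem hT p.1⟩ : Icc (0 : ℝ) T), p.2) :=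
    (((measurable_clip T).comp measurable_fst).subtype_mk).prodMk measurable_snd
  exact hv.comp h1

end Clip

section Iteration

variable {S A B : Type*} [MeasurableSpace S] [StandardBorelSpace S]
  [MeasurableSpace A] [MeasurableSpace B] (G : Model S A B)
  [TopologicalSpace A] [TopologicalSpace.MetrizableSpace A] [SecondCountableTopology A]
  [BorelSpace A] [StandardBorelSpace A]
  [TopologicalSpace B] [TopologicalSpace.MetrizableSpace B] [SecondCountableTopology B]
  [BorelSpace B] [StandardBorelSpace B] {θ T : ℝ}

theorem Model.isBddMeas_supInf (hc : G.CompactContinuous) (hG : G.IsBounded) (hθ : 0 ≤ θ)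
    {v : ℝ → S → ℝ} (hv : IsBddMeas v) : IsBddMeas (G.supInf θ v) := by
  obtain ⟨M, hM⟩ := hv.bdd
  exact ⟨G.measurable_supInf hc hG hθ hv.meas hM, _, fun t x =>
    G.abs_supInf_le hc hG hθ hv.meas.of_uncurry_left (hM t) x⟩

omit [StandardBorelSpace S] in
theorem IsBddMeas.intervalIntegrable {v : ℝ → S → ℝ} (hv : IsBddMeas v) (x : S) (a b : ℝ) :
    IntervalIntegrable (fun s => v s x) volume a b := by
  obtain ⟨M, hM⟩ := hv.bdd
  exact intervalIntegrable_of_abs_le (hv.meas.comp measurable_prodMk_right) (fun s => hM s x) a b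

omit [StandardBorelSpace S] [TopologicalSpace A] [TopologicalSpace.MetrizableSpace A]
  [SecondCountableTopology A] [BorelSpace A] [StandardBorelSpace A] [TopologicalSpace B]
  [TopologicalSpace.MetrizableSpace B] [SecondCountableTopology B] [BorelSpace B]
  [StandardBorelSpace B] in
theorem Model.Gam_congr {v v' : ℝ → S → ℝ} (h : ∀ t ∈ Icc 0 T, v t = v' t) {t : ℝ}
    (ht : t ∈ Icc 0 T) (x : S) : G.Gam θ T v t x =
      Real.exp (θ * G.g x) + ∫ s in t..T, G.supInf θ v' s x := by
  rw [Model.Gam]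
  congr 1
  refine intervalIntegral.integral_congr fun s hs => ?_
  rw [uIcc_of_le ht.2] at hs
  exact Model.supInf_congr (h s ⟨ht.1.trans hs.1, hs.2⟩)

theorem Model.isBddMeas_Gam_clip (hc : G.CompactContinuous) (hG : G.IsBounded) (hθ : 0 ≤ θ)
    (hT : 0 ≤ T) {v : ℝ → S → ℝ} (hv : IsBddMeas v) :
    IsBddMeas fun t => G.Gam θ T v (clip T t) := by
  have hsi := G.isBddMeas_supInf hc hG hθ hv
  obtain ⟨M, hM⟩ := hsi.bdd
  obtain ⟨Mg, hMg⟩ := hG.2.2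
  have hm : Measurable fun p : ℝ × S => G.Gam θ T v p.1 p.2 := by
    have h1 := measurable_primitive (X := S) (f := fun q => G.supInf θ v q.2 q.1)
      (hsi.meas.comp measurable_swap)
    have h2 : (fun p : ℝ × S => G.Gam θ T v p.1 p.2) = fun p : ℝ × S => Real.exp (θ * G.g p.2) +
        ((∫ s in (0 : ℝ)..T, G.supInf θ v s p.2) - ∫ s in (0 : ℝ)..p.1, G.supInf θ v s p.2) := by
      ext ⟨t, x⟩
      rw [intervalIntegral.integral_interval_sub_left (hsi.intervalIntegrable x 0 T)
        (hsi.intervalIntegrable x 0 t)]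
      rfl
    rw [h2]
    exact (Real.measurable_exp.comp ((G.measurable_g.comp measurable_snd).const_mul θ)).add
      ((h1.comp (measurable_snd.prodMk measurable_const)).sub (h1.comp measurable_swap))
  refine ⟨hm.comp (((measurable_clip T).comp measurable_fst).prodMk measurable_snd),
    Real.exp (θ * Mg) + M * T, fun t x => ?_⟩
  have h0 := clip_mem hT t
  refine (abs_add_le _ _).trans (add_le_add ?_ ?_)
  · rw [abs_of_pos (Real.exp_pos _)]
    exact Real.exp_le_exp.2 (mul_le_mul_of_nonneg_left ((le_abs_self _).trans (hMg ⟨x, rfl⟩)) hθ)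
  · refine (abs_intervalIntegral_le (fun s => hM s x) (clip T t) T).trans ?_
    rw [abs_of_nonneg (sub_nonneg.2 h0.2)]
    exact mul_le_mul_of_nonneg_left (by linarith [h0.1]) ((abs_nonneg _).trans (hM 0 x))

/-- The value iteration, extended constantly in time outside `[0,T]`. -/
noncomputable def Model.iterClip (θ T : ℝ) (v₀ : ℝ → S → ℝ) (n : ℕ) (t : ℝ) : S → ℝ :=
  G.iter θ T v₀ n (clip T t)

omit [StandardBorelSpace S] [TopologicalSpace A] [TopologicalSpace.MetrizableSpace A]
  [SecondCountableTopology A] [BorelSpace A] [StandardBorelSpace A] [TopologicalSpace B]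
  [TopologicalSpace.MetrizableSpace B] [SecondCountableTopology B] [BorelSpace B]
  [StandardBorelSpace B] in
theorem Model.iterClip_of_mem (v₀ : ℝ → S → ℝ) (n : ℕ) {t : ℝ} (ht : t ∈ Icc 0 T) :
    G.iterClip θ T v₀ n t = G.iter θ T v₀ n t := by
  rw [Model.iterClip, clip_of_mem ht]

omit [StandardBorelSpace S] [TopologicalSpace A] [TopologicalSpace.MetrizableSpace A]
  [SecondCountableTopology A] [BorelSpace A] [StandardBorelSpace A] [TopologicalSpace B]
  [TopologicalSpace.MetrizableSpace B] [SecondCountableTopology B] [BorelSpace B]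
  [StandardBorelSpace B] in
theorem Model.iterClip_succ (v₀ : ℝ → S → ℝ) (n : ℕ) {t : ℝ} (ht : t ∈ Icc 0 T) (x : S) :
    G.iterClip θ T v₀ (n + 1) t x =
      Real.exp (θ * G.g x) + ∫ s in t..T, G.supInf θ (G.iterClip θ T v₀ n) s x := by
  rw [G.iterClip_of_mem v₀ (n + 1) ht, Model.iter, Function.iterate_succ_apply']
  exact G.Gam_congr (fun s hs => (G.iterClip_of_mem v₀ n hs).symm) ht x

theorem Model.isBddMeas_iterClip (hc : G.CompactContinuous) (hG : G.IsBounded) (hθ : 0 ≤ θ)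
    (hT : 0 ≤ T) {v₀ : ℝ → S → ℝ} (hv : Measurable fun p : Icc (0 : ℝ) T × S => v₀ p.1 p.2)
    (hb : ∃ C, ∀ t ∈ Icc 0 T, ∀ x, |v₀ t x| ≤ C) (n : ℕ) : IsBddMeas (G.iterClip θ T v₀ n) := by
  induction n with
  | zero => exact isBddMeas_clip hT hv hb
  | succ n ih =>
    have h1 : G.iterClip θ T v₀ (n + 1) = fun t => G.Gam θ T (G.iterClip θ T v₀ n) (clip T t) := by
      ext t x
      have h2 := G.iterClip_succ (θ := θ) v₀ n (clip_mem hT t) x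
      rw [Model.iterClip, clip_of_mem (clip_mem hT t)] at h2
      rw [Model.iterClip, h2]
      rfl
    rw [h1]
    exact G.isBddMeas_Gam_clip hc hG hθ hT ih

/-- Contraction property of the backward operator. -/
theorem Model.abs_integral_supInf_sub_le (hc : G.CompactContinuous) (hG : G.IsBounded) (hθ : 0 ≤ θ)
    {v v' : ℝ → S → ℝ} (hv : IsBddMeas v) (hv' : IsBddMeas v') {δ : ℝ → ℝ} (hδ : Continuous δ)
    {t : ℝ} (ht : t ∈ Icc 0 T) (h : ∀ s ∈ Icc 0 T, ∀ y, |v s y - v' s y| ≤ δ s) (x : S) :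
    |(∫ s in t..T, G.supInf θ v s x) - ∫ s in t..T, G.supInf θ v' s x| ≤
      G.lip θ * ∫ s in t..T, δ s := by
  have h1 := G.isBddMeas_supInf hc hG hθ hv
  have h2 := G.isBddMeas_supInf hc hG hθ hv'
  obtain ⟨M, hM⟩ := hv.bdd
  obtain ⟨M', hM'⟩ := hv'.bdd
  rw [← intervalIntegral.integral_sub (h1.intervalIntegrable x t T) (h2.intervalIntegrable x t T),
    ← intervalIntegral.integral_const_mul]
  refine intervalIntegral.norm_integral_le_of_norm_le (μ := volume)
    (f := fun s => G.supInf θ v s x - G.supInf θ v' s x) ht.2 (Eventually.of_forall fun s hs => ?_)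
    ((hδ.intervalIntegrable (μ := volume) t T).const_mul _)
  exact G.abs_supInf_sub_le hc hG hθ hv.meas.of_uncurry_left hv'.meas.of_uncurry_left
    (M := max M M') (fun y => (hM s y).trans (le_max_left _ _))
    (fun y => (hM' s y).trans (le_max_right _ _)) (h s ⟨ht.1.trans hs.1.le, hs.2⟩) x

theorem integral_sub_pow_div_factorial (T t : ℝ) (m : ℕ) :
    ∫ s in t..T, (T - s) ^ m / (m.factorial : ℝ) = (T - t) ^ (m + 1) / ((m + 1).factorial : ℝ) := by
  have h0 : ((m : ℝ) + 1) ≠ 0 := by positivity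
  have h1 : (m.factorial : ℝ) ≠ 0 := by positivity
  rw [intervalIntegral.integral_div, intervalIntegral.integral_comp_sub_left (fun s => s ^ m),
    sub_self, integral_pow, Nat.factorial_succ]
  push_cast
  rw [zero_pow m.succ_ne_zero, sub_zero]
  field_simp

/-- Factorial decay of the increments of the value iteration. -/
theorem Model.abs_iterClip_succ_sub_le (hc : G.CompactContinuous) (hG : G.IsBounded) (hθ : 0 ≤ θ)
    (hT : 0 ≤ T) {v₀ : ℝ → S → ℝ} (hv : Measurable fun p : Icc (0 : ℝ) T × S => v₀ p.1 p.2)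
    (hb : ∃ C, ∀ t ∈ Icc 0 T, ∀ x, |v₀ t x| ≤ C) {n : ℕ} {d : ℝ}
    (hd : ∀ t ∈ Icc 0 T, ∀ x, |G.iterClip θ T v₀ (n + 1) t x - G.iterClip θ T v₀ n t x| ≤ d)
    (m : ℕ) {t : ℝ} (ht : t ∈ Icc 0 T) (x : S) :
    |G.iterClip θ T v₀ (n + m + 1) t x - G.iterClip θ T v₀ (n + m) t x| ≤
      G.lip θ ^ m * (T - t) ^ m / (m.factorial : ℝ) * d := by
  have hgood := G.isBddMeas_iterClip hc hG hθ hT hv hb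
  induction m generalizing t x with
  | zero => simpa using hd t ht x
  | succ m ih =>
    rw [← add_assoc, G.iterClip_succ v₀ (n + m + 1) ht x, G.iterClip_succ v₀ (n + m) ht x,
      add_sub_add_left_eq_sub]
    refine (G.abs_integral_supInf_sub_le hc hG hθ (hgood _) (hgood _) (by fun_prop) ht
      (fun s hs y => ih hs y) x).trans_eq ?_
    have h1 : ∀ s, G.lip θ ^ m * (T - s) ^ m / (m.factorial : ℝ) * d =
        (G.lip θ ^ m * d) * ((T - s) ^ m / (m.factorial : ℝ)) := fun s => by ring
    simp only [h1]
    rw [intervalIntegral.integral_const_mul, integral_sub_pow_div_factorial]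
    ring

theorem Model.abs_iterClip_add_sub_le (hc : G.CompactContinuous) (hG : G.IsBounded) (hθ : 0 ≤ θ)
    (hT : 0 ≤ T) {v₀ : ℝ → S → ℝ} (hv : Measurable fun p : Icc (0 : ℝ) T × S => v₀ p.1 p.2)
    (hb : ∃ C, ∀ t ∈ Icc 0 T, ∀ x, |v₀ t x| ≤ C) {n : ℕ} {d : ℝ}
    (hd : ∀ t ∈ Icc 0 T, ∀ x, |G.iterClip θ T v₀ (n + 1) t x - G.iterClip θ T v₀ n t x| ≤ d)
    (m : ℕ) {t : ℝ} (ht : t ∈ Icc 0 T) (x : S) :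
    |G.iterClip θ T v₀ (n + 1 + m) t x - G.iterClip θ T v₀ (n + 1) t x| ≤
      d * (Real.exp (G.lip θ * (T - t)) - 1) := by
  have hd0 : 0 ≤ d := (abs_nonneg _).trans (hd t ht x)
  have hr : 0 ≤ G.lip θ * (T - t) := mul_nonneg (G.lip_nonneg hθ) (sub_nonneg.2 ht.2)
  have h1 : |G.iterClip θ T v₀ (n + 1 + m) t x - G.iterClip θ T v₀ (n + 1) t x| ≤
      d * (∑ j ∈ Finset.range (m + 1), (G.lip θ * (T - t)) ^ j / (j.factorial : ℝ) - 1) := by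
    induction m with
    | zero => simp
    | succ m ih =>
      have h2 := G.abs_iterClip_succ_sub_le hc hG hθ hT hv hb hd (m + 1) ht x
      have h3 : n + (m + 1) = n + 1 + m := by ring
      rw [h3] at h2
      rw [Finset.sum_range_succ]
      have h4 := abs_add_le (G.iterClip θ T v₀ (n + 1 + m + 1) t x - G.iterClip θ T v₀ (n + 1 + m) t x)
        (G.iterClip θ T v₀ (n + 1 + m) t x - G.iterClip θ T v₀ (n + 1) t x)
      rw [sub_add_sub_cancel] at h4
      rw [← mul_pow] at h2
      rw [← add_assoc]
      linarith
  exact h1.trans (mul_le_mul_of_nonneg_left (sub_le_sub_right (Real.sum_le_exp_of_nonneg hr _) _) hd0)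

/-- The value iteration converges to a solution of the optimality equation. -/
theorem Model.exists_limit_iterClip (hc : G.CompactContinuous) (hG : G.IsBounded) (hθ : 0 ≤ θ)
    (hT : 0 ≤ T) {v₀ : ℝ → S → ℝ} (hv : Measurable fun p : Icc (0 : ℝ) T × S => v₀ p.1 p.2)
    (hb : ∃ C, ∀ t ∈ Icc 0 T, ∀ x, |v₀ t x| ≤ C) :
    ∃ φ : ℝ → S → ℝ, IsBddMeas φ ∧
      (∀ t ∈ Icc 0 T, ∀ x, φ t x = Real.exp (θ * G.g x) + ∫ s in t..T, G.supInf θ φ s x) ∧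
      (∀ n d, (∀ t ∈ Icc 0 T, ∀ x,
          |G.iterClip θ T v₀ (n + 1) t x - G.iterClip θ T v₀ n t x| ≤ d) →
        ∀ t ∈ Icc 0 T, ∀ x, |φ t x - G.iterClip θ T v₀ (n + 1) t x| ≤
          d * (Real.exp (G.lip θ * (T - t)) - 1)) := by
  have hgood := G.isBddMeas_iterClip hc hG hθ hT hv hb
  set w := G.iterClip θ T v₀ with hw
  obtain ⟨d, hd⟩ : ∃ d, ∀ t ∈ Icc 0 T, ∀ x, |w 1 t x - w 0 t x| ≤ d := by
    obtain ⟨M, hM⟩ := (hgood 1).bdd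
    obtain ⟨M', hM'⟩ := (hgood 0).bdd
    exact ⟨M + M', fun t _ x => (abs_sub _ _).trans (add_le_add (hM t x) (hM' t x))⟩
  set e : ℕ → ℝ := fun n => G.lip θ ^ n * T ^ n / (n.factorial : ℝ) * |d| with he
  have hL := G.lip_nonneg (θ := θ) hθ
  have hen : ∀ n, ∀ t ∈ Icc 0 T, ∀ x, |w (n + 1) t x - w n t x| ≤ e n := by
    intro n t ht x
    have h1 := G.abs_iterClip_succ_sub_le hc hG hθ hT hv hb (n := 0) (d := d)
      (by simpa using hd) n ht x
    rw [zero_add] at h1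
    refine h1.trans (mul_le_mul ?_ (le_abs_self d) ((abs_nonneg _).trans (hd t ht x))
      (by positivity))
    have := pow_le_pow_left₀ (sub_nonneg.2 ht.2) (show T - t ≤ T by linarith [ht.1]) n
    gcongr
  have he0 : Tendsto e atTop (𝓝 0) := by
    have h1 := (FloorSemiring.tendsto_pow_div_factorial_atTop (G.lip θ * T)).mul_const |d|
    rw [zero_mul] at h1
    simpa only [he, mul_pow] using h1
  have hK : ∀ t ∈ Icc 0 T, Real.exp (G.lip θ * (T - t)) - 1 ≤ Real.exp (G.lip θ * T) := fun t ht => by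
    have : Real.exp (G.lip θ * (T - t)) ≤ Real.exp (G.lip θ * T) :=
      Real.exp_le_exp.2 (mul_le_mul_of_nonneg_left (by linarith [ht.1]) hL)
    linarith
  have htail : ∀ n m, ∀ t ∈ Icc 0 T, ∀ x, |w (n + 1 + m) t x - w (n + 1) t x| ≤
      e n * Real.exp (G.lip θ * T) := fun n m t ht x =>
    (G.abs_iterClip_add_sub_le hc hG hθ hT hv hb (hen n) m ht x).trans
      (mul_le_mul_of_nonneg_left (hK t ht) ((abs_nonneg _).trans (hen n t ht x)))
  have hcauchy : ∀ t x, ∃ l, Tendsto (fun n => w (n + 1) t x) atTop (𝓝 l) := by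
    intro t x
    refine cauchySeq_tendsto_of_complete (cauchySeq_of_le_tendsto_0'
      (fun n => e n * Real.exp (G.lip θ * T)) (fun n m hnm => ?_) ?_)
    · have h1 := htail n (m - n) (clip T t) (clip_mem hT t) x
      have h2 : n + 1 + (m - n) = m + 1 := by omega
      have h3 : ∀ k, w k (clip T t) x = w k t x := fun k => by
        simp only [hw, Model.iterClip, clip_of_mem (clip_mem hT t)]
      rw [h2, h3, h3] at h1
      rwa [dist_comm, Real.dist_eq]
    · simpa using he0.mul_const (Real.exp (G.lip θ * T))
  choose φ hφ using hcauchy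
  have hclose : ∀ n d, (∀ t ∈ Icc 0 T, ∀ x, |w (n + 1) t x - w n t x| ≤ d) →
      ∀ t ∈ Icc 0 T, ∀ x, |φ t x - w (n + 1) t x| ≤ d * (Real.exp (G.lip θ * (T - t)) - 1) := by
    intro n d hd t ht x
    have h1 : Tendsto (fun m => w (n + 1 + m) t x) atTop (𝓝 (φ t x)) := by
      have := (tendsto_add_atTop_iff_nat n).2 (hφ t x)
      refine this.congr fun m => ?_
      congr 1
      ring
    exact le_of_tendsto ((h1.sub_const _).abs) (Eventually.of_forall fun m =>
      G.abs_iterClip_add_sub_le hc hG hθ hT hv hb hd m ht x)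
  have hφgood : IsBddMeas φ := by
    refine ⟨measurable_of_tendsto_metrizable (fun n => (hgood (n + 1)).meas)
      (tendsto_pi_nhds.2 fun p => hφ p.1 p.2), ?_⟩
    obtain ⟨M, hM⟩ := (hgood 1).bdd
    refine ⟨M + e 0 * Real.exp (G.lip θ * T), fun t x => ?_⟩
    refine le_of_tendsto (hφ t x).abs (Eventually.of_forall fun m => ?_)
    have h1 := htail 0 m (clip T t) (clip_mem hT t) x
    have h3 : ∀ k, w k (clip T t) x = w k t x := fun k => by
      simp only [hw, Model.iterClip, clip_of_mem (clip_mem hT t)]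
    rw [h3, h3, zero_add, add_comm 1 m] at h1
    have h2 := abs_sub_abs_le_abs_sub (w (m + 1) t x) (w 1 t x)
    linarith [hM t x]
  refine ⟨φ, hφgood, fun t ht x => ?_, hclose⟩
  have hlim2 : Tendsto (fun n => w (n + 2) t x) atTop
      (𝓝 (Real.exp (θ * G.g x) + ∫ s in t..T, G.supInf θ φ s x)) := by
    refine tendsto_iff_norm_sub_tendsto_zero.2 (squeeze_zero (fun _ => norm_nonneg _)
      (g := fun n => G.lip θ * ((e n * Real.exp (G.lip θ * T)) * (T - t))) (fun n => ?_) ?_)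
    · have h0 : w (n + 2) t x = Real.exp (θ * G.g x) + ∫ s in t..T, G.supInf θ (w (n + 1)) s x :=
        G.iterClip_succ v₀ (n + 1) ht x
      rw [Real.norm_eq_abs, h0, add_sub_add_left_eq_sub]
      have h1 := G.abs_integral_supInf_sub_le hc hG hθ (hgood (n + 1)) hφgood
        (δ := fun _ => e n * Real.exp (G.lip θ * T)) continuous_const ht (fun s hs y => by
          rw [abs_sub_comm]
          exact (hclose n (e n) (hen n) s hs y).trans (mul_le_mul_of_nonneg_left (hK s hs)
            ((abs_nonneg _).trans (hen n s hs y)))) x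
      rwa [intervalIntegral.integral_const, smul_eq_mul, mul_comm (T - t)] at h1
    · simpa using ((he0.mul_const (Real.exp (G.lip θ * T))).mul_const (T - t)).const_mul (G.lip θ)
  exact tendsto_nhds_unique ((tendsto_add_atTop_iff_nat 1).2 (hφ t x)) hlim2

end Iteration

section Bounds

variable {S A B : Type*} [MeasurableSpace S] [StandardBorelSpace S]
  [MeasurableSpace A] [MeasurableSpace B] (G : Model S A B)
  [TopologicalSpace A] [TopologicalSpace.MetrizableSpace A] [SecondCountableTopology A]
  [BorelSpace A] [StandardBorelSpace A]
  [TopologicalSpace B] [TopologicalSpace.MetrizableSpace B] [SecondCountableTopology B]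
  [BorelSpace B] [StandardBorelSpace B] {θ T : ℝ}

theorem integral_mul_exp_sub (L t H : ℝ) :
    ∫ s in t..H, L * Real.exp (L * (H - s)) = Real.exp (L * (H - t)) - 1 := by
  have h : ∀ s ∈ uIcc t H, HasDerivAt (fun s => -Real.exp (L * (H - s)))
      (L * Real.exp (L * (H - s))) s := by
    intro s _
    have h1 := ((((hasDerivAt_id s).const_sub H).const_mul L).exp).neg
    exact h1.congr_deriv (by simp only [id_eq]; ring)
  rw [intervalIntegral.integral_eq_sub_of_hasDerivAt h (by
    exact Continuous.intervalIntegrable (by fun_prop) _ _)]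
  simp
  ring

/-- Bounds for the value by an approximate solution of the optimality equation. -/
theorem Model.value_bound (hc : G.CompactContinuous) (hG : G.IsBounded) (hθ : 0 ≤ θ)
    {v w : ℝ → S → ℝ} (hv : IsBddMeas v) (hw : IsBddMeas w) {d : ℝ} (hd0 : 0 ≤ d)
    (hd : ∀ t ∈ Icc 0 T, ∀ x, |w t x - v t x| ≤ d)
    (hwv : ∀ t ∈ Icc 0 T, ∀ x, w t x = Real.exp (θ * G.g x) + ∫ s in t..T, G.supInf θ v s x)
    {t₀ : ℝ} (ht₀ : t₀ ∈ Icc 0 T) {σ : ℝ} (hσ : σ = 1 ∨ σ = -1)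
    (π₁ : Policy G.actA) (π₂ : Policy G.actB)
    (hπ : ∀ k (h : Hist S k) s, t₀ + histTime h + s ∈ Icc 0 T →
      0 ≤ σ * (G.supInf θ v (t₀ + histTime h + s) (lastState h) -
      G.payoff θ v (t₀ + histTime h + s) (lastState h) (π₁.ker k (h, s)) (π₂.ker k (h, s))))
    (x : S) :
    0 ≤ σ * (w t₀ x - (G.value θ (T - t₀) π₁ π₂ x).toReal) +
      d * (Real.exp (G.lip θ * (T - t₀)) - 1) := by
  have hL := G.lip_nonneg (θ := θ) hθ
  have hσ2 : σ * σ = 1 := by rcases hσ with h | h <;> rw [h] <;> norm_num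
  have hσa : |σ| = 1 := by rcases hσ with h | h <;> rw [h] <;> norm_num
  have hH : 0 ≤ T - t₀ := sub_nonneg.2 ht₀.2
  set H := T - t₀ with hHdef
  set L := G.lip θ with hLdef
  obtain ⟨Mv, hMv⟩ := hv.bdd
  obtain ⟨Mw, hMw⟩ := hw.bdd
  have hsi := G.isBddMeas_supInf hc hG hθ hv
  obtain ⟨Ms, hMs⟩ := hsi.bdd
  set E : ℝ → ℝ := fun t => Real.exp (L * clip H (H - t)) with hE
  have hEm : Measurable E := Real.measurable_exp.comp
    (((measurable_clip H).comp (measurable_id.const_sub H)).const_mul L)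
  have hE1 : ∀ t, 1 ≤ E t := fun t => Real.one_le_exp (mul_nonneg hL (clip_mem hH _).1)
  have hEle : ∀ t, E t ≤ Real.exp (L * H) := fun t =>
    Real.exp_le_exp.2 (mul_le_mul_of_nonneg_left (clip_mem hH _).2 hL)
  have hEeq : ∀ t ∈ Icc 0 H, E t = Real.exp (L * (H - t)) := fun t ht => by
    simp only [hE]
    rw [clip_of_mem ⟨by linarith [ht.2], by linarith [ht.1]⟩]
  have hshift : Measurable fun p : ℝ × S => (t₀ + p.1, p.2) :=
    (measurable_fst.const_add t₀).prodMk measurable_snd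
  set u : ℝ → S → ℝ := fun t y => w (t₀ + t) y + σ * (d * (E t - 1)) with hu
  set η : ℝ → S → ℝ := fun t y => G.supInf θ v (t₀ + t) y + σ * (d * (L * E t)) with hη
  have hum : Measurable (Function.uncurry u) := (hw.meas.comp hshift).add
    ((((hEm.comp measurable_fst).sub_const 1).const_mul d).const_mul σ)
  have huM : ∀ t y, |u t y| ≤ Mw + d * Real.exp (L * H) := by
    intro t y
    refine (abs_add_le _ _).trans (add_le_add (hMw _ _) ?_)
    rw [abs_mul, hσa, one_mul, abs_of_nonneg (mul_nonneg hd0 (sub_nonneg.2 (hE1 t)))]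
    exact mul_le_mul_of_nonneg_left (by linarith [hEle t]) hd0
  have hηm : ∀ y, Measurable fun s => η s y := fun y =>
    ((hsi.meas.comp measurable_prodMk_right).comp (measurable_const_add t₀)).add
      (((hEm.const_mul L).const_mul d).const_mul σ)
  have hηM : ∀ s y, |η s y| ≤ Ms + d * (L * Real.exp (L * H)) := by
    intro t y
    have hE0 : 0 ≤ E t := zero_le_one.trans (hE1 t)
    refine (abs_add_le _ _).trans (add_le_add (hMs _ _) ?_)
    rw [abs_mul, hσa, one_mul, abs_of_nonneg (by positivity)]
    exact mul_le_mul_of_nonneg_left (mul_le_mul_of_nonneg_left (hEle t) hL) hd0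
  have huη : ∀ t ∈ Icc 0 H, ∀ y, u t y = Real.exp (θ * G.g y) + ∫ s in t..H, η s y := by
    intro t ht y
    have h1 : ∫ s in t..H, η s y = (∫ s in t..H, G.supInf θ v (t₀ + s) y) +
        ∫ s in t..H, σ * (d * (L * Real.exp (L * (H - s)))) := by
      rw [← intervalIntegral.integral_add]
      · refine intervalIntegral.integral_congr fun s hs => ?_
        rw [uIcc_of_le ht.2] at hs
        simp only [hη]
        rw [hEeq s ⟨ht.1.trans hs.1, hs.2⟩]
      · exact intervalIntegrable_of_abs_le ((hsi.meas.comp measurable_prodMk_right).comp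
          (measurable_const_add t₀)) (fun s => hMs _ y) t H
      · exact Continuous.intervalIntegrable (by fun_prop) _ _
    rw [h1, intervalIntegral.integral_const_mul, intervalIntegral.integral_const_mul,
      integral_mul_exp_sub, intervalIntegral.integral_comp_add_left (fun s => G.supInf θ v s y)]
    simp only [hu]
    rw [hwv (t₀ + t) ⟨add_nonneg ht₀.1 ht.1, by linarith [ht.2]⟩, hEeq t ht, hHdef, add_sub_cancel]
    ring
  have hmain := G.verification π₁ π₂ hG hθ hH hum huM hηm hηM huη (σ := σ) (fun k h s hs hsH => by
    have htm : t₀ + histTime h + s ∈ Icc 0 T :=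
      ⟨by linarith [ht₀.1, histTime_nonneg h], by linarith⟩
    have htH : histTime h + s ∈ Icc 0 H := ⟨by linarith [histTime_nonneg h], hsH⟩
    have h1 := hπ k h s htm
    have h2 := G.abs_payoff_sub_le hG hθ (v := u) (v' := fun t => v (t₀ + t)) (t := histTime h + s)
      hum.of_uncurry_left hv.meas.of_uncurry_left
      (M := max (Mw + d * Real.exp (L * H)) Mv) (fun y => (huM _ y).trans (le_max_left _ _))
      (fun y => (hMv _ y).trans (le_max_right _ _)) (δ := d * E (histTime h + s)) (fun y => by
        have h3 := hd (t₀ + (histTime h + s)) (by rwa [← add_assoc]) y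
        have h4 : |σ * (d * (E (histTime h + s) - 1))| = d * (E (histTime h + s) - 1) := by
          rw [abs_mul, hσa, one_mul, abs_of_nonneg (mul_nonneg hd0 (sub_nonneg.2 (hE1 _)))]
        have h5 := abs_add_le (w (t₀ + (histTime h + s)) y - v (t₀ + (histTime h + s)) y)
          (σ * (d * (E (histTime h + s) - 1)))
        rw [h4] at h5
        have h6 : u (histTime h + s) y - v (t₀ + (histTime h + s)) y =
          w (t₀ + (histTime h + s)) y - v (t₀ + (histTime h + s)) y +
            σ * (d * (E (histTime h + s) - 1)) := by
          simp only [hu]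
          ring
        rw [h6]
        linarith) (lastState h) (π₁.mem_probOn k (h, s)) (π₂.mem_probOn k (h, s))
    have h7 : G.payoff θ (fun t => v (t₀ + t)) (histTime h + s) (lastState h) (π₁.ker k (h, s))
        (π₂.ker k (h, s)) = G.payoff θ v (t₀ + histTime h + s) (lastState h) (π₁.ker k (h, s))
        (π₂.ker k (h, s)) := by
      simp only [Model.payoff, add_assoc]
    rw [h7] at h2
    simp only [hη]
    rw [← add_assoc t₀]
    set P := G.payoff θ v (t₀ + histTime h + s) (lastState h) (π₁.ker k (h, s)) (π₂.ker k (h, s))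
    set Q := G.payoff θ u (histTime h + s) (lastState h) (π₁.ker k (h, s)) (π₂.ker k (h, s))
    have h8 : |σ * (Q - P)| ≤ L * (d * E (histTime h + s)) := by rwa [abs_mul, hσa, one_mul]
    have h9 := (abs_le.1 h8).2
    have h10 : σ * (σ * (d * (L * E (histTime h + s)))) = d * (L * E (histTime h + s)) := by
      rw [← mul_assoc, hσ2, one_mul]
    linarith) x
  have hu0 : u 0 x = w t₀ x + σ * (d * (Real.exp (L * H) - 1)) := by
    simp only [hu]
    rw [hEeq 0 ⟨le_rfl, hH⟩, add_zero, sub_zero]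
  rw [hu0] at hmain
  have h11 : σ * (σ * (d * (Real.exp (L * H) - 1))) = d * (Real.exp (L * H) - 1) := by
    rw [← mul_assoc, hσ2, one_mul]
  linarith

/-- Bounds for the value when one player uses a policy realising the sup-inf. -/
theorem Model.value_bounds_of_realisesSupInf (hc : G.CompactContinuous) (hG : G.IsBounded)
    (hθ : 0 ≤ θ) {v w : ℝ → S → ℝ} (hv : IsBddMeas v) (hw : IsBddMeas w) {d : ℝ} (hd0 : 0 ≤ d)
    (hd : ∀ t ∈ Icc 0 T, ∀ x, |w t x - v t x| ≤ d)
    (hwv : ∀ t ∈ Icc 0 T, ∀ x, w t x = Real.exp (θ * G.g x) + ∫ s in t..T, G.supInf θ v s x)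
    {φ : MarkovPolicy G.actA} {ψ : MarkovPolicy G.actB}
    (hr : ∀ t ∈ Icc 0 T, ∀ x, G.RealisesSupInf θ v t x (φ.ker (x, t)) (ψ.ker (x, t)))
    {t₀ : ℝ} (ht₀ : t₀ ∈ Icc 0 T) (x : S) :
    (∀ π₁ : Policy G.actA, (G.value θ (T - t₀) π₁ (ψ.startAt t₀) x).toReal ≤
        w t₀ x + d * (Real.exp (G.lip θ * (T - t₀)) - 1)) ∧
      ∀ π₂ : Policy G.actB, w t₀ x - d * (Real.exp (G.lip θ * (T - t₀)) - 1) ≤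
        (G.value θ (T - t₀) (φ.startAt t₀) π₂ x).toReal := by
  constructor
  · intro π₁
    have h := G.value_bound hc hG hθ hv hw hd0 hd hwv ht₀ (σ := 1) (Or.inl rfl) π₁ (ψ.startAt t₀)
      (fun k h s hs => by
        obtain ⟨-, -, h3, h4, -⟩ := hr _ hs (lastState h)
        have h5 := h4 _ (π₁.mem_probOn k (h, s))
        rw [one_mul, sub_nonneg]
        exact h5.trans_eq h3) x
    linarith
  · intro π₂
    have h := G.value_bound hc hG hθ hv hw hd0 hd hwv ht₀ (σ := -1) (Or.inr rfl) (φ.startAt t₀) π₂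
      (fun k h s hs => by
        obtain ⟨-, -, h3, -, h4⟩ := hr _ hs (lastState h)
        have h5 := h4 _ (π₂.mem_probOn k (h, s))
        rw [neg_one_mul, neg_sub, sub_nonneg]
        exact h3.symm.trans_le h5) x
    linarith

end Bounds

section SupNorm

variable {S : Type*} {T : ℝ} {u : ℝ → S → ℝ}

theorem supNorm_le_ofReal {c : ℝ} (h : ∀ t ∈ Icc 0 T, ∀ x, |u t x| ≤ c) :
    supNorm T u ≤ ENNReal.ofReal c :=
  iSup₂_le fun t ht => iSup_le fun x => ENNReal.ofReal_le_ofReal (h t ht x)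

theorem ofReal_abs_le_supNorm {t : ℝ} (ht : t ∈ Icc 0 T) (x : S) :
    ENNReal.ofReal |u t x| ≤ supNorm T u :=
  le_iSup₂_of_le t ht (le_iSup (fun x => ENNReal.ofReal |u t x|) x)

theorem abs_le_toReal_supNorm (h : supNorm T u ≠ ∞) {t : ℝ} (ht : t ∈ Icc 0 T) (x : S) :
    |u t x| ≤ (supNorm T u).toReal :=
  (ENNReal.ofReal_le_iff_le_toReal h).1 (ofReal_abs_le_supNorm ht x)

end SupNorm

theorem le_add_ofReal_of_toReal_le {a b : ℝ≥0∞} (ha : a ≠ ∞) (hb : b ≠ ∞) {ε : ℝ} (hε : 0 ≤ ε)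
    (h : a.toReal ≤ b.toReal + ε) : a ≤ b + ENNReal.ofReal ε := by
  rw [← ENNReal.ofReal_toReal ha, ← ENNReal.ofReal_toReal hb,
    ← ENNReal.ofReal_add ENNReal.toReal_nonneg hε]
  exact ENNReal.ofReal_le_ofReal h

section Main

variable {S A B : Type*} [MeasurableSpace S] [StandardBorelSpace S]
  [MeasurableSpace A] [MeasurableSpace B] (G : Model S A B)

omit [StandardBorelSpace S] in
/-- The threshold of the stopping criterion controls the error `(e^{LT} - 1) d`. -/
theorem Model.two_mul_exp_sub_one_lt {θ T ε d : ℝ} (hθ : 0 < θ) (hq : 0 ≤ G.qNorm)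
    (hd0 : 0 ≤ d) (hd : d < G.threshold θ T ε) :
    2 * (d * (Real.exp (G.lip θ * T) - 1)) < ε := by
  have h1 : 0 ≤ 2 * G.qNorm / (θ * G.rNorm) :=
    div_nonneg (by linarith) (mul_nonneg hθ.le G.rNorm_nonneg)
  have h2 : 0 < Real.exp (G.lip θ * T) := Real.exp_pos _
  have h3 : d * (2 * Real.exp (G.lip θ * T) * (1 + 2 * G.qNorm / (θ * G.rNorm))) < ε := by
    rw [← lt_div_iff₀ (by positivity)]
    exact hd
  have h4 : 0 ≤ d * (2 * Real.exp (G.lip θ * T) * (2 * G.qNorm / (θ * G.rNorm))) := by positivity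
  nlinarith

omit [StandardBorelSpace S] in
theorem Model.threshold_pos {θ T ε : ℝ} (hθ : 0 < θ) (hε : 0 < ε) (hq : 0 ≤ G.qNorm) :
    0 < G.threshold θ T ε := by
  have h1 : 0 ≤ 2 * G.qNorm / (θ * G.rNorm) :=
    div_nonneg (by linarith) (mul_nonneg hθ.le G.rNorm_nonneg)
  exact div_pos hε (by positivity)

variable [TopologicalSpace A] [TopologicalSpace.MetrizableSpace A] [SecondCountableTopology A]
  [BorelSpace A] [StandardBorelSpace A]
  [TopologicalSpace B] [TopologicalSpace.MetrizableSpace B] [SecondCountableTopology B]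
  [BorelSpace B] [StandardBorelSpace B] {θ T : ℝ}

/-- A solution of the optimality equation is the value function of the game. -/
theorem Model.isValueFunction_of_optimality (hc : G.CompactContinuous) (hG : G.IsBounded)
    (hθ : 0 ≤ θ) (hT : 0 ≤ T) {φ : ℝ → S → ℝ} (hφ : IsBddMeas φ)
    (hopt : ∀ t ∈ Icc 0 T, ∀ x, φ t x = Real.exp (θ * G.g x) + ∫ s in t..T, G.supInf θ φ s x) :
    G.IsValueFunction θ T φ := by
  obtain ⟨M, hM⟩ := hφ.bdd
  obtain ⟨π, ρ, hr⟩ := G.exists_realisesSupInf hc hG hθ hφ.meas hM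
  have hb : ∀ t ∈ Icc 0 T, ∀ x,
      (∀ π₁ : Policy G.actA, G.value θ (T - t) π₁ (ρ.startAt t) x ≤ ENNReal.ofReal (φ t x)) ∧
      ∀ π₂ : Policy G.actB, ENNReal.ofReal (φ t x) ≤ G.value θ (T - t) (π.startAt t) π₂ x := by
    intro t ht x
    obtain ⟨h1, h2⟩ := G.value_bounds_of_realisesSupInf hc hG hθ hφ hφ le_rfl (by simp) hopt
      (fun t _ x => hr t x) ht x
    simp only [zero_mul, add_zero, sub_zero] at h1 h2
    have hfin := fun π₁ π₂ =>
      (G.integral_atHorizon_tendsto π₁ π₂ hG hθ (sub_nonneg.2 ht.2) x).1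
    refine ⟨fun π₁ => ?_, fun π₂ => ?_⟩
    · rw [← ENNReal.ofReal_toReal (hfin π₁ _)]
      exact ENNReal.ofReal_le_ofReal (h1 π₁)
    · rw [← ENNReal.ofReal_toReal (hfin _ π₂)]
      exact ENNReal.ofReal_le_ofReal (h2 π₂)
  have h0 : (0 : ℝ) ∈ Icc 0 T := ⟨le_rfl, hT⟩
  have hb0 := hb 0 h0
  simp only [sub_zero] at hb0
  refine ⟨fun t ht x => ?_, fun t ht x => ?_, fun t ht x => ?_, fun x => ?_, fun x => ?_⟩
  · exact ENNReal.toReal_nonneg.trans ((G.value_bounds_of_realisesSupInf hc hG hθ hφ hφ le_rfl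
      (by simp) hopt (fun t _ x => hr t x) ht x).1 (π.startAt t) |>.trans_eq (by simp))
  · exact le_antisymm (iSup_le fun π₁ => iInf_le_of_le ρ ((hb t ht x).1 _))
      (le_iSup_of_le π (le_iInf fun π₂ => (hb t ht x).2 _))
  · exact le_antisymm (iInf_le_of_le ρ (iSup_le fun π₁ => (hb t ht x).1 _))
      (le_iInf fun π₂ => le_iSup_of_le π ((hb t ht x).2 _))
  · exact le_antisymm (iSup_le fun π₁ => iInf_le_of_le (ρ.startAt 0) ((hb0 x).1 _))
      (le_iSup_of_le (π.startAt 0) (le_iInf fun π₂ => (hb0 x).2 _))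
  · exact le_antisymm (iInf_le_of_le (ρ.startAt 0) (iSup_le fun π₁ => (hb0 x).1 _))
      (le_iInf fun π₂ => le_iSup_of_le (π.startAt 0) ((hb0 x).2 _))

end Main

end RiskGame

theorem theorem5p1 {S A B : Type*}
    [MeasurableSpace S] [StandardBorelSpace S]
    [TopologicalSpace A] [TopologicalSpace.MetrizableSpace A] [SecondCountableTopology A]
    [MeasurableSpace A] [BorelSpace A] [StandardBorelSpace A]
    [TopologicalSpace B] [TopologicalSpace.MetrizableSpace B] [SecondCountableTopology B]
    [MeasurableSpace B] [BorelSpace B] [StandardBorelSpace B]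
    (G : RiskGame.Model S A B) (θ T : ℝ) (hθ : 0 < θ) (hT : 0 < T)
    (hcont : G.CompactContinuous) (hbdd : G.IsBounded)
    (v₀ : ℝ → S → ℝ)
    (hv₀_meas : Measurable fun p : Set.Icc (0 : ℝ) T × S => v₀ p.1 p.2)
    (hv₀_bdd : ∃ C : ℝ, ∀ t ∈ Set.Icc (0 : ℝ) T, ∀ x, |v₀ t x| ≤ C) :
    ∃ φ : ℝ → S → ℝ, G.IsValueFunction θ T φ ∧
      -- factorial bounds
      (∀ n : ℕ, ∀ t ∈ Set.Icc (0 : ℝ) T, ∀ x,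
        ENNReal.ofReal |G.iter θ T v₀ (n + 1) t x - G.iter θ T v₀ n t x| ≤
          ENNReal.ofReal ((θ * G.rNorm + 2 * G.qNorm) ^ n * (T - t) ^ n / (n.factorial : ℝ)) *
            RiskGame.supNorm T (G.iter θ T v₀ 1 - v₀)) ∧
      (∀ n : ℕ, RiskGame.supNorm T (φ - G.iter θ T v₀ (n + 1)) ≤
          ENNReal.ofReal ((θ * G.rNorm + 2 * G.qNorm) ^ n * T ^ n / (n.factorial : ℝ) *
            Real.exp ((θ * G.rNorm + 2 * G.qNorm) * T)) *
            RiskGame.supNorm T (G.iter θ T v₀ 1 - v₀)) ∧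
      RiskGame.supNorm T (G.iter θ T v₀ 1 - v₀) < ⊤ ∧
      -- uniform convergence
      Filter.Tendsto (fun n => RiskGame.supNorm T (G.iter θ T v₀ n - φ)) Filter.atTop (nhds 0) ∧
      -- the stopping criterion is eventually met, and `v_{n+1}` is then `ε/2`-close to `φ`
      (∀ ε : ℝ, 0 < ε → ∃ N₁ : ℕ, 0 < N₁ ∧ ∀ n ≥ N₁,
        RiskGame.supNorm T (G.iter θ T v₀ (n + 1) - G.iter θ T v₀ n) <
            ENNReal.ofReal (G.threshold θ T ε) ∧
          RiskGame.supNorm T (φ - G.iter θ T v₀ (n + 1)) < ENNReal.ofReal (ε / 2)) ∧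
      (∀ ε : ℝ, 0 < ε → ∀ n : ℕ,
        RiskGame.supNorm T (G.iter θ T v₀ (n + 1) - G.iter θ T v₀ n) <
            ENNReal.ofReal (G.threshold θ T ε) →
          RiskGame.supNorm T (φ - G.iter θ T v₀ (n + 1)) < ENNReal.ofReal (ε / 2)) ∧
      -- Markov policies that realise the sup-inf at every stage exist
      (∀ n : ℕ, ∃ (φn : RiskGame.MarkovPolicy G.actA) (ψn : RiskGame.MarkovPolicy G.actB),
        ∀ t ∈ Set.Icc (0 : ℝ) T, ∀ x,
          G.RealisesSupInf θ (G.iter θ T v₀ n) t x (φn.ker (x, t)) (ψn.ker (x, t))) ∧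
      -- any such policies are `ε`-optimal as soon as the stopping criterion is met
      (∀ ε : ℝ, 0 < ε → ∀ n : ℕ,
        RiskGame.supNorm T (G.iter θ T v₀ (n + 1) - G.iter θ T v₀ n) <
            ENNReal.ofReal (G.threshold θ T ε) →
        ∀ (φn : RiskGame.MarkovPolicy G.actA) (ψn : RiskGame.MarkovPolicy G.actB),
        (∀ t ∈ Set.Icc (0 : ℝ) T, ∀ x,
          G.RealisesSupInf θ (G.iter θ T v₀ n) t x (φn.ker (x, t)) (ψn.ker (x, t))) →
          (∀ t ∈ Set.Icc (0 : ℝ) T, ∀ x, G.J θ T φn ψn t x < ⊤) ∧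
          RiskGame.supNorm T (fun t x => (G.J θ T φn ψn t x).toReal - φ t x) <
            ENNReal.ofReal ε ∧
          G.IsEpsNash θ T ε (φn.startAt 0) (ψn.startAt 0)) := by
  have hL := G.lip_nonneg hθ.le
  have hgood := G.isBddMeas_iterClip hcont hbdd hθ.le hT.le hv₀_meas hv₀_bdd
  obtain ⟨φ, hφ, hopt, hclose⟩ :=
    G.exists_limit_iterClip hcont hbdd hθ.le hT.le hv₀_meas hv₀_bdd
  set w := G.iterClip θ T v₀ with hw
  have hwmem : ∀ n, ∀ t ∈ Set.Icc (0 : ℝ) T, w n t = G.iter θ T v₀ n t := fun n t ht =>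
    G.iterClip_of_mem v₀ n ht
  have hfin : ∀ n, RiskGame.supNorm T (G.iter θ T v₀ (n + 1) - G.iter θ T v₀ n) < ⊤ := by
    intro n
    obtain ⟨M, hM⟩ := (hgood (n + 1)).bdd
    obtain ⟨M', hM'⟩ := (hgood n).bdd
    refine (RiskGame.supNorm_le_ofReal (c := M + M') fun t ht x => ?_).trans_lt ENNReal.ofReal_lt_top
    rw [Pi.sub_apply, Pi.sub_apply, ← hwmem _ t ht, ← hwmem _ t ht]
    exact (abs_sub _ _).trans (add_le_add (hM t x) (hM' t x))
  set d : ℕ → ℝ := fun n =>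
    (RiskGame.supNorm T (G.iter θ T v₀ (n + 1) - G.iter θ T v₀ n)).toReal with hd
  have hd0 : ∀ n, 0 ≤ d n := fun n => ENNReal.toReal_nonneg
  have hdw : ∀ n, ∀ t ∈ Set.Icc (0 : ℝ) T, ∀ x, |w (n + 1) t x - w n t x| ≤ d n := by
    intro n t ht x
    rw [hwmem _ t ht, hwmem _ t ht]
    exact RiskGame.abs_le_toReal_supNorm (hfin n).ne ht x
  have hofReal : ∀ n, ENNReal.ofReal (d n) =
      RiskGame.supNorm T (G.iter θ T v₀ (n + 1) - G.iter θ T v₀ n) := fun n =>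
    ENNReal.ofReal_toReal (hfin n).ne
  have hexp : ∀ t ∈ Set.Icc (0 : ℝ) T,
      Real.exp (G.lip θ * (T - t)) - 1 ≤ Real.exp (G.lip θ * T) - 1 := fun t ht =>
    sub_le_sub_right (Real.exp_le_exp.2 (mul_le_mul_of_nonneg_left (by linarith [ht.1]) hL)) _
  have hφw : ∀ n c, (∀ t ∈ Set.Icc (0 : ℝ) T, ∀ x, |w (n + 1) t x - w n t x| ≤ c) → 0 ≤ c →
      ∀ t ∈ Set.Icc (0 : ℝ) T, ∀ x,
        |φ t x - w (n + 1) t x| ≤ c * (Real.exp (G.lip θ * T) - 1) := fun n c hc hc0 t ht x =>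
    (hclose n c hc t ht x).trans (mul_le_mul_of_nonneg_left (hexp t ht) hc0)
  have hφsup : ∀ n c, (∀ t ∈ Set.Icc (0 : ℝ) T, ∀ x, |w (n + 1) t x - w n t x| ≤ c) → 0 ≤ c →
      RiskGame.supNorm T (φ - G.iter θ T v₀ (n + 1)) ≤
        ENNReal.ofReal (c * (Real.exp (G.lip θ * T) - 1)) := fun n c hc hc0 =>
    RiskGame.supNorm_le_ofReal fun t ht x => by
      rw [Pi.sub_apply, Pi.sub_apply, ← hwmem _ t ht]
      exact hφw n c hc hc0 t ht x
  have hfact : ∀ n, ∀ t ∈ Set.Icc (0 : ℝ) T, ∀ x, |w (n + 1) t x - w n t x| ≤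
      G.lip θ ^ n * (T - t) ^ n / (n.factorial : ℝ) * d 0 := by
    intro n t ht x
    have := G.abs_iterClip_succ_sub_le hcont hbdd hθ.le hT.le hv₀_meas hv₀_bdd (n := 0) (hdw 0) n
      ht x
    rwa [zero_add] at this
  have hfactT : ∀ n, ∀ t ∈ Set.Icc (0 : ℝ) T, ∀ x, |w (n + 1) t x - w n t x| ≤
      G.lip θ ^ n * T ^ n / (n.factorial : ℝ) * d 0 := by
    intro n t ht x
    refine (hfact n t ht x).trans (mul_le_mul_of_nonneg_right ?_ (hd0 0))
    have := pow_le_pow_left₀ (sub_nonneg.2 ht.2) (show T - t ≤ T by linarith [ht.1]) n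
    gcongr
  have hfact0 : ∀ n : ℕ, 0 ≤ G.lip θ ^ n * T ^ n / (n.factorial : ℝ) * d 0 := fun n =>
    mul_nonneg (by positivity) (hd0 0)
  have hfactlim : Filter.Tendsto (fun n : ℕ => G.lip θ ^ n * T ^ n / (n.factorial : ℝ) * d 0)
      Filter.atTop (nhds 0) := by
    have h1 := (FloorSemiring.tendsto_pow_div_factorial_atTop (G.lip θ * T)).mul_const (d 0)
    rw [zero_mul] at h1
    simpa only [mul_pow] using h1
  have hdle : ∀ n, RiskGame.supNorm T (G.iter θ T v₀ (n + 1) - G.iter θ T v₀ n) ≤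
      ENNReal.ofReal (G.lip θ ^ n * T ^ n / (n.factorial : ℝ) * d 0) := fun n =>
    RiskGame.supNorm_le_ofReal fun t ht x => by
      rw [Pi.sub_apply, Pi.sub_apply, ← hwmem _ t ht, ← hwmem _ t ht]
      exact hfactT n t ht x
  have hdlt : ∀ {ε : ℝ}, 0 < ε → ∀ {n : ℕ},
      RiskGame.supNorm T (G.iter θ T v₀ (n + 1) - G.iter θ T v₀ n) <
        ENNReal.ofReal (G.threshold θ T ε) →
      2 * (d n * (Real.exp (G.lip θ * T) - 1)) < ε := by
    intro ε hε n hn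
    refine G.two_mul_exp_sub_one_lt hθ G.qNorm_nonneg (hd0 n) ?_
    rw [← hofReal] at hn
    exact (ENNReal.ofReal_lt_ofReal_iff (G.threshold_pos hθ hε G.qNorm_nonneg)).1 hn
  have hcrit : ∀ ε : ℝ, 0 < ε → ∀ n : ℕ,
      RiskGame.supNorm T (G.iter θ T v₀ (n + 1) - G.iter θ T v₀ n) <
          ENNReal.ofReal (G.threshold θ T ε) →
        RiskGame.supNorm T (φ - G.iter θ T v₀ (n + 1)) < ENNReal.ofReal (ε / 2) := by
    intro ε hε n hn
    refine (hφsup n (d n) (hdw n) (hd0 n)).trans_lt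
      ((ENNReal.ofReal_lt_ofReal_iff (half_pos hε)).2 ?_)
    linarith [hdlt hε hn]
  refine ⟨φ, G.isValueFunction_of_optimality hcont hbdd hθ.le hT.le hφ hopt, fun n t ht x => ?_,
    fun n => ?_, hfin 0, ?_, fun ε hε => ?_, hcrit, fun n => ?_, fun ε hε n hn φn ψn hr => ?_⟩
  · have h1 : RiskGame.supNorm T (G.iter θ T v₀ 1 - v₀) = ENNReal.ofReal (d 0) := (hofReal 0).symm
    rw [h1, ← ENNReal.ofReal_mul' (hd0 0), ← hwmem _ t ht, ← hwmem _ t ht]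
    exact ENNReal.ofReal_le_ofReal (hfact n t ht x)
  · have h1 : RiskGame.supNorm T (G.iter θ T v₀ 1 - v₀) = ENNReal.ofReal (d 0) := (hofReal 0).symm
    rw [h1, ← ENNReal.ofReal_mul' (hd0 0)]
    refine (hφsup n _ (hfactT n) (hfact0 n)).trans (ENNReal.ofReal_le_ofReal ?_)
    have h2 := mul_le_mul_of_nonneg_left
      (show Real.exp (G.lip θ * T) - 1 ≤ Real.exp (G.lip θ * T) by linarith) (hfact0 n)
    refine h2.trans_eq ?_
    rw [RiskGame.Model.lip]
    ring
  · rw [← Filter.tendsto_add_atTop_iff_nat 1]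
    have h1 := (ENNReal.tendsto_ofReal (hfactlim.mul_const (Real.exp (G.lip θ * T) - 1)))
    rw [zero_mul, ENNReal.ofReal_zero] at h1
    refine tendsto_of_tendsto_of_tendsto_of_le_of_le tendsto_const_nhds h1 (fun _ => zero_le)
      fun n => RiskGame.supNorm_le_ofReal fun t ht x => ?_
    rw [Pi.sub_apply, Pi.sub_apply, ← hwmem _ t ht, abs_sub_comm]
    exact hφw n _ (hfactT n) (hfact0 n) t ht x
  · have h1 := G.threshold_pos (T := T) hθ hε G.qNorm_nonneg
    obtain ⟨N, hN⟩ := Filter.eventually_atTop.1 (hfactlim.eventually_lt_const h1)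
    refine ⟨N + 1, N.succ_pos, fun n hn => ?_⟩
    have h2 : RiskGame.supNorm T (G.iter θ T v₀ (n + 1) - G.iter θ T v₀ n) <
        ENNReal.ofReal (G.threshold θ T ε) :=
      (hdle n).trans_lt ((ENNReal.ofReal_lt_ofReal_iff h1).2 (hN n (by omega)))
    exact ⟨h2, hcrit ε hε n h2⟩
  · obtain ⟨M, hM⟩ := (hgood n).bdd
    obtain ⟨φn, ψn, h⟩ := G.exists_realisesSupInf hcont hbdd hθ.le (hgood n).meas hM
    exact ⟨φn, ψn, fun t ht x => (h t x).congr (hwmem n t ht)⟩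
  · have hlt := hdlt hε hn
    have hr' : ∀ t ∈ Set.Icc (0 : ℝ) T, ∀ x,
        G.RealisesSupInf θ (w n) t x (φn.ker (x, t)) (ψn.ker (x, t)) := fun t ht x =>
      (hr t ht x).congr (hwmem n t ht).symm
    have hvf : ∀ t ∈ Set.Icc (0 : ℝ) T, ∀ π₁ π₂ x, G.value θ (T - t) π₁ π₂ x ≠ ⊤ :=
      fun t ht π₁ π₂ x => (G.integral_atHorizon_tendsto π₁ π₂ hbdd hθ.le (sub_nonneg.2 ht.2) x).1
    have hb : ∀ t ∈ Set.Icc (0 : ℝ) T, ∀ x,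
        (∀ π₁ : RiskGame.Policy G.actA, (G.value θ (T - t) π₁ (ψn.startAt t) x).toReal ≤
          w (n + 1) t x + d n * (Real.exp (G.lip θ * T) - 1)) ∧
        ∀ π₂ : RiskGame.Policy G.actB, w (n + 1) t x - d n * (Real.exp (G.lip θ * T) - 1) ≤
          (G.value θ (T - t) (φn.startAt t) π₂ x).toReal := by
      intro t ht x
      obtain ⟨h1, h2⟩ := G.value_bounds_of_realisesSupInf hcont hbdd hθ.le (hgood n) (hgood (n + 1))
        (hd0 n) (hdw n) (fun t ht x => G.iterClip_succ v₀ n ht x) hr' ht x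
      have h3 := mul_le_mul_of_nonneg_left (hexp t ht) (hd0 n)
      exact ⟨fun π₁ => (h1 π₁).trans (add_le_add_right h3 _),
        fun π₂ => (sub_le_sub_left h3 _).trans (h2 π₂)⟩
    refine ⟨fun t ht x => (hvf t ht _ _ x).lt_top, ?_, fun x => ?_⟩
    · refine (RiskGame.supNorm_le_ofReal
        (c := 2 * (d n * (Real.exp (G.lip θ * T) - 1))) fun t ht x => ?_).trans_lt
        ((ENNReal.ofReal_lt_ofReal_iff hε).2 hlt)
      have h1 := (hb t ht x).1 (φn.startAt t)
      have h2 := (hb t ht x).2 (ψn.startAt t)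
      have h3 := abs_le.1 (hφw n (d n) (hdw n) (hd0 n) t ht x)
      change |(G.value θ (T - t) (φn.startAt t) (ψn.startAt t) x).toReal - φ t x| ≤ _
      rw [abs_le]
      constructor <;> linarith [h3.1, h3.2]
    · have h0 : (0 : ℝ) ∈ Set.Icc (0 : ℝ) T := ⟨le_rfl, hT.le⟩
      have hb0 := hb 0 h0 x
      have hf0 := hvf 0 h0
      rw [sub_zero] at hb0 hf0
      refine ⟨fun π₁ => ?_, fun π₂ => ?_⟩
      · refine RiskGame.le_add_ofReal_of_toReal_le (hf0 _ _ x) (hf0 _ _ x) hε.le ?_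
        linarith [hb0.1 π₁, hb0.2 (ψn.startAt 0)]
      · refine RiskGame.le_add_ofReal_of_toReal_le (hf0 _ _ x) (hf0 _ _ x) hε.le ?_
        linarith [hb0.1 (φn.startAt 0), hb0.2 π₂]
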